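/- **Setting.** Let $\mathbb S^n$ be the space of real symmetric $n\times n$ matrices with the trace inner product, $\mathbb S^n_+$ its positive semidefinite cone, $\mathbb W$ a finite dimensional real Euclidean space, $\mathcal A:\mathbb S^n\to\mathbb R^m$ and $\mathcal F:\mathbb S^n\to\mathbb W$ linear maps, $b\in\mathbb R^m$, $C\in\mathbb S^n$, and $\mathcal Q\subseteq\mathbb R^m$ a convex polyhedral cone. Let $h:\mathbb W\to(-\infty,+\infty]$ have a non-empty open convex domain on which it is continuously differentiable and strictly convex. For a cone $D$ put $D^\circ=\{x\mid\langle x,d\rangle\le0\ \forall d\in D\}$ and $D^*=-D^\circ$; $\mathcal T_D$, $\mathcal N_D$, $\delta_D$, $\Pi_D$ denote tangent cone, normal cone, indicator function and metric projection of a convex set $D$. Consider the convex SDP $\min\{h(\mathcal FX)+\langle C,X\rangle+\delta_{\mathbb S^n_+}(X)\mid b-\mathcal AX\in\mathcal Q^\circ\}$ and its dual $$\text{(D)}\qquad \min\ \delta_{\mathcal Q}(y)-\langle b,y\rangle+h^*(-w)+\delta_{\mathbb S^n_+}(S)\quad\text{s.t.}\quad \mathcal A^*y+\mathcal F^*w+S=C,$$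 with Lagrangian $l(z,X)=\delta_{\mathcal Q}(y)-\langle b,y\rangle+h^*(-w)+\delta_{\mathbb S^n_+}(S)+\langle X,\mathcal A^*y+\mathcal F^*w+S-C\rangle$, $z=(y,w,S)\in\mathbb Z:=\mathbb R^m\times\mathbb W\times\mathbb S^n$. Put $\mathbb E:=\mathbb Z\times\mathbb S^n$ and $\mathcal T_l(z,X):=\{(u,V)\in\mathbb E\mid(u,-V)\in\partial l(z,X)\}$. For $z=(y,w,S)$, let $\mathcal M_\psi(z)$ be the set of all $X$ with $b-\mathcal AX\in\mathcal N_{\mathcal Q}(y)$, $\mathcal FX\in\partial h^*(-w)$, $-X\in\mathcal N_{\mathbb S^n_+}(S)$, $\mathcal A^*y+\mathcal F^*w+S=C$. Assume that $h^*$ is continuously differentiable on its domain (which is therefore open) and that $\nabla h^*$ is directionally differentiable in the sense of Hadamard at every point $x$ of the domain, i.e. for every $d$ the limit of $(\nabla h^*(x+td')-\nabla h^*(x))/t$ as $t\downarrow0$, $d'\to d$ exists; it is denoted by $(\nabla h^*)'(x;d)$. Let $\bar z=(\bar y,\bar w,\overline S)$ be an optimal solution of (D), $\overline X\in\mathcal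 M_\psi(\bar z)$, $\bar q=b-\mathcal A\overline X$. Write $\mathcal C_D(x,v)=\mathcal T_D(x)\cap v^\perp$. Let $\mathcal C_{\mathcal Q}(\bar y,\bar q)=\{y\in\mathbb R^m\mid Qy\le0\}$ with $Q\in\mathbb R^{r\times m}$ (rows $Q_i$), let $\mathcal I_Q$ be the collection of all $a\subseteq\{1,\dots,r\}$ such that some $y$ satisfies $Q_iy=0$ for $i\in a$ and $Q_iy<0$ for $i\notin a$, and $L_a=\{y\mid Q_iy=0\ \forall i\in a\}$. Define $\mathcal K:=(\mathcal C_{\mathbb S^n_+}(\overline S,\overline X))^*$, $$\Xi:=\{(d_y,d_w,d_S,d_X)\in\mathbb E\mid\mathcal A^*d_y+\mathcal F^*d_w+d_S=0,\ \mathcal Fd_X-(\nabla h^*)'(-\bar w;-d_w)=0\},$$ and let $\mathcal C(\bar z,\overline X)$ be the set of all $(d_y,d_w,d_S,d_X)\in\mathbb E$ with $d_y\in\mathcal C_{\mathcal Q}(\bar y,\bar q)$, $d_S\in\mathcal C_{\mathbb S^n_+}(\overline S,\overline X)$, $d_X\in\mathcal C_{\mathbb S^n_+}(\overline X,\overline S)$,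 $-\mathcal Ad_X\in\mathcal C_{\mathcal Q^\circ}(\bar q,\bar y)$, $\langle d_y,\mathcal Ad_X\rangle=0$ and $\overline X^{1/2}d_S(\overline S^{1/2})^\dagger+(\overline X^{1/2})^\dagger d_X\overline S^{1/2}=0$, where $^\dagger$ is the Moore–Penrose pseudo-inverse. Let $\mathcal C_\psi(\bar z)$ be the critical cone of (D): all $(d_y,d_w,d_S)\in\mathbb Z$ with $\mathcal A^*d_y+\mathcal F^*d_w+d_S=0$, $d_y\in\mathcal T_{\mathcal Q}(\bar y)$, $d_S\in\mathcal T_{\mathbb S^n_+}(\overline S)$, $-\langle b,d_y\rangle-\langle\nabla h^*(-\bar w),d_w\rangle=0$. **Theorem.** Assume: (i) the sets $\mathcal F\mathcal K$ and $\{\mathcal AG-q\mid G\in\mathcal K,\ q\in\mathcal C_{\mathcal Q^\circ}(\bar q,\bar y)\cap L_a^\perp\}$, $a\in\mathcal I_Q$, are closed; (ii) $\langle\Pi_{\mathcal K}(d_X),\Pi_{\mathcal K}(d_S)\rangle=0$ for all $(d_y,d_w,d_S,d_X)\in\mathcal C(\bar z,\overline X)\cap\Xi$; (iii) the second order sufficient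 condition of (D) holds at $\bar z$ with respect to $\overline X$: $\langle -d_w,(\nabla h^*)'(-\bar w;-d_w)\rangle+2\langle\overline X,d_S\overline S^\dagger d_S\rangle>0$ for all $0\ne(d_y,d_w,d_S)\in\mathcal C_\psi(\bar z)$. Then there are $\kappa>0$ and a neighborhood $\mathcal U$ of $(\bar z,\overline X)$ such that for all $(u,V)\in\mathbb E$, $$\|z-\bar z\|\le\kappa\|(u,V)\|\qquad\text{for all }(z,X)\in\mathcal T_l^{-1}(u,V)\cap\mathcal U.$$ If, in addition, $\nabla h^*$ is Lipschitz continuous on a neighborhood of $-\bar w$ and there is $\widehat X\in\mathcal M_\psi(\bar z)$ with $\operatorname{rank}(\widehat X)+\operatorname{rank}(\overline S)=n$, then $\mathcal T_l$ is metrically subregular at $(\bar z,\overline X)$ for the origin: there are $\kappa'>0$ and a neighborhood $\mathcal U'$ of $(\bar z,\overline X)$ such that $\operatorname{dist}(\xi,\mathcal T_l^{-1}(0))\le\kappa'\operatorname{dist}(0,\mathcal T_l(\xi))$ for all $\xi\in\mathcal U'$, where $\operatorname{dist}(0,\emptyset)=\infty$. -/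

import Mathlib

open Set Filter Topology Matrix
open scoped RealInnerProductSpace Pointwise NNReal

noncomputable section

namespace SDP

/-! ### Convex analysis in a real inner product space -/

section ConvexAnalysis

variable {E : Type*} [NormedAddCommGroup E] [InnerProductSpace ℝ E]
variable {E' : Type*} [NormedAddCommGroup E'] [InnerProductSpace ℝ E']

/-- Effective domain of an extended-real-valued function with values in `(-∞, +∞]`. -/
def effDom (f : E → EReal) : Set E := {x | f x < ⊤}

/-- Fenchel conjugate `f*(u) = sup_x (⟪x, u⟫ - f x)`. -/
def conjugate (f : E → EReal) (u : E) : EReal := ⨆ x : E, ((⟪x, u⟫ : ℝ) : EReal) - f x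

open Classical in
/-- Indicator function `δ_D`. -/
def indicatorFun (D : Set E) (x : E) : EReal := if x ∈ D then 0 else ⊤

/-- Subdifferential `∂f(x)` of a proper convex function. -/
def subdifferential (f : E → EReal) (x : E) : Set E :=
  {v | f x < ⊤ ∧ ∀ x', f x + ((⟪v, x' - x⟫ : ℝ) : EReal) ≤ f x'}

/-- Subdifferential `∂l(z, x)` of a convex-concave function `l`: pairs `(u, v)` with `u` a
subgradient of `l(·, x)` at `z` and `v` a supergradient of `l(z, ·)` at `x`. -/
def saddleSubdifferential (l : E → E' → EReal) (z : E) (x : E') : Set (E × E') :=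
  {p | (∀ z', l z x + ((⟪p.1, z' - z⟫ : ℝ) : EReal) ≤ l z' x) ∧
       (∀ x', l z x' ≤ l z x + ((⟪p.2, x' - x⟫ : ℝ) : EReal))}

/-- Normal cone of a convex set (empty at points outside of the set). -/
def normalCone (D : Set E) (x : E) : Set E := {v | x ∈ D ∧ ∀ d ∈ D, ⟪v, d - x⟫ ≤ 0}

/-- Polar cone `D° = {x | ⟪x, d⟫ ≤ 0 for all d ∈ D}`. -/
def polarCone (D : Set E) : Set E := {x | ∀ d ∈ D, ⟪x, d⟫ ≤ 0}

/-- Dual cone `D* = -D°`. -/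
def dualCone (D : Set E) : Set E := -polarCone D

/-- Critical cone `T_D(x) ∩ v^⊥` of a convex set `D` at `x` associated with `v`.  For convex `D`
and `x ∈ D`, `posTangentConeAt D x` is the tangent cone of convex analysis. -/
def criticalCone (D : Set E) (x v : E) : Set E := {d | d ∈ posTangentConeAt D x ∧ ⟪v, d⟫ = 0}

/-- `p` is a nearest point of `D` to `x`. -/
def IsMetricProj (D : Set E) (x p : E) : Prop := p ∈ D ∧ ∀ d ∈ D, ‖x - p‖ ≤ ‖x - d‖

/-- The metric projection `Π_D(x)` onto a nonempty closed convex set `D`. -/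
def metricProj (D : Set E) (x : E) : E := Classical.epsilon (IsMetricProj D x)

theorem isMetricProj_metricProj [CompleteSpace E] {D : Set E} (hne : D.Nonempty)
    (hcl : IsClosed D) (hcv : Convex ℝ D) (x : E) : IsMetricProj D x (metricProj D x) := by
  apply Classical.epsilon_spec (p := IsMetricProj D x)
  obtain ⟨p, hp, h⟩ := exists_norm_eq_iInf_of_complete_convex hne hcl.isComplete hcv x
  refine ⟨p, hp, fun d hd => ?_⟩
  rw [h]
  exact ciInf_le ⟨0, Set.forall_mem_range.2 fun _ => norm_nonneg _⟩ (⟨d, hd⟩ : D)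

/-- Metric subregularity of a multi-valued mapping `T` at `x` for `y`: `(x, y)` lies in the graph
and `dist(x', T⁻¹(y)) ≤ κ dist(y, T(x'))` for all `x'` near `x`, where `dist(y, ∅) = ∞`. -/
def MetricallySubregularAt (T : E → Set E') (x : E) (y : E') : Prop :=
  y ∈ T x ∧ ∃ κ : ℝ≥0, 0 < κ ∧ ∃ U ∈ 𝓝 x, ∀ x' ∈ U,
    Metric.infEDist x' {x'' | y ∈ T x''} ≤ (κ : ENNReal) * Metric.infEDist y (T x')

/-- One-sided directional derivative `G'(x; d) = lim_{t ↓ 0} (G(x + t d) - G(x)) / t`. -/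
def dirDeriv (G : E → E') (x d : E) : E' :=
  limUnder (𝓝[>] (0 : ℝ)) fun t => t⁻¹ • (G (x + t • d) - G x)

/-- Directional differentiability (in the sense of Hadamard) of `G` at `x`: for each direction `d`
the quotients `(G(x + t d') - G(x)) / t` converge as `t ↓ 0` and `d' → d`. -/
def DirDifferentiableAt (G : E → E') (x : E) : Prop :=
  ∀ d, ∃ v, Tendsto (fun p : ℝ × E => p.1⁻¹ • (G (x + p.1 • p.2) - G x))
    (𝓝[>] (0 : ℝ) ×ˢ 𝓝 d) (𝓝 v)

/-- The gradient of the (finite part of the) extended-real-valued function `f`. -/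
def egradient [FiniteDimensional ℝ E] (f : E → EReal) (x : E) : E :=
  haveI := FiniteDimensional.complete ℝ E
  gradient (fun x' => (f x').toReal) x

end ConvexAnalysis

/-! ### Symmetric matrices -/

/-- `ℝ^m` with its Euclidean structure. -/
abbrev Vec (m : ℕ) : Type := EuclideanSpace ℝ (Fin m)

/-- The subspace of symmetric arrays in `ℝ^{n × n}`, the latter with inner product
`∑ i j, X i j * Y i j = tr (Xᵀ Y)`. -/
def symSubmodule (n : ℕ) : Submodule ℝ (EuclideanSpace ℝ (Fin n × Fin n)) where
  carrier := {X | ∀ i j, X (i, j) = X (j, i)}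
  zero_mem' := by intro i j; simp
  add_mem' := by
    intro a b ha hb i j
    simp only [PiLp.add_apply]
    rw [ha i j, hb i j]
  smul_mem' := by
    intro c a ha i j
    simp only [PiLp.smul_apply]
    rw [ha i j]

/-- The Euclidean space `𝕊^n` of symmetric `n × n` matrices with the trace inner product. -/
abbrev Sym (n : ℕ) : Type := symSubmodule n

/-- The matrix of an element of `𝕊^n`. -/
def Sym.mat {n : ℕ} (X : Sym n) : Matrix (Fin n) (Fin n) ℝ := Matrix.of fun i j => X.1 (i, j)

/-- The cone `𝕊^n_+`. -/
def psdCone (n : ℕ) : Set (Sym n) := {X | X.mat.PosSemidef}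

/-- The Penrose equations: `B` is the Moore-Penrose pseudo-inverse of the real matrix `A`. -/
def IsMoorePenrose {n : ℕ} (A B : Matrix (Fin n) (Fin n) ℝ) : Prop :=
  A * B * A = A ∧ B * A * B = B ∧ (A * B)ᵀ = A * B ∧ (B * A)ᵀ = B * A

/-- The Moore-Penrose pseudo-inverse `A^†`. -/
def pinv {n : ℕ} (A : Matrix (Fin n) (Fin n) ℝ) : Matrix (Fin n) (Fin n) ℝ :=
  Classical.epsilon (IsMoorePenrose A)

theorem isMoorePenrose_pinv {n : ℕ} {A : Matrix (Fin n) (Fin n) ℝ} (hA : A.IsHermitian) :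
    IsMoorePenrose A (pinv A) := by
  apply Classical.epsilon_spec (p := IsMoorePenrose A)
  have hs := hA.spectral_theorem
  rw [Unitary.conjStarAlgAut_apply] at hs
  set U : Matrix (Fin n) (Fin n) ℝ := (hA.eigenvectorUnitary : Matrix (Fin n) (Fin n) ℝ)
  have hU : star U * U = 1 := Unitary.coe_star_mul_self hA.eigenvectorUnitary
  set l : Fin n → ℝ := (RCLike.ofReal ∘ hA.eigenvalues : Fin n → ℝ)
  have key : ∀ a b : Fin n → ℝ, (U * diagonal a * star U) * (U * diagonal b * star U)
      = U * diagonal (fun i => a i * b i) * star U := by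
    intro a b
    calc (U * diagonal a * star U) * (U * diagonal b * star U)
        = U * diagonal a * (star U * U) * diagonal b * star U := by
          simp only [Matrix.mul_assoc]
      _ = _ := by rw [hU, Matrix.mul_one, Matrix.mul_assoc U, diagonal_mul_diagonal]
  have tr : ∀ a : Fin n → ℝ, (U * diagonal a * star U)ᵀ = U * diagonal a * star U := by
    intro a
    simp [Matrix.transpose_mul, Matrix.star_eq_conjTranspose, Matrix.mul_assoc,
      Matrix.conjTranspose_eq_transpose_of_trivial]
  refine ⟨U * diagonal (fun i => (l i)⁻¹) * star U, ?_, ?_, ?_, ?_⟩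
  · rw [hs, key, key]
    congr 3
    funext i
    exact mul_inv_mul_cancel (l i)
  · rw [hs, key, key]
    congr 3
    funext i
    simpa using mul_inv_mul_cancel (l i)⁻¹
  · rw [hs, key, tr]
  · rw [hs, key, tr]

section
open scoped MatrixOrder

/-- The positive semidefinite square root of a positive semidefinite matrix. -/
def psdSqrt {n : ℕ} (A : Matrix (Fin n) (Fin n) ℝ) : Matrix (Fin n) (Fin n) ℝ := CFC.sqrt A

end

/-- `Υ_S(Γ, D) = 2 ⟨Γ, D S^† D⟩`. -/
def Upsilon {n : ℕ} (S Γ D : Sym n) : ℝ :=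
  2 * (Γ.matᵀ * (D.mat * pinv S.mat * D.mat)).trace

/-! ### The convex SDP -/

/-- Data of the convex SDP `min h(F X) + ⟨C, X⟩ + δ_{𝕊^n_+}(X)  s.t.  b - A X ∈ Q°`
with a convex polyhedral cone `Q` and the standing assumptions on `h`. -/
structure ConvexSDP (W : Type*) [NormedAddCommGroup W] [InnerProductSpace ℝ W] (m n : ℕ) where
  A : Sym n →ₗ[ℝ] Vec m
  F : Sym n →ₗ[ℝ] W
  b : Vec m
  C : Sym n
  Q : Set (Vec m)
  h : W → EReal
  /-- `Q` is a convex polyhedral cone. -/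
  polyhedral : ∃ (k : ℕ) (N : Matrix (Fin k) (Fin m) ℝ), Q = {y | ∀ i, (N *ᵥ y.ofLp) i ≤ 0}
  h_ne_bot : ∀ x, h x ≠ ⊥
  dom_nonempty : (effDom h).Nonempty
  dom_open : IsOpen (effDom h)
  /-- `h` is continuously differentiable on its domain. -/
  h_contDiff : ContDiffOn ℝ 1 (fun x => (h x).toReal) (effDom h)
  /-- The domain of `h` is convex and `h` is strictly convex on it. -/
  h_strictConvex : StrictConvexOn ℝ (effDom h) (fun x => (h x).toReal)

/-- The space `ℤ = 𝕐 × 𝕎 × 𝕊^n` with the Euclidean product norm. -/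
abbrev ZSpace (W : Type*) [NormedAddCommGroup W] [InnerProductSpace ℝ W] (m n : ℕ) : Type _ :=
  WithLp 2 (Vec m × WithLp 2 (W × Sym n))

/-- The space `𝔼 = 𝕐 × 𝕎 × 𝕊^n × 𝕊^n` with the Euclidean product norm. -/
abbrev ESpace (W : Type*) [NormedAddCommGroup W] [InnerProductSpace ℝ W] (m n : ℕ) : Type _ :=
  WithLp 2 (ZSpace W m n × Sym n)

section Components

variable {W : Type*} [NormedAddCommGroup W] [InnerProductSpace ℝ W] {m n : ℕ}

/-- The triple `(y, w, S)`. -/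
def mkZ (y : Vec m) (w : W) (S : Sym n) : ZSpace W m n := WithLp.toLp 2 (y, WithLp.toLp 2 (w, S))

/-- The pair `(z, X)`. -/
def mkE (z : ZSpace W m n) (X : Sym n) : ESpace W m n := WithLp.toLp 2 (z, X)

/-- The components of `(y, w, S)`. -/
def yOf (z : ZSpace W m n) : Vec m := z.fst
def wOf (z : ZSpace W m n) : W := z.snd.fst
def sOf (z : ZSpace W m n) : Sym n := z.snd.snd

/-- The components of `(z, X)`. -/
def zOf (ξ : ESpace W m n) : ZSpace W m n := ξ.fst
def xOf (ξ : ESpace W m n) : Sym n := ξ.snd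

end Components

namespace ConvexSDP

variable {W : Type*} [NormedAddCommGroup W] [InnerProductSpace ℝ W] [FiniteDimensional ℝ W]
  {m n : ℕ} (P : ConvexSDP W m n)

/-- The conjugate `h*`. -/
def hConj : W → EReal := conjugate P.h

/-- The gradient `∇h*`. -/
def gradConj : W → W := egradient P.hConj

/-- The linear map `(y, w, S) ↦ A* y + F* w + S`. -/
def dualMap (z : ZSpace W m n) : Sym n :=
  LinearMap.adjoint P.A (yOf z) + LinearMap.adjoint P.F (wOf z) + sOf z

/-- The objective function of the dual problem in minimization form,
`δ_Q(y) - ⟨b, y⟩ + h*(-w) + δ_{𝕊^n_+}(S)`. -/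
def dualObj (z : ZSpace W m n) : EReal :=
  indicatorFun P.Q (yOf z) + ((-⟪P.b, yOf z⟫ : ℝ) : EReal) + P.hConj (-wOf z)
    + indicatorFun (psdCone n) (sOf z)

/-- `z` is an optimal solution of the dual problem `min dualObj  s.t.  A* y + F* w + S = C`. -/
def IsDualOptimal (z : ZSpace W m n) : Prop :=
  P.dualMap z = P.C ∧ P.dualObj z < ⊤ ∧ ∀ z', P.dualMap z' = P.C → P.dualObj z ≤ P.dualObj z'

/-- The Lagrangian `l(z, X)` of the dual problem. -/
def lagrangian (z : ZSpace W m n) (X : Sym n) : EReal :=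
  P.dualObj z + ((⟪X, P.dualMap z - P.C⟫ : ℝ) : EReal)

/-- The KKT solution mapping `T_l(z, X) = {(u, V) | (u, -V) ∈ ∂l(z, X)}`. -/
def Tl (ξ : ESpace W m n) : Set (ESpace W m n) :=
  {p | (zOf p, -xOf p) ∈ saddleSubdifferential P.lagrangian (zOf ξ) (xOf ξ)}

/-- The set `M_ψ(z)` of multipliers: all `X` such that `(z, X)` solves the KKT system
`0 ∈ -b + A X + N_Q(y)`, `0 ∈ F X - ∂h*(-w)`, `0 ∈ X + N_{𝕊^n_+}(S)`, `A* y + F* w + S = C`. -/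
def multipliers (z : ZSpace W m n) : Set (Sym n) :=
  {X | P.b - P.A X ∈ normalCone P.Q (yOf z) ∧ P.F X ∈ subdifferential P.hConj (-wOf z) ∧
    -X ∈ normalCone (psdCone n) (sOf z) ∧ P.dualMap z = P.C}

/-- `h*` is continuously differentiable on its domain (which therefore is open) and `∇h*` is
directionally differentiable at every point of the domain. -/
def ConjSmooth : Prop :=
  IsOpen (effDom P.hConj) ∧
  ContDiffOn ℝ 1 (fun u => (P.hConj u).toReal) (effDom P.hConj) ∧
  ∀ u ∈ effDom P.hConj, DirDifferentiableAt P.gradConj u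

/-- The critical cone `C_ψ(y, w, S)` of the dual problem. -/
def dualCriticalCone (z : ZSpace W m n) : Set (ZSpace W m n) :=
  {d | P.dualMap d = 0 ∧ yOf d ∈ posTangentConeAt P.Q (yOf z) ∧
    sOf d ∈ posTangentConeAt (psdCone n) (sOf z) ∧
    -⟪P.b, yOf d⟫ - ⟪P.gradConj (-wOf z), wOf d⟫ = 0}

/-- The second order sufficient condition of the dual problem at `z = (y, w, S)` with respect to
the multiplier `X`.  The first term is the second order directional derivative of the summand
`w ↦ h*(-w)`, that is `⟨-d_w, (∇h*)'(-w; -d_w)⟩`. -/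
def DualSOSC (z : ZSpace W m n) (X : Sym n) : Prop :=
  ∀ d ∈ P.dualCriticalCone z, d ≠ 0 →
    0 < ⟪-wOf d, dirDeriv P.gradConj (-wOf z) (-wOf d)⟫ + Upsilon (sOf z) X (sOf d)

/-- The joint critical cone `C(y, w, S, X)`. -/
def jointCriticalCone (z : ZSpace W m n) (X : Sym n) : Set (ESpace W m n) :=
  {d | yOf (zOf d) ∈ criticalCone P.Q (yOf z) (P.b - P.A X) ∧
    sOf (zOf d) ∈ criticalCone (psdCone n) (sOf z) X ∧
    xOf d ∈ criticalCone (psdCone n) X (sOf z) ∧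
    -P.A (xOf d) ∈ criticalCone (polarCone P.Q) (P.b - P.A X) (yOf z) ∧
    ⟪yOf (zOf d), P.A (xOf d)⟫ = 0 ∧
    psdSqrt X.mat * (sOf (zOf d)).mat * pinv (psdSqrt (sOf z).mat)
      + pinv (psdSqrt X.mat) * (xOf d).mat * psdSqrt (sOf z).mat = 0}

/-- The set `Ξ` of solutions of the linearized equations of the KKT system,
`A* d_y + F* d_w + d_S = 0` and `F d_X = (∇h*)'(-w; -d_w)`. -/
def linearizedSet (z : ZSpace W m n) : Set (ESpace W m n) :=
  {d | P.dualMap (zOf d) = 0 ∧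
    P.F (xOf d) - dirDeriv P.gradConj (-wOf z) (-wOf (zOf d)) = 0}

end ConvexSDP

/-- The cone `K = (C_{𝕊^n_+}(S, X))*`. -/
def coneK {n : ℕ} (S X : Sym n) : Set (Sym n) := dualCone (criticalCone (psdCone n) S X)

/-- The collection `I_B` of the index sets `a` for which some `y` satisfies `B_i y = 0` for
`i ∈ a` and `B_i y < 0` for `i ∉ a`. -/
def activeSets {r m : ℕ} (B : Matrix (Fin r) (Fin m) ℝ) : Set (Set (Fin r)) :=
  {a | ∃ y : Vec m, (∀ i ∈ a, (B *ᵥ y.ofLp) i = 0) ∧ ∀ i ∉ a, (B *ᵥ y.ofLp) i < 0}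

/-- The subspace `L_a = {y | B_i y = 0 for i ∈ a}`. -/
def activeSubspace {r m : ℕ} (B : Matrix (Fin r) (Fin m) ℝ) (a : Set (Fin r)) :
    Submodule ℝ (Vec m) where
  carrier := {y | ∀ i ∈ a, (B *ᵥ y.ofLp) i = 0}
  zero_mem' := by intro i _; simp
  add_mem' := by
    intro x y hx hy i hi
    simp [Matrix.mulVec_add, hx i hi, hy i hi]
  smul_mem' := by
    intro c x hx i hi
    simp [Matrix.mulVec_smul, hx i hi]

end SDP

end

/-! Write S, X for the given pair and H for the operator `hess`. A simultaneous diagonalization of S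
and X (`exists_frame`) turns every cone of the statement into a condition on matrix blocks and the
curvature term of (iii) into the form ⟨H d_S, d_S⟩. The delicate block is the kernel block of S: for
a nearby complementary pair, the first-order change of the multiplier is determined only in rows
where S is positive, while on the kernel block its quotients may be unbounded.

The heart is that every critical direction d has d_S = 0 on that block (`Complementary.c_eq_zero`).
Let I be the projector onto the common kernel of S and X. By (iii), the linearized optimality
conditions with source term I have a solution e, a variational inequality over the critical cone
(`exists_linearized_solution`). Its multipliers exist a priori only in a closure. But I is a
relative interior point of K and the rest of the system is polyhedral, so a Hoffman bound produces
genuine multipliers once I is added (`add_mem_sum_of_mem_closure`). Adding I cancels the source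
exactly. Hence e, together with the multiplier, lies in the joint critical cone and in Ξ, with
Π_K(d_X) = G, the K-part of the multiplier. Now (ii) gives ⟨G, e_S⟩ = 0, the form in (iii) vanishes
at e, and e = 0. The variational inequality at e = 0 reads ⟨I, d_S⟩ ≤ 0 for all critical d. Since
d_S is semidefinite on the kernel block, that block vanishes.

The bound on z follows by contradiction (`Complementary.limit_direction_eq_zero`). If it failed,
normalized differences of z would converge to a unit critical direction d. Pair the change of the
multiplier with the equation A*d_y + F*d_w + d_S = 0. The part over S converges to -⟨H d_S, d_S⟩
because the uncontrolled block meets a zero block, the part over h* converges by Hadamard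
differentiability, and the part over Q has a sign by polyhedrality. The limit contradicts (iii).

For metric subregularity the matrix component must be near some multiplier of the unperturbed
problem (`Complementary.exists_multiplier_near`). It is cut to the kernel block, the linear
equations are repaired by a Hoffman bound that keeps the signs of the coefficients, and
semidefiniteness is restored by mixing in the strictly complementary multiplier, which is definite
on the kernel of S. Each operation costs a multiple of the perturbation. -/

namespace SDP

/-! ### Hoffman-type bounds and closedness of polyhedral images -/

section Polyhedral

/-- Two vectors are conformal when each coordinate of the first lies between `0` and the
corresponding coordinate of the second. -/
def Conformal {ι : Type*} (v δ : ι → ℝ) : Prop := ∀ i, v i ∈ Set.uIcc 0 (δ i)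

/-- Among the conformal vectors with the given image, one of least ℓ¹ norm works. No nonzero kernel
vector is sign compatible with it, as subtracting a small multiple would shorten it. On such an
orthant `T` is bounded below by compactness, and there are finitely many sign patterns. -/
theorem exists_conformal_eq_norm_le {ι Y : Type*} [Fintype ι] [NormedAddCommGroup Y]
    [NormedSpace ℝ Y] (T : (ι → ℝ) →ₗ[ℝ] Y) :
    ∃ c : ℝ, 0 ≤ c ∧ ∀ δ : ι → ℝ, ∃ v, Conformal v δ ∧ T v = T δ ∧ ‖v‖ ≤ c * ‖T δ‖ := by
  classical
  have hTc : Continuous T := T.continuous_of_finiteDimensional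
  -- for each sign pattern without kernel vectors, the map is bounded below
  have hpat : ∀ σ : ι → SignType, ∃ c : ℝ, 0 ≤ c ∧
      ((∀ w : ι → ℝ, (∀ i, w i = 0 ∨ SignType.sign (w i) = σ i) → T w = 0 → w = 0) →
        ∀ w : ι → ℝ, (∀ i, w i = 0 ∨ SignType.sign (w i) = σ i) → ‖w‖ ≤ c * ‖T w‖) := by
    intro σ
    by_cases hk : ∀ w : ι → ℝ, (∀ i, w i = 0 ∨ SignType.sign (w i) = σ i) → T w = 0 → w = 0
    swap
    · exact ⟨0, le_rfl, fun h => absurd h hk⟩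
    set O : Set (ι → ℝ) := {w | ∀ i, w i = 0 ∨ SignType.sign (w i) = σ i} with hO
    have hOeq : O = {w | ∀ i, (σ i = 0 → w i = 0) ∧ (σ i = 1 → 0 ≤ w i) ∧
        (σ i = -1 → w i ≤ 0)} := by
      ext w
      simp only [hO, mem_ofPred_eq]
      refine forall_congr' fun i => ?_
      rcases lt_trichotomy (w i) 0 with h | h | h
      · rcases hs : σ i <;> simp [h, h.le, h.ne, sign_neg]
      · rcases hs : σ i <;> simp [h]
      · rcases hs : σ i <;> simp [h, h.le, h.ne', sign_pos]
    have hOcl : IsClosed O := by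
      rw [hOeq]
      simp only [ofPred_forall, ofPred_and]
      refine isClosed_iInter fun i => (IsClosed.inter ?_ (IsClosed.inter ?_ ?_))
      · exact isClosed_iInter fun _ => isClosed_eq (continuous_apply i) continuous_const
      · exact isClosed_iInter fun _ => isClosed_le continuous_const (continuous_apply i)
      · exact isClosed_iInter fun _ => isClosed_le (continuous_apply i) continuous_const
    have hsm : ∀ w ∈ O, ∀ r : ℝ, 0 < r → r • w ∈ O := by
      intro w hw r hr i
      rcases hw i with h | h
      · left; simp [h]
      · right; rw [← h]; simp [sign_mul, sign_pos hr]
    have hcomp : IsCompact (O ∩ Metric.sphere (0 : ι → ℝ) 1) :=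
      (isCompact_sphere _ _).inter_left hOcl
    rcases (O ∩ Metric.sphere (0 : ι → ℝ) 1).eq_empty_or_nonempty with he | hne
    · refine ⟨0, le_rfl, fun _ w hw => ?_⟩
      by_cases hw0 : w = 0
      · simp [hw0]
      · exfalso
        have : ‖w‖⁻¹ • w ∈ O ∩ Metric.sphere (0 : ι → ℝ) 1 :=
          ⟨hsm w hw _ (by positivity), by simp [norm_smul, hw0]⟩
        rw [he] at this; exact this
    · obtain ⟨w0, hw0, hmin⟩ := hcomp.exists_isMinOn hne (hTc.norm.continuousOn)
      have hpos : 0 < ‖T w0‖ := by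
        rw [norm_pos_iff]
        intro h0
        have := hk w0 hw0.1 h0
        have h1 := hw0.2
        simp [this] at h1
      refine ⟨‖T w0‖⁻¹, by positivity, fun _ w hw => ?_⟩
      by_cases hw0' : w = 0
      · simp [hw0']
      have hwn : 0 < ‖w‖ := norm_pos_iff.2 hw0'
      have : ‖w‖⁻¹ • w ∈ O ∩ Metric.sphere (0 : ι → ℝ) 1 :=
        ⟨hsm w hw _ (by positivity), by simp [norm_smul, hw0']⟩
      have h2 : ‖T w0‖ ≤ ‖T (‖w‖⁻¹ • w)‖ := hmin this
      rw [map_smul, norm_smul, norm_inv, norm_norm] at h2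
      rw [inv_mul_eq_div, le_div_iff₀ hpos]
      calc ‖w‖ * ‖T w0‖ ≤ ‖w‖ * (‖w‖⁻¹ * ‖T w‖) := by gcongr
        _ = ‖T w‖ := by field_simp
  choose c hc0 hc using hpat
  refine ⟨∑ σ, c σ, Finset.sum_nonneg fun σ _ => hc0 σ, fun δ => ?_⟩
  set S : Set (ι → ℝ) := {v | Conformal v δ ∧ T v = T δ} with hS
  have hScomp : IsCompact S := by
    have : S = (Set.pi univ fun i => Set.uIcc 0 (δ i)) ∩ T ⁻¹' {T δ} := by
      ext v; simp only [hS, Conformal, mem_ofPred_eq, mem_inter_iff, Set.mem_pi, mem_univ,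
        true_imp_iff, mem_preimage, mem_singleton_iff]
    rw [this]
    exact (isCompact_univ_pi fun i => isCompact_uIcc).inter_right (isClosed_singleton.preimage hTc)
  have hSne : S.Nonempty := ⟨δ, fun i => right_mem_uIcc, rfl⟩
  obtain ⟨v, hvS, hvmin⟩ := hScomp.exists_isMinOn hSne
    (f := fun v => ∑ i, |v i|) (by fun_prop)
  refine ⟨v, hvS.1, hvS.2, ?_⟩
  rw [← hvS.2]
  set σ : ι → SignType := fun i => SignType.sign (v i) with hσ
  -- What remains is to exclude kernel vectors compatible with the signs of `v`; compatibility
  -- forces `w i = 0` wherever `v i = 0`.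
  have key := hc σ ?_ v (fun i => Or.inr rfl)
  · refine key.trans ?_
    gcongr
    exact Finset.single_le_sum (f := c) (fun σ _ => hc0 σ) (Finset.mem_univ σ)
  intro w hw hTw
  by_contra hwne
  -- subtract a small multiple of `w`
  have hex : ∃ t : ℝ, 0 < t ∧ ∀ i, t * |w i| ≤ |v i| := by
    have : ∀ i, ∃ t : ℝ, 0 < t ∧ ∀ s, 0 ≤ s → s ≤ t → s * |w i| ≤ |v i| := by
      intro i
      rcases hw i with h | h
      · exact ⟨1, one_pos, fun s _ _ => by simp [h]⟩
      · by_cases hwi : w i = 0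
        · exact ⟨1, one_pos, fun s _ _ => by simp [hwi]⟩
        have hvi : v i ≠ 0 := by
          intro h0; simp [hσ, h0] at h; exact hwi h
        refine ⟨|v i| / |w i|, by positivity, fun s _ hs => ?_⟩
        rwa [le_div_iff₀ (by positivity)] at hs
    choose t ht0 ht using this
    by_cases hι : Nonempty ι
    · refine ⟨Finset.univ.inf' Finset.univ_nonempty t, ?_, fun i => ht i _ ?_ ?_⟩
      · rw [Finset.lt_inf'_iff]; exact fun i _ => ht0 i
      · rw [Finset.le_inf'_iff]; exact fun i _ => (ht0 i).le
      · exact Finset.inf'_le _ (Finset.mem_univ i)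
    · exact ⟨1, one_pos, fun i => absurd ⟨i⟩ hι⟩
  obtain ⟨t, ht, htw⟩ := hex
  -- Since `w` shares the signs of `v`, each coordinate moves toward `0` without crossing it, so its
  -- absolute value drops by exactly `t * |w i|`.
  have hcoord : ∀ i, (v - t • w) i ∈ Set.uIcc 0 (v i) ∧ |(v - t • w) i| = |v i| - t * |w i| := by
    intro i
    have h1 := htw i
    simp only [Pi.sub_apply, Pi.smul_apply, smul_eq_mul]
    rcases lt_trichotomy (v i) 0 with h | h | h
    · have hwi : w i ≤ 0 := by
        rcases hw i with h' | h'
        · exact h'.le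
        · have h'' : SignType.sign (w i) = -1 := by rw [h', hσ]; exact sign_neg h
          exact (sign_eq_neg_one_iff.1 h'').le
      rw [abs_of_neg h, abs_of_nonpos hwi] at h1
      rw [uIcc_of_ge h.le, abs_of_nonpos (by linarith : v i - t * w i ≤ 0), abs_of_neg h,
        abs_of_nonpos hwi]
      exact ⟨⟨by nlinarith, by linarith⟩, by ring⟩
    · have hwi : w i = 0 := by
        rcases hw i with h' | h'
        · exact h'
        · have h'' : SignType.sign (w i) = 0 := by rw [h', hσ]; simp [h]
          exact sign_eq_zero_iff.1 h''
      simp [h, hwi]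
    · have hwi : 0 ≤ w i := by
        rcases hw i with h' | h'
        · exact h'.ge
        · have h'' : SignType.sign (w i) = 1 := by rw [h', hσ]; exact sign_pos h
          exact (sign_eq_one_iff.1 h'').le
      rw [abs_of_pos h, abs_of_nonneg hwi] at h1
      rw [uIcc_of_le h.le, abs_of_nonneg (by linarith : 0 ≤ v i - t * w i), abs_of_pos h,
        abs_of_nonneg hwi]
      exact ⟨⟨by linarith, by nlinarith⟩, by ring⟩
  have hmem : v - t • w ∈ S := by
    refine ⟨fun i => ?_, by simp [hTw, hvS.2]⟩
    exact uIcc_subset_uIcc left_mem_uIcc (hvS.1 i) (hcoord i).1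
  have h3 : ∑ i, |v i| ≤ ∑ i, |(v - t • w) i| := hvmin hmem
  have h4 : ∑ i, |(v - t • w) i| = ∑ i, |v i| - t * ∑ i, |w i| := by
    rw [Finset.mul_sum, ← Finset.sum_sub_distrib]
    exact Finset.sum_congr rfl fun i _ => (hcoord i).2
  have h5 : 0 < ∑ i, |w i| := by
    obtain ⟨i, hi⟩ := Function.ne_iff.1 hwne
    exact Finset.sum_pos' (fun i _ => abs_nonneg _) ⟨i, Finset.mem_univ i, abs_pos.2 hi⟩
  nlinarith [mul_pos ht h5]

/-- This is why conformality is wanted: a conformal correction from `l` toward `m` never leaves the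
orthant. -/
theorem Conformal.add_nonneg {ι : Type*} {v : ι → ℝ} {l m : ι → ℝ} (h : Conformal v (m - l))
    {i : ι} (hl : 0 ≤ l i) (hm : 0 ≤ m i) : 0 ≤ l i + v i := by
  have := h i
  simp only [Pi.sub_apply, mem_uIcc] at this
  rcases this with h | h <;> linarith [h.1, h.2]

/-- Hoffman's bound for a system with free variables in a finite dimensional space and
nonnegative variables. -/
theorem exists_conformal_prod {E ι Y : Type*} [NormedAddCommGroup E] [NormedSpace ℝ E]
    [FiniteDimensional ℝ E] [Fintype ι] [NormedAddCommGroup Y]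
    [NormedSpace ℝ Y] (T : E →ₗ[ℝ] Y) (T' : (ι → ℝ) →ₗ[ℝ] Y) :
    ∃ c : ℝ, 0 ≤ c ∧ ∀ (e : E) (δ : ι → ℝ), ∃ (e' : E) (v : ι → ℝ), Conformal v δ ∧
      T e' + T' v = T e + T' δ ∧ ‖e'‖ ≤ c * ‖T e + T' δ‖ ∧ ‖v‖ ≤ c * ‖T e + T' δ‖ := by
  classical
  let b := Module.finBasis ℝ E
  let k := Module.finrank ℝ E
  let inlP : (Fin k ⊕ ι → ℝ) →ₗ[ℝ] (Fin k → ℝ) := LinearMap.funLeft ℝ ℝ Sum.inl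
  let inrP : (Fin k ⊕ ι → ℝ) →ₗ[ℝ] (ι → ℝ) := LinearMap.funLeft ℝ ℝ Sum.inr
  let φ : (Fin k → ℝ) →ₗ[ℝ] E := b.equivFun.symm.toLinearMap
  let φc : (Fin k → ℝ) →L[ℝ] E := LinearMap.toContinuousLinearMap φ
  -- Free variables enter through coordinates in a basis; conformality in those coordinates is
  -- simply discarded.
  obtain ⟨c, hc, h⟩ := exists_conformal_eq_norm_le (T ∘ₗ φ ∘ₗ inlP + T' ∘ₗ inrP)
  refine ⟨(‖φc‖ + 1) * c, by positivity, fun e δ => ?_⟩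
  obtain ⟨v, hv, hTv, hvn⟩ := h (Sum.elim (b.equivFun e) δ)
  have hin : inlP (Sum.elim (b.equivFun e) δ) = b.equivFun e := rfl
  have hin' : inrP (Sum.elim (b.equivFun e) δ) = δ := rfl
  have hφ : φ (b.equivFun e) = e := b.equivFun.symm_apply_apply e
  simp only [LinearMap.add_apply, LinearMap.comp_apply, hin, hin', hφ] at hTv hvn
  have n1 : ‖inlP v‖ ≤ ‖v‖ := (pi_norm_le_iff_of_nonneg (norm_nonneg _)).2
    fun i => norm_le_pi_norm v _
  have n2 : ‖inrP v‖ ≤ ‖v‖ := (pi_norm_le_iff_of_nonneg (norm_nonneg _)).2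
    fun i => norm_le_pi_norm v _
  refine ⟨φ (inlP v), inrP v, fun i => hv (Sum.inr i), hTv, ?_, ?_⟩
  · have : ‖φ (inlP v)‖ ≤ ‖φc‖ * ‖inlP v‖ := φc.le_opNorm _
    nlinarith [norm_nonneg φc, norm_nonneg (inlP v), norm_nonneg v]
  · nlinarith [norm_nonneg φc, norm_nonneg v]

/-- The image of an orthant with additional free variables is closed. -/
theorem isClosed_image_orthant {E ι Y : Type*} [NormedAddCommGroup E] [NormedSpace ℝ E]
    [FiniteDimensional ℝ E] [Fintype ι] [NormedAddCommGroup Y]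
    [NormedSpace ℝ Y] (T : E →ₗ[ℝ] Y) (T' : (ι → ℝ) →ₗ[ℝ] Y) :
    IsClosed {y | ∃ (e : E) (l : ι → ℝ), (∀ i, 0 ≤ l i) ∧ y = T e + T' l} := by
  obtain ⟨c, hc, h⟩ := exists_conformal_prod T T'
  have hT : Continuous T := T.continuous_of_finiteDimensional
  have hT' : Continuous T' := T'.continuous_of_finiteDimensional
  rw [← isSeqClosed_iff_isClosed]
  intro y y0 hy hlim
  choose e l hl hyl using hy
  -- The given preimages may be unbounded. Conformal replacements are bounded by the images and
  -- still nonnegative, so a subsequence converges.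
  have : ∀ k, ∃ (p : E × (ι → ℝ)), (∀ i, 0 ≤ p.2 i) ∧ T p.1 + T' p.2 = y k ∧
      ‖p‖ ≤ c * ‖y k‖ := by
    intro k
    obtain ⟨e', v, hv, heq, h1, h2⟩ := h (e k) (l k)
    rw [← hyl k] at h1 h2 heq
    refine ⟨(e', v), fun i => ?_, heq, ?_⟩
    · have := hv i
      rw [uIcc_of_le (hl k i)] at this
      exact this.1
    · rw [Prod.norm_def]; exact max_le h1 h2
  choose p hp hpy hpn using this
  obtain ⟨R, hR⟩ := (Metric.isBounded_range_of_tendsto y hlim).exists_norm_le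
  have hb : ∀ k, p k ∈ Metric.closedBall (0 : E × (ι → ℝ)) (c * R) := by
    intro k
    rw [mem_closedBall_zero_iff]
    exact (hpn k).trans (by gcongr; exact hR _ (mem_range_self k))
  have : ProperSpace (E × (ι → ℝ)) := FiniteDimensional.proper ℝ _
  obtain ⟨p0, -, φ, hφ, hpl⟩ := (isCompact_closedBall _ _).tendsto_subseq hb
  refine ⟨p0.1, p0.2, fun i => ?_, ?_⟩
  · have : Tendsto (fun k => (p (φ k)).2 i) atTop (𝓝 (p0.2 i)) :=
      ((continuous_apply i).tendsto _).comp ((continuous_snd.tendsto _).comp hpl)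
    exact ge_of_tendsto' this fun k => hp _ i
  · have h1 : Tendsto (fun k => T (p (φ k)).1 + T' (p (φ k)).2) atTop
        (𝓝 (T p0.1 + T' p0.2)) :=
      (((hT.comp continuous_fst).add (hT'.comp continuous_snd)).tendsto p0).comp hpl
    have h2 := hlim.comp hφ.tendsto_atTop
    refine tendsto_nhds_unique h2 (h1.congr fun k => ?_)
    simp [hpy]

end Polyhedral

/-! ### Tangent, critical and dual cones -/

section TangentCones

variable {E : Type*} [NormedAddCommGroup E] [InnerProductSpace ℝ E]

theorem isClosed_posTangentConeAt (s : Set E) (x : E) : IsClosed (posTangentConeAt s x) := by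
  rw [posTangentConeAt, tangentConeAt_def]
  exact isClosed_setOfPred_clusterPt

theorem inner_nonneg_of_mem_posTangentConeAt {s : Set E} {x v d : E}
    (hd : d ∈ posTangentConeAt s x) (hv : ∀ y ∈ s, 0 ≤ ⟪v, y - x⟫) : 0 ≤ ⟪v, d⟫ := by
  obtain ⟨α, l, hl, c, e, -, hes, hce⟩ := exists_fun_of_mem_tangentConeAt hd
  have h1 : Tendsto (fun n => ⟪v, c n • e n⟫) l (𝓝 ⟪v, d⟫) := tendsto_const_nhds.inner hce
  refine ge_of_tendsto h1 (hes.mono fun n hn => ?_)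
  have := hv _ hn
  rw [add_sub_cancel_left] at this
  rw [NNReal.smul_def, real_inner_smul_right]
  exact mul_nonneg (c n).2 this

theorem smul_sub_mem_posTangentConeAt {s : Set E} (hs : Convex ℝ s) {x y : E} (hx : x ∈ s)
    (hy : y ∈ s) {t : ℝ} (ht : 0 ≤ t) : t • (y - x) ∈ posTangentConeAt s x := by
  apply mem_posTangentConeAt_of_frequently_mem
  apply Eventually.frequently
  have h1 : ∀ᶠ τ : ℝ in 𝓝[>] 0, τ * t ≤ 1 := by
    have : Tendsto (fun τ : ℝ => τ * t) (𝓝[>] 0) (𝓝 (0 * t)) :=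
      (tendsto_nhdsWithin_of_tendsto_nhds tendsto_id).mul_const t
    rw [zero_mul] at this
    exact (this.eventually (gt_mem_nhds one_pos)).mono fun _ h => h.le
  filter_upwards [h1, self_mem_nhdsWithin] with τ hτ hτ0
  have h2 : 0 ≤ τ * t := mul_nonneg (le_of_lt hτ0) ht
  have := hs hx hy (sub_nonneg.2 hτ) h2 (by ring)
  convert this using 1
  rw [smul_smul, smul_sub, sub_smul, one_smul]; abel

/-- The set `C` contains the origin and is stable under sums and nonnegative multiples. -/
structure IsPointedCone (C : Set E) : Prop where
  zero_mem : (0 : E) ∈ C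
  add_mem : ∀ {x y}, x ∈ C → y ∈ C → x + y ∈ C
  smul_mem : ∀ {t : ℝ} {x}, 0 ≤ t → x ∈ C → t • x ∈ C

theorem IsPointedCone.convex {C : Set E} (hC : IsPointedCone C) : Convex ℝ C :=
  fun _ hx _ hy _ _ ha hb _ => hC.add_mem (hC.smul_mem ha hx) (hC.smul_mem hb hy)

/-- Separation of a point from the closure of a convex cone. -/
theorem IsPointedCone.exists_separating [FiniteDimensional ℝ E] {C : Set E} (hC : IsPointedCone C)
    {x : E}
    (hx : x ∉ closure C) : ∃ v, (∀ y ∈ C, 0 ≤ ⟪v, y⟫) ∧ ⟪v, x⟫ < 0 := by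
  have : CompleteSpace E := FiniteDimensional.complete ℝ E
  let P : PointedCone ℝ E :=
    { carrier := C
      zero_mem' := hC.zero_mem
      add_mem' := hC.add_mem
      smul_mem' := fun c _ h => hC.smul_mem c.2 h }
  let P' : ProperCone ℝ E := ⟨P.closure, isClosed_closure⟩
  obtain ⟨v, h1, h2⟩ := P'.hyperplane_separation' (x₀ := x) hx
  exact ⟨v, fun y hy => by rw [real_inner_comm]; exact h1 y (subset_closure hy),
    by rwa [real_inner_comm]⟩

/-- The tangent cone of a convex set is the dual cone of the set of inward normals. -/
theorem mem_posTangentConeAt_of_forall [FiniteDimensional ℝ E] {s : Set E} (hs : Convex ℝ s)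
    {x d : E} (hx : x ∈ s)
    (h : ∀ v, (∀ y ∈ s, 0 ≤ ⟪v, y - x⟫) → 0 ≤ ⟪v, d⟫) : d ∈ posTangentConeAt s x := by
  by_contra hd
  -- The feasible directions form a convex cone whose closure lies in the tangent cone. A vector
  -- outside this closure is cut off by an inward normal.
  have hC : IsPointedCone {z : E | ∃ t : ℝ, 0 ≤ t ∧ ∃ y ∈ s, z = t • (y - x)} := by
    refine ⟨⟨0, le_rfl, x, hx, by simp⟩, ?_, ?_⟩
    · rintro _ _ ⟨t, ht, y, hy, rfl⟩ ⟨t', ht', y', hy', rfl⟩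
      rcases eq_or_lt_of_le (add_nonneg ht ht') with h0 | h0
      · have : t = 0 := by linarith
        have : t' = 0 := by linarith
        exact ⟨0, le_rfl, x, hx, by simp [‹t = 0›, ‹t' = 0›]⟩
      · refine ⟨t + t', h0.le, _, hs hy hy' (div_nonneg ht h0.le) (div_nonneg ht' h0.le)
          (by field_simp), ?_⟩
        rw [smul_sub (t + t'), smul_add, smul_smul, smul_smul, mul_div_cancel₀ _ h0.ne',
          mul_div_cancel₀ _ h0.ne', add_smul, smul_sub, smul_sub]
        abel
    · rintro r _ hr ⟨t, ht, y, hy, rfl⟩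
      exact ⟨r * t, mul_nonneg hr ht, y, hy, by rw [smul_smul]⟩
  have hsub : closure {z : E | ∃ t : ℝ, 0 ≤ t ∧ ∃ y ∈ s, z = t • (y - x)} ⊆
      posTangentConeAt s x := by
    refine closure_minimal ?_ (isClosed_posTangentConeAt s x)
    rintro _ ⟨t, ht, y, hy, rfl⟩
    exact smul_sub_mem_posTangentConeAt hs hx hy ht
  obtain ⟨v, hv, hvd⟩ := hC.exists_separating (fun hmem => hd (hsub hmem))
  refine absurd (h v fun y hy => ?_) (not_le.2 hvd)
  exact hv _ ⟨1, zero_le_one, y, hy, by simp⟩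

theorem mem_posTangentConeAt_iff [FiniteDimensional ℝ E] {s : Set E} (hs : Convex ℝ s) {x d : E}
    (hx : x ∈ s) :
    d ∈ posTangentConeAt s x ↔ ∀ v, (∀ y ∈ s, 0 ≤ ⟪v, y - x⟫) → 0 ≤ ⟪v, d⟫ :=
  ⟨fun hd _ hv => inner_nonneg_of_mem_posTangentConeAt hd hv,
    mem_posTangentConeAt_of_forall hs hx⟩

theorem isPointedCone_posTangentConeAt [FiniteDimensional ℝ E] {s : Set E} (hs : Convex ℝ s) {x : E}
    (hx : x ∈ s) :
    IsPointedCone (posTangentConeAt s x) := by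
  refine ⟨?_, ?_, ?_⟩
  · rw [mem_posTangentConeAt_iff hs hx]; simp
  · intro a b ha hb
    rw [mem_posTangentConeAt_iff hs hx] at *
    intro v hv
    rw [inner_add_right]
    exact add_nonneg (ha v hv) (hb v hv)
  · intro t a ht ha
    rw [mem_posTangentConeAt_iff hs hx] at *
    intro v hv
    rw [real_inner_smul_right]
    exact mul_nonneg ht (ha v hv)

theorem isPointedCone_criticalCone [FiniteDimensional ℝ E] {s : Set E} (hs : Convex ℝ s) {x v : E}
    (hx : x ∈ s) :
    IsPointedCone (criticalCone s x v) := by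
  have h := isPointedCone_posTangentConeAt hs hx
  refine ⟨⟨h.zero_mem, by simp⟩, fun ha hb => ⟨h.add_mem ha.1 hb.1, ?_⟩,
    fun ht ha => ⟨h.smul_mem ht ha.1, ?_⟩⟩
  · rw [inner_add_right, ha.2, hb.2, add_zero]
  · rw [real_inner_smul_right, ha.2, mul_zero]

theorem isClosed_criticalCone {s : Set E} {x v : E} : IsClosed (criticalCone s x v) :=
  (isClosed_posTangentConeAt s x).inter
    (isClosed_eq (continuous_const.inner continuous_id) continuous_const)

theorem isPointedCone_dualCone (s : Set E) : IsPointedCone (dualCone s) := by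
  have hm : ∀ x : E, x ∈ dualCone s ↔ ∀ d ∈ s, 0 ≤ ⟪x, d⟫ := by
    intro x
    simp [dualCone, polarCone]
  refine ⟨?_, ?_, ?_⟩
  · rw [hm]; simp
  · intro a b ha hb
    rw [hm] at *
    intro d hd
    rw [inner_add_left]
    exact add_nonneg (ha d hd) (hb d hd)
  · intro t a ht ha
    rw [hm] at *
    intro d hd
    rw [real_inner_smul_left]
    exact mul_nonneg ht (ha d hd)

theorem mem_dualCone {s : Set E} {x : E} : x ∈ dualCone s ↔ ∀ d ∈ s, 0 ≤ ⟪x, d⟫ := by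
  simp [dualCone, polarCone]

theorem isClosed_dualCone (s : Set E) : IsClosed (dualCone s) := by
  have : dualCone s = ⋂ d ∈ s, {x : E | 0 ≤ ⟪x, d⟫} := by
    ext x; simp only [mem_dualCone, mem_iInter, mem_ofPred_eq]
  rw [this]
  exact isClosed_biInter fun d _ => isClosed_le continuous_const
    (continuous_id.inner continuous_const)

/-- Moreau's characterization of the projection onto a closed convex cone. -/
theorem metricProj_eq [FiniteDimensional ℝ E] {K : Set E} (hK : IsPointedCone K) (hcl : IsClosed K)
    {x p : E}
    (hp : p ∈ K) (hxp : ∀ k ∈ K, ⟪x - p, k⟫ ≤ 0) (h0 : ⟪x - p, p⟫ = 0) :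
    metricProj K x = p := by
  have : CompleteSpace E := FiniteDimensional.complete ℝ E
  obtain ⟨hq, hmin⟩ := isMetricProj_metricProj ⟨0, hK.zero_mem⟩ hcl hK.convex x
  set q := metricProj K x
  have h1 := hmin p hp
  have h2 : ‖x - q‖ ^ 2 = ‖x - p‖ ^ 2 - 2 * ⟪x - p, q - p⟫ + ‖q - p‖ ^ 2 := by
    rw [← norm_sub_sq_real]; congr 2; abel
  have h3 : ⟪x - p, q - p⟫ ≤ 0 := by rw [inner_sub_right, h0, sub_zero]; exact hxp q hq
  have h4 : ‖x - q‖ ^ 2 ≤ ‖x - p‖ ^ 2 := by gcongr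
  have h5 : ‖q - p‖ ^ 2 ≤ 0 := by linarith
  have h6 : ‖q - p‖ = 0 := by nlinarith [norm_nonneg (q - p)]
  exact sub_eq_zero.1 (norm_eq_zero.1 h6)

/-- A point of the closure of the sum of a polyhedral cone and a convex cone belongs to the sum
after a translation by a relative interior point of the second cone. -/
theorem add_mem_sum_of_mem_closure [FiniteDimensional ℝ E] {X ι : Type*} [Fintype ι]
    [NormedAddCommGroup X]
    [NormedSpace ℝ X] [FiniteDimensional ℝ X] (T : X →ₗ[ℝ] E) (T' : (ι → ℝ) →ₗ[ℝ] E)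
    {K : Set E} (hK : IsPointedCone K) (V : Submodule ℝ E) (hKV : K ⊆ V) {g : E} {ε : ℝ}
    (hε : 0 < ε) (hg : ∀ s ∈ V, ‖s‖ < ε → g + s ∈ K) {x : E}
    (hx : x ∈ closure {y | ∃ (e : X) (l : ι → ℝ), (∀ i, 0 ≤ l i) ∧ ∃ k ∈ K,
      y = T e + T' l + k}) :
    ∃ (e : X) (l : ι → ℝ), (∀ i, 0 ≤ l i) ∧ ∃ k ∈ K, x + g = T e + T' l + k := by
  -- `π` annihilates `V` and hence `K`. The image of the sum under `π` is polyhedral, hence closed,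
  -- so `π x` is attained exactly.
  let π : E →L[ℝ] E := Vᗮ.starProjection
  have hπV : ∀ v ∈ V, π v = 0 := fun v hv =>
    (Submodule.starProjection_apply_eq_zero_iff _).2 (V.le_orthogonal_orthogonal hv)
  have hπV' : ∀ v, π v = 0 → v ∈ V := fun v hv => by
    have := (Submodule.starProjection_apply_eq_zero_iff _).1 hv
    rwa [Submodule.orthogonal_orthogonal] at this
  let A : X →ₗ[ℝ] E := π.toLinearMap ∘ₗ T
  let A' : (ι → ℝ) →ₗ[ℝ] E := π.toLinearMap ∘ₗ T'
  have hπx : π x ∈ {y | ∃ (e : X) (l : ι → ℝ), (∀ i, 0 ≤ l i) ∧ y = A e + A' l} := by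
    rw [← (isClosed_image_orthant A A').closure_eq]
    refine map_mem_closure π.continuous hx ?_
    rintro _ ⟨e, l, hl, k, hk, rfl⟩
    exact ⟨e, l, hl, by simp [A, A', hπV k (hKV hk)]⟩
  obtain ⟨e0, l0, hl0, hx0⟩ := hπx
  obtain ⟨c, hc, hcf⟩ := exists_conformal_prod A A'
  let Tc : X →L[ℝ] E := LinearMap.toContinuousLinearMap T
  let Tc' : (ι → ℝ) →L[ℝ] E := LinearMap.toContinuousLinearMap T'
  -- `M` bounds the growth of an approximation error sent through `π`, the conformal correction and
  -- the maps `T`, `T'`.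
  set M : ℝ := 1 + (‖Tc‖ + ‖Tc'‖) * c * ‖π‖ with hM
  have hM0 : 0 < M := by positivity
  obtain ⟨y, ⟨e, l, hl, k, hk, rfl⟩, hxy⟩ := Metric.mem_closure_iff.1 hx (ε / M) (by positivity)
  -- Move `(e, l)` conformally toward the exact preimage of `π x`. The coefficients stay
  -- nonnegative, and the new residual lies in `V` with norm below `ε`, so the ball around `g`
  -- absorbs it.
  obtain ⟨e', v, hv, heq, he', hv'⟩ := hcf (e0 - e) (l0 - l)
  have hdiff : A (e0 - e) + A' (l0 - l) = π (x - (T e + T' l + k)) := by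
    rw [map_sub π, hx0, map_add π, map_add π, hπV k (hKV hk), map_sub, map_sub]
    simp only [A, A', LinearMap.comp_apply, ContinuousLinearMap.coe_coe]
    abel
  rw [hdiff] at heq he' hv'
  rw [dist_eq_norm] at hxy
  set w := x - (T e + T' l + k) with hw
  have hπw : ‖π w‖ ≤ ‖π‖ * ‖w‖ := π.le_opNorm w
  have hs : w - (T e' + T' v) ∈ V := by
    apply hπV'
    rw [map_sub, map_add, sub_eq_zero]
    exact heq.symm
  have hsn : ‖w - (T e' + T' v)‖ < ε := by
    have h1 : ‖T e'‖ ≤ ‖Tc‖ * (c * (‖π‖ * ‖w‖)) :=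
      (Tc.le_opNorm e').trans (by gcongr; exact he'.trans (by gcongr))
    have h2 : ‖T' v‖ ≤ ‖Tc'‖ * (c * (‖π‖ * ‖w‖)) :=
      (Tc'.le_opNorm v).trans (by gcongr; exact hv'.trans (by gcongr))
    have h3 := norm_sub_le w (T e' + T' v)
    have h4 := norm_add_le (T e') (T' v)
    have h5 : ‖w‖ * M < ε := by rwa [lt_div_iff₀ hM0] at hxy
    have h6 : ‖w‖ * M = ‖w‖ + ‖Tc‖ * (c * (‖π‖ * ‖w‖)) + ‖Tc'‖ * (c * (‖π‖ * ‖w‖)) := by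
      rw [hM]; ring
    linarith
  refine ⟨e + e', l + v, fun i => hv.add_nonneg (hl i) (hl0 i), k + (g + (w - (T e' + T' v))),
    hK.add_mem hk (hg _ hs hsn), ?_⟩
  rw [map_add, map_add, hw]
  abel

end TangentCones

/-! ### Hadamard derivatives and variational inequalities -/

section Variational

variable {E F : Type*} [NormedAddCommGroup E] [NormedSpace ℝ E] [NormedAddCommGroup F]
  [NormedSpace ℝ F]

/-- The Hadamard limit exists by assumption; restricting it to the fixed direction `d` identifies it
with `dirDeriv`. -/
theorem DirDifferentiableAt.tendsto_dirDeriv {E F : Type*} [NormedAddCommGroup E]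
    [InnerProductSpace ℝ E] [NormedAddCommGroup F] [InnerProductSpace ℝ F] {G : E → F} {x : E}
    (h : DirDifferentiableAt G x) (d : E) :
    Tendsto (fun p : ℝ × E => p.1⁻¹ • (G (x + p.1 • p.2) - G x)) (𝓝[>] (0 : ℝ) ×ˢ 𝓝 d)
      (𝓝 (dirDeriv G x d)) := by
  obtain ⟨v, hv⟩ := h d
  have h1 : Tendsto (fun t : ℝ => t⁻¹ • (G (x + t • d) - G x)) (𝓝[>] 0) (𝓝 v) :=
    hv.comp (tendsto_id.prodMk tendsto_const_nhds)
  have : dirDeriv G x d = v := h1.limUnder_eq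
  rwa [this]

theorem DirDifferentiableAt.dirDeriv_smul {E F : Type*} [NormedAddCommGroup E]
    [InnerProductSpace ℝ E] [NormedAddCommGroup F] [InnerProductSpace ℝ F] {G : E → F} {x : E}
    (h : DirDifferentiableAt G x) (d : E) {r : ℝ} (hr : 0 < r) :
    dirDeriv G x (r • d) = r • dirDeriv G x d := by
  have h1 : Tendsto (fun t : ℝ => t⁻¹ • (G (x + t • r • d) - G x)) (𝓝[>] 0)
      (𝓝 (dirDeriv G x (r • d))) :=
    (h.tendsto_dirDeriv (r • d)).comp (tendsto_id.prodMk tendsto_const_nhds)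
  have h2 : Tendsto (fun t : ℝ => t⁻¹ • (G (x + t • d) - G x)) (𝓝[>] 0)
      (𝓝 (dirDeriv G x d)) :=
    (h.tendsto_dirDeriv d).comp (tendsto_id.prodMk tendsto_const_nhds)
  have h3 : Tendsto (fun t : ℝ => t * r) (𝓝[>] 0) (𝓝[>] 0) := by
    refine tendsto_nhdsWithin_iff.2 ⟨?_, ?_⟩
    · have : Tendsto (fun t : ℝ => t * r) (𝓝 0) (𝓝 (0 * r)) := tendsto_id.mul_const r
      rw [zero_mul] at this
      exact tendsto_nhdsWithin_of_tendsto_nhds this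
    · filter_upwards [self_mem_nhdsWithin] with t ht using mul_pos ht hr
  have h4 := ((h2.comp h3).const_smul r)
  refine tendsto_nhds_unique h1 (h4.congr' ?_)
  filter_upwards [self_mem_nhdsWithin] with t ht
  have ht' : t ≠ 0 := ne_of_gt ht
  simp only [Function.comp_apply, smul_smul]
  congr 1
  field_simp

/-- The limit along the product filter is locally uniform in `d`. Closed neighborhoods, available in
a regular space, survive the passage to the limit at nearby directions. -/
theorem continuous_of_tendsto_prod {α E F : Type*} [TopologicalSpace E] [TopologicalSpace F]
    [RegularSpace F] {l : Filter α} [l.NeBot] {f : α × E → F} {g : E → F}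
    (h : ∀ d, Tendsto f (l ×ˢ 𝓝 d) (𝓝 (g d))) : Continuous g := by
  rw [continuous_iff_continuousAt]
  intro d
  refine (closed_nhds_basis (g d)).tendsto_right_iff.2 ?_
  rintro C ⟨hC, hCcl⟩
  obtain ⟨p, hp, q, hq, hpq⟩ := eventually_prod_iff.1 ((h d).eventually hC)
  filter_upwards [hq] with d' hd'
  refine hCcl.mem_of_tendsto
    (f := fun a => f (a, d')) ((h d').comp (tendsto_id.prodMk tendsto_const_nhds)) ?_
  filter_upwards [hp] with a ha using hpq ha hd'

/-- Solution of a variational inequality, as a limit of minimizers of functions whose gradients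
converge continuously. -/
theorem exists_variational_inequality {C : Set E} (hC : IsCompact C) (hcv : Convex ℝ C)
    (hne : C.Nonempty) {ψ : ℝ → E → ℝ} {g : ℝ → E → E →L[ℝ] ℝ} {G : E → E →L[ℝ] ℝ}
    (hg : ∀ᶠ t in 𝓝[>] (0 : ℝ), ∀ d ∈ C, HasFDerivAt (ψ t) (g t d) d)
    (hG : ∀ d, Tendsto (fun p : ℝ × E => g p.1 p.2) (𝓝[>] (0 : ℝ) ×ˢ 𝓝 d) (𝓝 (G d))) :
    ∃ d ∈ C, ∀ d' ∈ C, 0 ≤ G d (d' - d) := by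
  have hmin : ∀ᶠ t in 𝓝[>] (0 : ℝ), ∃ d ∈ C, ∀ d' ∈ C, 0 ≤ g t d (d' - d) := by
    filter_upwards [hg] with t ht
    obtain ⟨d, hd, hdm⟩ := hC.exists_isMinOn hne
      (fun d hd => (ht d hd).continuousAt.continuousWithinAt)
    refine ⟨d, hd, fun d' hd' => ?_⟩
    have hseg : segment ℝ d d' ⊆ C := hcv.segment_subset hd hd'
    exact hdm.localize.hasFDerivWithinAt_nonneg (ht d hd).hasFDerivWithinAt
      (sub_mem_posTangentConeAt_of_segment_subset hseg)
  obtain ⟨u, hu, hP⟩ := exists_seq_forall_of_frequently hmin.frequently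
  choose d hdC hd using hP
  obtain ⟨d0, hd0, φ, hφ, hlim⟩ := hC.tendsto_subseq hdC
  refine ⟨d0, hd0, fun d' hd' => ?_⟩
  -- The gradients converge even with moving arguments, so the first-order conditions of the
  -- minimizers pass to the limit.
  have h1 : Tendsto (fun k => g (u (φ k)) (d (φ k))) atTop (𝓝 (G d0)) :=
    (hG d0).comp ((hu.comp hφ.tendsto_atTop).prodMk hlim)
  have h2 : Tendsto (fun k => g (u (φ k)) (d (φ k)) (d' - d (φ k))) atTop
      (𝓝 (G d0 (d' - d0))) :=
    (isBoundedBilinearMap_apply.continuous.tendsto (G d0, d' - d0)).comp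
      (h1.prodMk_nhds (tendsto_const_nhds.sub hlim))
  exact ge_of_tendsto' h2 fun k => hd _ d' hd'

end Variational

/-! ### Semidefinite matrices, pseudo-inverses and square roots -/

section Matrices

variable {n : ℕ}

theorem posSemidef_iff_real {M : Matrix (Fin n) (Fin n) ℝ} (hM : Mᵀ = M) :
    M.PosSemidef ↔ ∀ v : Fin n → ℝ, 0 ≤ v ⬝ᵥ M *ᵥ v := by
  have hH : M.IsHermitian := by
    rw [Matrix.IsHermitian, conjTranspose_eq_transpose_of_trivial, hM]
  rw [posSemidef_iff_dotProduct_mulVec, and_iff_right hH]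
  simp

section
open scoped MatrixOrder

theorem exists_eq_transpose_mul_self {A : Matrix (Fin n) (Fin n) ℝ} (hA : A.PosSemidef) :
    ∃ B : Matrix (Fin n) (Fin n) ℝ, A = Bᵀ * B := by
  obtain ⟨B, hB⟩ := CStarAlgebra.nonneg_iff_eq_star_mul_self.mp hA.nonneg
  exact ⟨B, by rw [hB, star_eq_conjTranspose, conjTranspose_eq_transpose_of_trivial]⟩

end

theorem trace_mul_eq_trace_transpose_mul_self (B C : Matrix (Fin n) (Fin n) ℝ) :
    (Bᵀ * B * (Cᵀ * C)).trace = ((C * Bᵀ)ᵀ * (C * Bᵀ)).trace := by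
  rw [transpose_mul, transpose_transpose, Matrix.mul_assoc, Matrix.trace_mul_comm]
  simp only [Matrix.mul_assoc]

theorem trace_mul_nonneg {A B : Matrix (Fin n) (Fin n) ℝ} (hA : A.PosSemidef)
    (hB : B.PosSemidef) : 0 ≤ (A * B).trace := by
  obtain ⟨C, rfl⟩ := exists_eq_transpose_mul_self hA
  obtain ⟨D, rfl⟩ := exists_eq_transpose_mul_self hB
  rw [trace_mul_eq_trace_transpose_mul_self]
  have := (posSemidef_conjTranspose_mul_self (D * Cᵀ)).trace_nonneg
  rwa [conjTranspose_eq_transpose_of_trivial] at this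

/-- With Gram factorizations CᵀC and DᵀD the trace of the product is the squared Frobenius norm of D
Cᵀ. -/
theorem mul_eq_zero_of_trace_eq_zero {A B : Matrix (Fin n) (Fin n) ℝ} (hA : A.PosSemidef)
    (hB : B.PosSemidef) (h : (A * B).trace = 0) : A * B = 0 := by
  obtain ⟨C, rfl⟩ := exists_eq_transpose_mul_self hA
  obtain ⟨D, rfl⟩ := exists_eq_transpose_mul_self hB
  rw [trace_mul_eq_trace_transpose_mul_self] at h
  have h2 : D * Cᵀ = 0 := by
    rw [← trace_conjTranspose_mul_self_eq_zero_iff, conjTranspose_eq_transpose_of_trivial]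
    exact h
  have h3 : C * Dᵀ = 0 := by
    have := congrArg Matrix.transpose h2
    rwa [transpose_mul, transpose_transpose, transpose_zero] at this
  calc Cᵀ * C * (Dᵀ * D) = Cᵀ * (C * Dᵀ) * D := by simp only [Matrix.mul_assoc]
    _ = 0 := by rw [h3]; simp

theorem IsMoorePenrose.unique {A B C : Matrix (Fin n) (Fin n) ℝ} (hB : IsMoorePenrose A B)
    (hC : IsMoorePenrose A C) : B = C := by
  obtain ⟨b1, b2, b3, b4⟩ := hB
  obtain ⟨c1, c2, c3, c4⟩ := hC
  have e1 : B * A = C * A := by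
    calc B * A = (B * A)ᵀ := b4.symm
      _ = (B * (A * C * A))ᵀ := by rw [c1]
      _ = ((B * A) * (C * A))ᵀ := by simp only [Matrix.mul_assoc]
      _ = (C * A) * (B * A) := by rw [transpose_mul, b4, c4]
      _ = C * (A * B * A) := by simp only [Matrix.mul_assoc]
      _ = C * A := by rw [b1]
  have e2 : A * B = A * C := by
    calc A * B = (A * B)ᵀ := b3.symm
      _ = ((A * C * A) * B)ᵀ := by rw [c1]
      _ = ((A * C) * (A * B))ᵀ := by simp only [Matrix.mul_assoc]
      _ = (A * B) * (A * C) := by rw [transpose_mul, b3, c3]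
      _ = (A * B * A) * C := by simp only [Matrix.mul_assoc]
      _ = A * C := by rw [b1]
  calc B = B * A * B := b2.symm
    _ = C * A * B := by rw [e1]
    _ = C * A * C := by rw [Matrix.mul_assoc, e2, Matrix.mul_assoc]
    _ = C := c2

theorem pinv_eq {A B : Matrix (Fin n) (Fin n) ℝ} (h : IsMoorePenrose A B) : pinv A = B :=
  (Classical.epsilon_spec (p := IsMoorePenrose A) ⟨B, h⟩).unique h

theorem mul_diagonal_mul_transpose {U : Matrix (Fin n) (Fin n) ℝ} (hU : Uᵀ * U = 1)
    (a b : Fin n → ℝ) : (U * diagonal a * Uᵀ) * (U * diagonal b * Uᵀ)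
      = U * diagonal (fun i => a i * b i) * Uᵀ := by
  calc (U * diagonal a * Uᵀ) * (U * diagonal b * Uᵀ)
      = U * diagonal a * (Uᵀ * U) * diagonal b * Uᵀ := by simp only [Matrix.mul_assoc]
    _ = _ := by rw [hU, Matrix.mul_one, Matrix.mul_assoc U, diagonal_mul_diagonal]

theorem transpose_mul_diagonal_mul (U : Matrix (Fin n) (Fin n) ℝ) (a : Fin n → ℝ) :
    (U * diagonal a * Uᵀ)ᵀ = U * diagonal a * Uᵀ := by
  simp [Matrix.transpose_mul, Matrix.mul_assoc]

/-- The convention `0⁻¹ = 0` makes entrywise inversion produce the pseudo-inverse. -/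
theorem pinv_conj_diagonal {U : Matrix (Fin n) (Fin n) ℝ} (hU : Uᵀ * U = 1) (a : Fin n → ℝ) :
    pinv (U * diagonal a * Uᵀ) = U * diagonal (fun i => (a i)⁻¹) * Uᵀ := by
  apply pinv_eq
  refine ⟨?_, ?_, ?_, ?_⟩ <;>
    simp only [mul_diagonal_mul_transpose hU, transpose_mul_diagonal_mul]
  · congr 3; funext i; exact mul_inv_mul_cancel (a i)
  · congr 3; funext i; simpa using mul_inv_mul_cancel (a i)⁻¹

section
open scoped MatrixOrder

theorem psdSqrt_conj_diagonal {U : Matrix (Fin n) (Fin n) ℝ} (hU : Uᵀ * U = 1) {a : Fin n → ℝ}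
    (ha : ∀ i, 0 ≤ a i) :
    psdSqrt (U * diagonal a * Uᵀ) = U * diagonal (fun i => √(a i)) * Uᵀ := by
  apply CFC.sqrt_unique
  · rw [mul_diagonal_mul_transpose hU]
    congr 3; funext i; exact Real.mul_self_sqrt (ha i)
  · rw [Matrix.nonneg_iff_posSemidef]
    have := (PosSemidef.diagonal (d := fun i => √(a i))
      (fun i => Real.sqrt_nonneg (a i))).mul_mul_conjTranspose_same U
    rwa [conjTranspose_eq_transpose_of_trivial] at this

end

/-- A quadratic form that is nonnegative on a coordinate plane and vanishes at one of the basis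
vectors has vanishing mixed entry. -/
theorem entry_eq_zero_of_diag_eq_zero {A : Matrix (Fin n) (Fin n) ℝ} (hA : Aᵀ = A)
    {i j : Fin n} (h : ∀ v : Fin n → ℝ, (∀ k, k ≠ i → k ≠ j → v k = 0) → 0 ≤ v ⬝ᵥ A *ᵥ v)
    (hj : A j j = 0) : A i j = 0 := by
  by_cases hij : i = j
  · rw [hij, hj]
  have key : ∀ τ : ℝ, 0 ≤ A i i + 2 * τ * A i j := by
    intro τ
    have h1 := h (Pi.single i 1 + τ • Pi.single j 1) (by
      intro k hki hkj; simp [hki, hkj])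
    have h2 : A j i = A i j := by rw [← Matrix.transpose_apply A i j, hA]
    simp only [mulVec_add, mulVec_smul, dotProduct_add, add_dotProduct, smul_dotProduct,
      dotProduct_smul, single_dotProduct, mulVec_single_one, col_apply, smul_eq_mul, one_mul,
      h2, hj] at h1
    linarith
  by_contra hne
  -- This value of `τ` makes the affine expression in `key` equal to `-1`.
  have h1 := key (-(A i i + 1) / (2 * A i j))
  have h2 : 2 * (-(A i i + 1) / (2 * A i j)) * A i j = -(A i i + 1) := by field_simp
  linarith

theorem dotProduct_mulVec_eq_sum (A : Matrix (Fin n) (Fin n) ℝ) (v : Fin n → ℝ) :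
    v ⬝ᵥ A *ᵥ v = ∑ i, ∑ j, A i j * (v i * v j) := by
  simp only [dotProduct, mulVec, Finset.mul_sum]
  exact Finset.sum_congr rfl fun i _ => Finset.sum_congr rfl fun j _ => by ring

end Matrices

/-! ### Symmetric matrices in an orthonormal basis -/

namespace Sym

variable {n : ℕ}

theorem mat_apply (X : Sym n) (i j : Fin n) : X.mat i j = X.1 (i, j) := rfl

theorem mat_injective {X Y : Sym n} (h : X.mat = Y.mat) : X = Y := by
  apply Subtype.ext
  ext p
  exact congrFun (congrFun h p.1) p.2

@[simp] theorem mat_add (X Y : Sym n) : (X + Y).mat = X.mat + Y.mat := rfl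
@[simp] theorem mat_sub (X Y : Sym n) : (X - Y).mat = X.mat - Y.mat := rfl
@[simp] theorem mat_smul (t : ℝ) (X : Sym n) : (t • X).mat = t • X.mat := rfl
@[simp] theorem mat_zero : (0 : Sym n).mat = 0 := rfl

@[simp] theorem mat_transpose (X : Sym n) : X.matᵀ = X.mat := by
  ext i j; exact (X.2 i j).symm

/-- The element of `𝕊^n` with a given symmetric matrix. -/
def ofMat (M : Matrix (Fin n) (Fin n) ℝ) (h : Mᵀ = M) : Sym n :=
  ⟨WithLp.toLp 2 fun p => M p.1 p.2, fun i j => by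
    change M i j = M j i
    rw [← Matrix.transpose_apply M j i, h]⟩

@[simp] theorem mat_ofMat (M : Matrix (Fin n) (Fin n) ℝ) (h : Mᵀ = M) : (ofMat M h).mat = M := rfl

theorem inner_eq_trace (X Y : Sym n) : ⟪X, Y⟫ = (X.mat * Y.mat).trace := by
  have : ⟪X, Y⟫ = ∑ p : Fin n × Fin n, X.1 p * Y.1 p := by
    rw [Submodule.coe_inner, PiLp.inner_apply]
    exact Finset.sum_congr rfl fun p _ => by simp [mul_comm]
  rw [this, Fintype.sum_prod_type, Matrix.trace]
  refine Finset.sum_congr rfl fun i _ => ?_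
  rw [Matrix.diag_apply, Matrix.mul_apply]
  refine Finset.sum_congr rfl fun j _ => ?_
  rw [mat_apply, mat_apply, Y.2 i j]

/-- Coordinates of a symmetric matrix in the basis formed by the columns of `U`. -/
def coord (U : Matrix (Fin n) (Fin n) ℝ) (X : Sym n) : Matrix (Fin n) (Fin n) ℝ := Uᵀ * X.mat * U

variable {U : Matrix (Fin n) (Fin n) ℝ}

@[simp] theorem coord_add (X Y : Sym n) : coord U (X + Y) = coord U X + coord U Y := by
  simp [coord, Matrix.mul_add, Matrix.add_mul]
@[simp] theorem coord_sub (X Y : Sym n) : coord U (X - Y) = coord U X - coord U Y := by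
  simp [coord, Matrix.mul_sub, Matrix.sub_mul]
@[simp] theorem coord_smul (t : ℝ) (X : Sym n) : coord U (t • X) = t • coord U X := by
  simp [coord]
@[simp] theorem coord_zero : coord U (0 : Sym n) = 0 := by simp [coord]

@[simp] theorem coord_transpose (X : Sym n) : (coord U X)ᵀ = coord U X := by
  simp [coord, Matrix.transpose_mul, Matrix.mul_assoc]

theorem coord_symm (X : Sym n) (i j : Fin n) : coord U X i j = coord U X j i := by
  rw [← Matrix.transpose_apply (coord U X) j i, coord_transpose]

theorem mat_eq_coord (hU : Uᵀ * U = 1) (X : Sym n) : X.mat = U * coord U X * Uᵀ := by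
  have hU' : U * Uᵀ = 1 := mul_eq_one_comm.1 hU
  calc X.mat = (U * Uᵀ) * X.mat * (U * Uᵀ) := by rw [hU']; simp
    _ = _ := by simp only [coord, Matrix.mul_assoc]

theorem coord_injective (hU : Uᵀ * U = 1) {X Y : Sym n} (h : coord U X = coord U Y) : X = Y :=
  mat_injective (by rw [mat_eq_coord hU X, mat_eq_coord hU Y, h])

/-- The symmetric matrix with given coordinates. -/
def ofCoord (U M : Matrix (Fin n) (Fin n) ℝ) (h : Mᵀ = M) : Sym n :=
  ofMat (U * M * Uᵀ) (by simp [Matrix.transpose_mul, Matrix.mul_assoc, h])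

theorem coord_ofCoord (hU : Uᵀ * U = 1) (M : Matrix (Fin n) (Fin n) ℝ) (h : Mᵀ = M) :
    coord U (ofCoord U M h) = M := by
  calc coord U (ofCoord U M h) = (Uᵀ * U) * M * (Uᵀ * U) := by
        simp only [coord, ofCoord, mat_ofMat, Matrix.mul_assoc]
    _ = M := by rw [hU]; simp

theorem coord_mul (hU : Uᵀ * U = 1) (X Y : Sym n) :
    coord U X * coord U Y = Uᵀ * (X.mat * Y.mat) * U := by
  have hU' : U * Uᵀ = 1 := mul_eq_one_comm.1 hU
  calc coord U X * coord U Y = Uᵀ * X.mat * (U * Uᵀ) * Y.mat * U := by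
        simp only [coord, Matrix.mul_assoc]
    _ = _ := by rw [hU', Matrix.mul_one]; simp only [Matrix.mul_assoc]

theorem inner_eq_trace_coord (hU : Uᵀ * U = 1) (X Y : Sym n) :
    ⟪X, Y⟫ = (coord U X * coord U Y).trace := by
  have hU' : U * Uᵀ = 1 := mul_eq_one_comm.1 hU
  rw [coord_mul hU, Matrix.mul_assoc, Matrix.trace_mul_comm, Matrix.mul_assoc, hU',
    Matrix.mul_one, inner_eq_trace]

theorem inner_eq_sum_coord (hU : Uᵀ * U = 1) (X Y : Sym n) :
    ⟪X, Y⟫ = ∑ i, ∑ j, coord U X i j * coord U Y i j := by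
  rw [inner_eq_trace_coord hU, Matrix.trace]
  refine Finset.sum_congr rfl fun i _ => ?_
  rw [Matrix.diag_apply, Matrix.mul_apply]
  exact Finset.sum_congr rfl fun j _ => by rw [coord_symm Y j i]

theorem abs_coord_le (hU : Uᵀ * U = 1) (X : Sym n) (i j : Fin n) : |coord U X i j| ≤ ‖X‖ := by
  apply abs_le_of_sq_le_sq _ (norm_nonneg _)
  rw [← real_inner_self_eq_norm_sq, inner_eq_sum_coord hU]
  have h1 : coord U X i j ^ 2 ≤ ∑ l, coord U X i l * coord U X i l := by
    rw [sq]
    exact Finset.single_le_sum (f := fun l => coord U X i l * coord U X i l)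
      (fun l _ => mul_self_nonneg _) (Finset.mem_univ j)
  exact h1.trans (Finset.single_le_sum (f := fun k => ∑ l, coord U X k l * coord U X k l)
      (fun k _ => Finset.sum_nonneg fun l _ => mul_self_nonneg _) (Finset.mem_univ i))

theorem continuous_coord_apply (i j : Fin n) : Continuous fun X : Sym n => coord U X i j := by
  have : (fun X : Sym n => coord U X i j)
      = fun X : Sym n => ∑ l, (∑ k, U k i * X.1 (k, l)) * U l j := by
    funext X
    simp [coord, Matrix.mul_apply, mat_apply]
  rw [this]
  refine continuous_finsetSum _ fun l _ => (continuous_finsetSum _ fun k _ => ?_).mul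
    continuous_const
  exact continuous_const.mul ((EuclideanSpace.proj (𝕜 := ℝ) (k, l)).continuous.comp
    continuous_subtype_val)

theorem mem_psdCone_iff_coord (hU : Uᵀ * U = 1) {X : Sym n} :
    X ∈ psdCone n ↔ (coord U X).PosSemidef := by
  constructor
  · intro h
    have := PosSemidef.conjTranspose_mul_mul_same (A := X.mat) h U
    rwa [conjTranspose_eq_transpose_of_trivial] at this
  · intro h
    have := h.mul_mul_conjTranspose_same U
    rw [conjTranspose_eq_transpose_of_trivial, ← mat_eq_coord hU] at this
    exact this

theorem mem_psdCone_iff_forall (hU : Uᵀ * U = 1) {X : Sym n} :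
    X ∈ psdCone n ↔ ∀ v : Fin n → ℝ, 0 ≤ v ⬝ᵥ coord U X *ᵥ v := by
  rw [mem_psdCone_iff_coord hU, posSemidef_iff_real (coord_transpose X)]

theorem inner_nonneg {X Y : Sym n} (hX : X ∈ psdCone n) (hY : Y ∈ psdCone n) : 0 ≤ ⟪X, Y⟫ := by
  rw [inner_eq_trace]; exact trace_mul_nonneg hX hY

theorem mul_eq_zero_of_inner_eq_zero {X Y : Sym n} (hX : X ∈ psdCone n) (hY : Y ∈ psdCone n)
    (h : ⟪X, Y⟫ = 0) : X.mat * Y.mat = 0 := by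
  rw [inner_eq_trace] at h; exact mul_eq_zero_of_trace_eq_zero hX hY h

end Sym

theorem isPointedCone_psdCone (n : ℕ) : IsPointedCone (psdCone n) :=
  ⟨Matrix.PosSemidef.zero, fun hx hy => Matrix.PosSemidef.add hx hy,
    fun ht hx => Matrix.PosSemidef.smul hx ht⟩

/-! ### Simultaneous diagonalization of a complementary pair -/

variable {n : ℕ}

/-- A simultaneous diagonalization of a complementary pair of positive semidefinite matrices. -/
structure Frame (S X : Sym n) where
  U : Matrix (Fin n) (Fin n) ℝ
  s : Fin n → ℝ
  x : Fin n → ℝ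
  orth : Uᵀ * U = 1
  coord_S : Sym.coord U S = diagonal s
  coord_X : Sym.coord U X = diagonal x
  s_nonneg : ∀ i, 0 ≤ s i
  x_nonneg : ∀ i, 0 ≤ x i
  compl : ∀ i, s i * x i = 0

/-- `X` and `S` have product zero, so they are the positive and negative parts of `X - S`; an
eigenbasis of the difference diagonalizes both. -/
theorem exists_frame {S X : Sym n} (hS : S ∈ psdCone n) (hX : X ∈ psdCone n)
    (h : ⟪S, X⟫ = 0) : Nonempty (Frame S X) := by
  have hSX : S.mat * X.mat = 0 := Sym.mul_eq_zero_of_inner_eq_zero hS hX h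
  have hXS : X.mat * S.mat = 0 := by
    have := congrArg Matrix.transpose hSX
    rwa [transpose_mul, Sym.mat_transpose, Sym.mat_transpose, transpose_zero] at this
  have hM : (X.mat - S.mat).IsHermitian := hX.1.sub hS.1
  let u : Fin n → Fin n → ℝ := fun j => ⇑(hM.eigenvectorBasis j)
  let l : Fin n → ℝ := hM.eigenvalues
  have hu : ∀ j, (X.mat - S.mat) *ᵥ u j = l j • u j := hM.mulVec_eigenvectorBasis
  have hquad : ∀ {A : Sym n}, A ∈ psdCone n → ∀ v, 0 ≤ v ⬝ᵥ A.mat *ᵥ v := fun {A} hA =>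
    (posSemidef_iff_real A.mat_transpose).1 hA
  have hzero : ∀ {A B : Sym n}, A ∈ psdCone n → A.mat * B.mat = 0 → ∀ (v : Fin n → ℝ) (r : ℝ),
      0 ≤ r → (B.mat - A.mat) *ᵥ v = r • v → A.mat *ᵥ v = 0 ∧ B.mat *ᵥ v = r • v := by
    intro A B hA hAB v r hr hv
    -- From `A B = 0` one gets ‖A v‖² = -r vᵀ A v. The right side is nonpositive, so `A v = 0`.
    have h1 : A.mat *ᵥ v ⬝ᵥ A.mat *ᵥ v = -(r * (v ⬝ᵥ A.mat *ᵥ v)) := by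
      have h2 : A.mat *ᵥ ((B.mat - A.mat) *ᵥ v) = r • (A.mat *ᵥ v) := by rw [hv, mulVec_smul]
      rw [mulVec_mulVec, Matrix.mul_sub, hAB, zero_sub, neg_mulVec, ← mulVec_mulVec] at h2
      have h3 : A.mat *ᵥ v ⬝ᵥ A.mat *ᵥ v = v ⬝ᵥ A.mat *ᵥ (A.mat *ᵥ v) := by
        rw [dotProduct_mulVec v, ← mulVec_transpose, A.mat_transpose]
      rw [h3, ← neg_neg (A.mat *ᵥ (A.mat *ᵥ v)), h2, dotProduct_neg, dotProduct_smul, smul_eq_mul]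
    have h4 : A.mat *ᵥ v = 0 := by
      rw [← dotProduct_self_eq_zero]
      refine le_antisymm ?_ (Finset.sum_nonneg fun i _ => mul_self_nonneg _)
      rw [h1]
      have := mul_nonneg hr (hquad hA v)
      linarith
    refine ⟨h4, ?_⟩
    rw [← hv, sub_mulVec, h4, sub_zero]
  have hboth : ∀ j, X.mat *ᵥ u j = max (l j) 0 • u j ∧ S.mat *ᵥ u j = max (-l j) 0 • u j := by
    intro j
    rcases le_total 0 (l j) with hl | hl
    · obtain ⟨h1, h2⟩ := hzero hS hSX (u j) (l j) hl (hu j)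
      rw [max_eq_left hl, max_eq_right (neg_nonpos.2 hl), zero_smul]
      exact ⟨h2, h1⟩
    · obtain ⟨h1, h2⟩ := hzero hX hXS (u j) (-l j) (neg_nonneg.2 hl) (by
        rw [← neg_sub, neg_mulVec, hu j, neg_smul])
      rw [max_eq_right hl, max_eq_left (neg_nonneg.2 hl), zero_smul]
      exact ⟨h1, h2⟩
  let U : Matrix (Fin n) (Fin n) ℝ := (hM.eigenvectorUnitary : Matrix (Fin n) (Fin n) ℝ)
  have hU : Uᵀ * U = 1 := by
    have := Unitary.coe_star_mul_self hM.eigenvectorUnitary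
    rwa [star_eq_conjTranspose, conjTranspose_eq_transpose_of_trivial] at this
  have hcol : ∀ (A : Matrix (Fin n) (Fin n) ℝ) (a : Fin n → ℝ),
      (∀ j, A *ᵥ u j = a j • u j) → Uᵀ * A * U = diagonal a := by
    intro A a ha
    have : A * U = U * diagonal a := by
      ext i j
      rw [Matrix.mul_diagonal]
      have := congrFun (ha j) i
      rw [Pi.smul_apply, smul_eq_mul, mul_comm] at this
      exact this
    rw [Matrix.mul_assoc, this, ← Matrix.mul_assoc, hU, Matrix.one_mul]
  refine ⟨⟨U, fun j => max (-l j) 0, fun j => max (l j) 0, hU,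
    hcol S.mat _ fun j => (hboth j).2, hcol X.mat _ fun j => (hboth j).1,
    fun _ => le_max_right _ _, fun _ => le_max_right _ _, fun j => ?_⟩⟩
  rcases le_total 0 (l j) with hl | hl
  · simp [hl]
  · simp [hl]

/-! ### Tangent cone, critical cone and K in frame coordinates -/

namespace Frame

variable {S X : Sym n} (f : Frame S X)

/-- The frame of the interchanged pair. -/
noncomputable def swap : Frame X S :=
  ⟨f.U, f.x, f.s, f.orth, f.coord_X, f.coord_S, f.x_nonneg, f.s_nonneg, fun i => by
    rw [mul_comm]; exact f.compl i⟩

/-- Coordinates with respect to a frame. -/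
noncomputable abbrev c (D : Sym n) : Matrix (Fin n) (Fin n) ℝ := Sym.coord f.U D

theorem s_eq_zero_of_x {i : Fin n} (h : f.x i ≠ 0) : f.s i = 0 :=
  (mul_eq_zero.1 (f.compl i)).resolve_right h

theorem x_eq_zero_of_s {i : Fin n} (h : f.s i ≠ 0) : f.x i = 0 :=
  (mul_eq_zero.1 (f.compl i)).resolve_left h

theorem inner_eq (D E : Sym n) : ⟪D, E⟫ = ∑ i, ∑ j, f.c D i j * f.c E i j :=
  Sym.inner_eq_sum_coord f.orth D E

theorem c_S : f.c S = diagonal f.s := f.coord_S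

theorem inner_S (D : Sym n) : ⟪S, D⟫ = ∑ i, f.s i * f.c D i i := by
  rw [f.inner_eq, f.c_S]
  refine Finset.sum_congr rfl fun i _ => ?_
  simp [diagonal_apply]

theorem inner_X (D : Sym n) : ⟪X, D⟫ = ∑ i, f.x i * f.c D i i := f.swap.inner_S D

theorem S_mem (f : Frame S X) : S ∈ psdCone n := by
  rw [Sym.mem_psdCone_iff_coord f.orth, f.coord_S]
  exact PosSemidef.diagonal f.s_nonneg

theorem mat_S : S.mat = f.U * diagonal f.s * f.Uᵀ := by
  rw [Sym.mat_eq_coord f.orth S, f.coord_S]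

theorem mat_X : X.mat = f.U * diagonal f.x * f.Uᵀ := f.swap.mat_S

/-- The rank one matrix `v vᵀ` in coordinates. -/
noncomputable def rankOne (v : Fin n → ℝ) : Sym n :=
  Sym.ofCoord f.U (Matrix.of fun i j => v i * v j) (by ext i j; simp [mul_comm])

theorem c_rankOne (v : Fin n → ℝ) (i j : Fin n) : f.c (f.rankOne v) i j = v i * v j := by
  rw [c, rankOne, Sym.coord_ofCoord f.orth]; rfl

theorem inner_rankOne (D : Sym n) (v : Fin n → ℝ) :
    ⟪D, f.rankOne v⟫ = v ⬝ᵥ f.c D *ᵥ v := by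
  rw [f.inner_eq, dotProduct_mulVec_eq_sum]
  simp only [c_rankOne]

theorem rankOne_mem (v : Fin n → ℝ) : f.rankOne v ∈ psdCone n := by
  rw [Sym.mem_psdCone_iff_forall f.orth]
  intro w
  rw [dotProduct_mulVec_eq_sum]
  have : ∑ i, ∑ j, f.c (f.rankOne v) i j * (w i * w j) = (∑ i, v i * w i) * ∑ j, v j * w j := by
    rw [Finset.sum_mul_sum]
    exact Finset.sum_congr rfl fun i _ => Finset.sum_congr rfl fun j _ => by
      rw [c_rankOne]; ring
  rw [this]; exact mul_self_nonneg _

/-- Entries of a matrix masked by a set of indices. -/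
noncomputable def mask (D : Sym n) (p : Fin n → Prop) [DecidablePred p] : Sym n :=
  Sym.ofCoord f.U (Matrix.of fun i j => if p i ∧ p j then f.c D i j else 0) (by
    ext i j
    simp only [transpose_apply, of_apply, and_comm (a := p j), Sym.coord_symm D j i])

theorem c_mask (D : Sym n) (p : Fin n → Prop) [DecidablePred p] (i j : Fin n) :
    f.c (f.mask D p) i j = if p i ∧ p j then f.c D i j else 0 := by
  rw [c, mask, Sym.coord_ofCoord f.orth]; rfl

theorem mask_quad (D : Sym n) (p : Fin n → Prop) [DecidablePred p] (v : Fin n → ℝ) :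
    v ⬝ᵥ f.c (f.mask D p) *ᵥ v
      = (fun i => if p i then v i else 0) ⬝ᵥ f.c D *ᵥ (fun i => if p i then v i else 0) := by
  rw [dotProduct_mulVec_eq_sum, dotProduct_mulVec_eq_sum]
  refine Finset.sum_congr rfl fun i _ => Finset.sum_congr rfl fun j _ => ?_
  rw [c_mask]
  by_cases hi : p i <;> by_cases hj : p j <;> simp [hi, hj]

theorem mask_mem (D : Sym n) (p : Fin n → Prop) [DecidablePred p]
    (h : ∀ v : Fin n → ℝ, (∀ i, ¬p i → v i = 0) → 0 ≤ v ⬝ᵥ f.c D *ᵥ v) :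
    f.mask D p ∈ psdCone n := by
  rw [Sym.mem_psdCone_iff_forall f.orth]
  intro v
  change 0 ≤ v ⬝ᵥ f.c (f.mask D p) *ᵥ v
  rw [mask_quad]
  exact h _ fun i hi => by simp [hi]

/-- An inward normal at `S` is semidefinite and orthogonal to `S`, hence supported on the kernel
block of `S`, and it tests only that block of `D`. Rank one matrices on the kernel are such normals
and give the converse. -/
theorem mem_posTangentConeAt_iff (D : Sym n) : D ∈ posTangentConeAt (psdCone n) S ↔
    ∀ v : Fin n → ℝ, (∀ i, f.s i ≠ 0 → v i = 0) → 0 ≤ v ⬝ᵥ f.c D *ᵥ v := by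
  classical
  rw [SDP.mem_posTangentConeAt_iff (isPointedCone_psdCone n).convex f.S_mem]
  constructor
  · intro h v hv
    rw [← inner_rankOne, real_inner_comm]
    refine h _ fun Y hY => ?_
    rw [inner_sub_right, real_inner_comm Y, real_inner_comm S, f.inner_S]
    have h0 : ∑ i, f.s i * f.c (f.rankOne v) i i = 0 := by
      refine Finset.sum_eq_zero fun i _ => ?_
      rw [c_rankOne]
      by_cases hs : f.s i = 0
      · simp [hs]
      · simp [hv i hs]
    rw [h0, sub_zero]
    exact Sym.inner_nonneg hY (f.rankOne_mem v)
  · intro h V hV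
    have hK := isPointedCone_psdCone n
    have hVS : ⟪V, S⟫ = 0 := by
      have h1 := hV 0 hK.zero_mem
      have h2 := hV (S + S) (hK.add_mem f.S_mem f.S_mem)
      rw [add_sub_cancel_right] at h2
      rw [zero_sub, inner_neg_right] at h1
      linarith
    have hVp : V ∈ psdCone n := by
      rw [Sym.mem_psdCone_iff_forall f.orth]
      intro v
      have := hV _ (hK.add_mem f.S_mem (f.rankOne_mem v))
      rwa [add_sub_cancel_left, inner_rankOne] at this
    have hquad := (Sym.mem_psdCone_iff_forall f.orth).1 hVp
    have hdiag : ∀ i, 0 ≤ f.c V i i := fun i =>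
      ((Sym.mem_psdCone_iff_coord f.orth).1 hVp).diag_nonneg
    rw [real_inner_comm, f.inner_S, Finset.sum_eq_zero_iff_of_nonneg
      (fun i _ => mul_nonneg (f.s_nonneg i) (hdiag i))] at hVS
    have hz : ∀ i j, f.s j ≠ 0 → f.c V i j = 0 := fun i j hj =>
      entry_eq_zero_of_diag_eq_zero (Sym.coord_transpose V) (fun v _ => hquad v)
        ((mul_eq_zero.1 (hVS j (Finset.mem_univ j))).resolve_left hj)
    have heq : ⟪V, D⟫ = ⟪V, f.mask D fun i => f.s i = 0⟫ := by
      rw [f.inner_eq, f.inner_eq]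
      refine Finset.sum_congr rfl fun i _ => Finset.sum_congr rfl fun j _ => ?_
      rw [c_mask]
      split_ifs with hij
      · rfl
      · rcases not_and_or.1 hij with hi | hj
        · rw [show f.c V i j = f.c V j i from Sym.coord_symm V i j, hz j i hi]; simp
        · rw [hz i j hj]; simp
    rw [heq]
    exact Sym.inner_nonneg hVp (f.mask_mem D _ h)

/-- ⟪X, D⟫ is a sum of nonnegative terms `x j * D j j`, so orthogonality kills the diagonal of `D`
where `x j ≠ 0`. Semidefiniteness on the kernel of `S` then clears the corresponding columns of the
kernel block. -/
theorem mem_criticalCone_iff (D : Sym n) : D ∈ criticalCone (psdCone n) S X ↔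
    (∀ i j, f.s i = 0 → f.x j ≠ 0 → f.c D i j = 0) ∧
    ∀ v : Fin n → ℝ, (∀ i, f.s i ≠ 0 → v i = 0) → 0 ≤ v ⬝ᵥ f.c D *ᵥ v := by
  constructor
  · rintro ⟨h1, h2⟩
    rw [mem_posTangentConeAt_iff] at h1
    refine ⟨fun i j hi hj => ?_, h1⟩
    have hdiag : ∀ i, f.s i = 0 → 0 ≤ f.c D i i := by
      intro i hi
      have := h1 (Pi.single i 1) (fun k hk => by
        have : k ≠ i := fun h => hk (h ▸ hi)
        simp [this])
      simpa using this
    rw [f.inner_X, Finset.sum_eq_zero_iff_of_nonneg] at h2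
    · refine entry_eq_zero_of_diag_eq_zero (Sym.coord_transpose D) (fun v hv => h1 v ?_)
        ((mul_eq_zero.1 (h2 j (Finset.mem_univ j))).resolve_left hj)
      intro k hk
      refine hv k (fun h => hk (h ▸ hi)) (fun h => hk (h ▸ f.s_eq_zero_of_x hj))
    · intro i _
      by_cases hi : f.x i = 0
      · simp [hi]
      · exact mul_nonneg (f.x_nonneg i) (hdiag i (f.s_eq_zero_of_x hi))
  · rintro ⟨h1, h2⟩
    refine ⟨(f.mem_posTangentConeAt_iff D).2 h2, ?_⟩
    rw [f.inner_X]
    refine Finset.sum_eq_zero fun i _ => ?_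
    by_cases hi : f.x i = 0
    · simp [hi]
    · rw [h1 i i (f.s_eq_zero_of_x hi) hi, mul_zero]

theorem rankOne_mem_criticalCone {v : Fin n → ℝ} (hv : ∀ i, f.x i ≠ 0 → v i = 0) :
    f.rankOne v ∈ criticalCone (psdCone n) S X := by
  rw [mem_criticalCone_iff]
  refine ⟨fun i j _ hj => by rw [c_rankOne, hv j hj, mul_zero], fun w _ => ?_⟩
  exact (Sym.mem_psdCone_iff_forall f.orth).1 (f.rankOne_mem v) w

theorem coneK_quad {G : Sym n} (hG : G ∈ coneK S X) {v : Fin n → ℝ}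
    (hv : ∀ i, f.x i ≠ 0 → v i = 0) : 0 ≤ v ⬝ᵥ f.c G *ᵥ v := by
  rw [← inner_rankOne]
  exact mem_dualCone.1 hG _ (f.rankOne_mem_criticalCone hv)

/-- The critical cone does not restrict entries outside the kernel block of `S`, so it contains
whole lines there, and an element of its dual must be orthogonal to them. -/
theorem coneK_zero {G : Sym n} (hG : G ∈ coneK S X) {i : Fin n} (hi : f.s i ≠ 0) (j : Fin n) :
    f.c G i j = 0 := by
  have key : ∀ M : Matrix (Fin n) (Fin n) ℝ, ∀ hM : Mᵀ = M,
      (∀ k l, f.s k = 0 → f.s l = 0 → M k l = 0) →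
      0 ≤ ⟪G, Sym.ofCoord f.U M hM⟫ := by
    intro M hM hz
    refine mem_dualCone.1 hG _ ((f.mem_criticalCone_iff _).2 ?_)
    rw [c, Sym.coord_ofCoord f.orth]
    refine ⟨fun k l hk hl => hz k l hk (f.s_eq_zero_of_x hl), fun v hv => ?_⟩
    rw [dotProduct_mulVec_eq_sum]
    refine Finset.sum_nonneg fun k _ => Finset.sum_nonneg fun l _ => ?_
    by_cases hk : f.s k = 0
    · by_cases hl : f.s l = 0
      · simp [hz k l hk hl]
      · simp [hv l hl]
    · simp [hv k hk]
  -- Both `A` and `-A` are coordinates of critical directions because `s i ≠ 0`.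
  let A : Matrix (Fin n) (Fin n) ℝ := Matrix.single i j 1 + Matrix.single j i 1
  have hA : Aᵀ = A := by simp [A, add_comm]
  have hsum : ∀ (r : ℝ) (hM : (r • A)ᵀ = r • A), ⟪G, Sym.ofCoord f.U (r • A) hM⟫
      = r * (2 * f.c G i j) := by
    intro r hM
    rw [Sym.inner_eq_trace_coord f.orth, Sym.coord_ofCoord f.orth]
    rw [Matrix.mul_smul, Matrix.trace_smul, Matrix.mul_add, Matrix.trace_add,
      Matrix.trace_mul_single, Matrix.trace_mul_single, smul_eq_mul,
      Sym.coord_symm G j i]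
    simp only [MulOpposite.op_one, one_smul]
    ring
  have hzA : ∀ r : ℝ, ∀ k l, f.s k = 0 → f.s l = 0 → (r • A) k l = 0 := by
    intro r k l hk hl
    have h1 : i ≠ k := fun h => hi (h ▸ hk)
    have h2 : i ≠ l := fun h => hi (h ▸ hl)
    simp [A, h1, h2]
  have e1 := key ((1 : ℝ) • A) (by rw [transpose_smul, hA]) (hzA 1)
  have e2 := key ((-1 : ℝ) • A) (by rw [transpose_smul, hA]) (hzA (-1))
  rw [hsum] at e1 e2
  linarith

/-- The pairing of `G` with a critical direction sees only the indices with `s = x = 0`: elsewhere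
either `G` or the direction vanishes. There it is a pairing of two semidefinite blocks. -/
theorem mem_coneK {G : Sym n} (h0 : ∀ i j, f.s i ≠ 0 → f.c G i j = 0)
    (hq : ∀ v : Fin n → ℝ, (∀ i, f.s i ≠ 0 → v i = 0) → (∀ i, f.x i ≠ 0 → v i = 0) →
      0 ≤ v ⬝ᵥ f.c G *ᵥ v) : G ∈ coneK S X := by
  classical
  refine mem_dualCone.2 fun D hD => ?_
  rw [mem_criticalCone_iff] at hD
  have heq : ⟪G, D⟫ = ⟪f.mask G fun i => f.s i = 0 ∧ f.x i = 0, f.mask D fun i => f.s i = 0⟫ := by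
    rw [f.inner_eq, f.inner_eq]
    refine Finset.sum_congr rfl fun i _ => Finset.sum_congr rfl fun j _ => ?_
    rw [c_mask, c_mask]
    by_cases hi : f.s i = 0
    swap
    · simp [hi, h0 i j hi]
    by_cases hj : f.s j = 0
    swap
    · rw [show f.c G i j = f.c G j i from Sym.coord_symm G i j]; simp [hj, h0 j i hj]
    by_cases hxj : f.x j = 0
    swap
    · simp [hD.1 i j hi hxj]
    by_cases hxi : f.x i = 0
    swap
    · rw [show f.c D i j = f.c D j i from Sym.coord_symm D i j]
      simp [hD.1 j i hj hxi]
    simp [hi, hj, hxi, hxj]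
  rw [heq]
  refine Sym.inner_nonneg (f.mask_mem G _ fun v hv => hq v ?_ ?_) (f.mask_mem D _ hD.2)
  · exact fun i hi => hv i fun h => hi h.1
  · exact fun i hi => hv i fun h => hi h.2

/-- Half the gradient of the quadratic form `Υ` in coordinates. -/
noncomputable def hess (D : Sym n) : Sym n :=
  Sym.ofCoord f.U
    (Matrix.of fun i j => (f.x j * (f.s i)⁻¹ + f.x i * (f.s j)⁻¹) * f.c D i j) (by
      ext i j
      simp only [transpose_apply, of_apply, Sym.coord_symm D j i]
      ring)

theorem c_hess (D : Sym n) (i j : Fin n) :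
    f.c (f.hess D) i j = (f.x j * (f.s i)⁻¹ + f.x i * (f.s j)⁻¹) * f.c D i j := by
  rw [c, hess, Sym.coord_ofCoord f.orth]; rfl

/-- `hess` as a linear map. -/
noncomputable def hessL : Sym n →ₗ[ℝ] Sym n where
  toFun := f.hess
  map_add' D E := by
    apply Sym.coord_injective f.orth
    ext i j
    rw [Sym.coord_add, Matrix.add_apply]
    change f.c _ i j = f.c _ i j + f.c _ i j
    simp only [c_hess, Sym.coord_add, Matrix.add_apply]
    ring
  map_smul' t D := by
    apply Sym.coord_injective f.orth
    ext i j
    rw [RingHom.id_apply, Sym.coord_smul, Matrix.smul_apply]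
    change f.c _ i j = t • f.c _ i j
    simp only [c_hess, Sym.coord_smul, Matrix.smul_apply, smul_eq_mul]
    ring

theorem inner_hess_comm (D E : Sym n) : ⟪f.hess D, E⟫ = ⟪f.hess E, D⟫ := by
  rw [f.inner_eq, f.inner_eq]
  refine Finset.sum_congr rfl fun i _ => Finset.sum_congr rfl fun j _ => ?_
  rw [c_hess, c_hess]; ring

/-- Half of the double sum for 2 tr(X D S† D) is reindexed by exchanging `i` and `j`, which produces
the symmetric weights of `hess`. -/
theorem Upsilon_eq (D : Sym n) : Upsilon S X D = ⟪f.hess D, D⟫ := by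
  have h1 : Upsilon S X D = 2 * (diagonal f.x * (f.c D * diagonal (fun i =>
    (f.s i)⁻¹) * f.c D)).trace := by
    rw [Upsilon, f.mat_S, pinv_conj_diagonal f.orth, Sym.mat_transpose, f.mat_X, c, Sym.coord]
    congr 1
    calc _ = (f.U * (diagonal f.x * (f.Uᵀ * D.mat * f.U) * diagonal (fun i => (f.s i)⁻¹) *
      (f.Uᵀ * D.mat))).trace := by
          simp only [Matrix.mul_assoc]
      _ = _ := by rw [Matrix.trace_mul_comm]; simp only [Matrix.mul_assoc]
  have h2 : (diagonal f.x * (f.c D * diagonal (fun i => (f.s i)⁻¹) * f.c D)).trace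
      = ∑ i, ∑ j, f.x i * (f.s j)⁻¹ * (f.c D i j * f.c D i j) := by
    rw [Matrix.trace]
    refine Finset.sum_congr rfl fun i _ => ?_
    rw [diag_apply, diagonal_mul, Matrix.mul_apply, Finset.mul_sum]
    refine Finset.sum_congr rfl fun j _ => ?_
    rw [mul_diagonal, show f.c D j i = f.c D i j from Sym.coord_symm D j i]; ring
  have h3 : ∑ i, ∑ j, f.x i * (f.s j)⁻¹ * (f.c D i j * f.c D i j)
      = ∑ i, ∑ j, f.x j * (f.s i)⁻¹ * (f.c D i j * f.c D i j) := by
    rw [Finset.sum_comm]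
    refine Finset.sum_congr rfl fun i _ => Finset.sum_congr rfl fun j _ => ?_
    rw [show f.c D j i = f.c D i j from Sym.coord_symm D j i]
  rw [h1, h2, two_mul, f.inner_eq]
  nth_rewrite 2 [h3]
  rw [← Finset.sum_add_distrib]
  refine Finset.sum_congr rfl fun i _ => ?_
  rw [← Finset.sum_add_distrib]
  refine Finset.sum_congr rfl fun j _ => ?_
  rw [c_hess]; ring

end Frame

/-! ### Components, inner products and norms on the product spaces -/

section Components

variable {W : Type*} [NormedAddCommGroup W] [InnerProductSpace ℝ W] {m n : ℕ}

@[simp] theorem yOf_mkZ (y : Vec m) (w : W) (S : Sym n) : yOf (mkZ y w S) = y := rfl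
@[simp] theorem wOf_mkZ (y : Vec m) (w : W) (S : Sym n) : wOf (mkZ y w S) = w := rfl
@[simp] theorem sOf_mkZ (y : Vec m) (w : W) (S : Sym n) : sOf (mkZ y w S) = S := rfl
/-- The components as linear maps. -/
def wL : ZSpace W m n →ₗ[ℝ] W := ⟨⟨wOf, fun _ _ => rfl⟩, fun _ _ => rfl⟩
def sL : ZSpace W m n →ₗ[ℝ] Sym n := ⟨⟨sOf, fun _ _ => rfl⟩, fun _ _ => rfl⟩

@[simp] theorem yOf_add (a b : ZSpace W m n) : yOf (a + b) = yOf a + yOf b := rfl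
@[simp] theorem wOf_add (a b : ZSpace W m n) : wOf (a + b) = wOf a + wOf b := rfl
@[simp] theorem sOf_add (a b : ZSpace W m n) : sOf (a + b) = sOf a + sOf b := rfl
@[simp] theorem yOf_sub (a b : ZSpace W m n) : yOf (a - b) = yOf a - yOf b := rfl
@[simp] theorem wOf_sub (a b : ZSpace W m n) : wOf (a - b) = wOf a - wOf b := rfl
@[simp] theorem sOf_sub (a b : ZSpace W m n) : sOf (a - b) = sOf a - sOf b := rfl
@[simp] theorem yOf_smul (t : ℝ) (a : ZSpace W m n) : yOf (t • a) = t • yOf a := rfl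
@[simp] theorem wOf_smul (t : ℝ) (a : ZSpace W m n) : wOf (t • a) = t • wOf a := rfl
@[simp] theorem sOf_smul (t : ℝ) (a : ZSpace W m n) : sOf (t • a) = t • sOf a := rfl
@[simp] theorem yOf_zero : yOf (0 : ZSpace W m n) = 0 := rfl
@[simp] theorem wOf_zero : wOf (0 : ZSpace W m n) = 0 := rfl
@[simp] theorem sOf_zero : sOf (0 : ZSpace W m n) = 0 := rfl

theorem mkZ_add (y y' : Vec m) (w w' : W) (S S' : Sym n) :
    mkZ (y + y') (w + w') (S + S') = mkZ y w S + mkZ y' w' S' := rfl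

theorem mkZ_smul (t : ℝ) (y : Vec m) (w : W) (S : Sym n) :
    mkZ (t • y) (t • w) (t • S) = t • mkZ y w S := rfl

theorem inner_Z (a b : ZSpace W m n) :
    ⟪a, b⟫ = ⟪yOf a, yOf b⟫ + (⟪wOf a, wOf b⟫ + ⟪sOf a, sOf b⟫) := rfl

theorem inner_Z_comm (a b : ZSpace W m n) : ⟪a, b⟫ = ⟪b, a⟫ := by
  rw [inner_Z, inner_Z, real_inner_comm, real_inner_comm (wOf a), real_inner_comm (sOf a)]

set_option synthInstance.maxHeartbeats 200000 in
theorem inner_Z_smul_right (t : ℝ) (a b : ZSpace W m n) : ⟪a, t • b⟫ = t * ⟪a, b⟫ :=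
  real_inner_smul_right (F := ZSpace W m n) a b t

set_option synthInstance.maxHeartbeats 200000 in
theorem inner_Z_neg_right (a b : ZSpace W m n) : ⟪a, -b⟫ = -⟪a, b⟫ :=
  inner_neg_right (E := ZSpace W m n) a b

theorem inner_E (a b : ESpace W m n) : ⟪a, b⟫ = ⟪zOf a, zOf b⟫ + ⟪xOf a, xOf b⟫ := rfl

theorem norm_sq_Z (a : ZSpace W m n) : ‖a‖ ^ 2 = ‖yOf a‖ ^ 2 + (‖wOf a‖ ^ 2 + ‖sOf a‖ ^ 2) := by
  simp only [← real_inner_self_eq_norm_sq, inner_Z]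

theorem norm_sq_E (a : ESpace W m n) : ‖a‖ ^ 2 = ‖zOf a‖ ^ 2 + ‖xOf a‖ ^ 2 := by
  simp only [← real_inner_self_eq_norm_sq, inner_E]

theorem norm_yOf_le (a : ZSpace W m n) : ‖yOf a‖ ≤ ‖a‖ :=
  (sq_le_sq₀ (norm_nonneg _) (norm_nonneg _)).1 (by
    rw [norm_sq_Z a]
    nlinarith [sq_nonneg ‖wOf a‖, sq_nonneg ‖sOf a‖])
theorem norm_wOf_le (a : ZSpace W m n) : ‖wOf a‖ ≤ ‖a‖ :=
  (sq_le_sq₀ (norm_nonneg _) (norm_nonneg _)).1 (by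
    rw [norm_sq_Z a]
    nlinarith [sq_nonneg ‖yOf a‖, sq_nonneg ‖sOf a‖])
theorem norm_sOf_le (a : ZSpace W m n) : ‖sOf a‖ ≤ ‖a‖ :=
  (sq_le_sq₀ (norm_nonneg _) (norm_nonneg _)).1 (by
    rw [norm_sq_Z a]
    nlinarith [sq_nonneg ‖wOf a‖, sq_nonneg ‖yOf a‖])
theorem norm_zOf_le (a : ESpace W m n) : ‖zOf a‖ ≤ ‖a‖ :=
  (sq_le_sq₀ (norm_nonneg _) (norm_nonneg _)).1 (by rw [norm_sq_E a]; nlinarith [sq_nonneg ‖xOf a‖])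
theorem norm_E_le (a : ESpace W m n) : ‖a‖ ≤ ‖zOf a‖ + ‖xOf a‖ :=
  (sq_le_sq₀ (norm_nonneg _) (by positivity)).1 (by
    rw [norm_sq_E a]; nlinarith [mul_nonneg (norm_nonneg (zOf a)) (norm_nonneg (xOf a))])

theorem continuous_yOf : Continuous (yOf : ZSpace W m n → Vec m) :=
  WithLp.continuous_fst ..
theorem continuous_wOf : Continuous (wOf : ZSpace W m n → W) :=
  (WithLp.continuous_fst ..).comp (WithLp.continuous_snd ..)
theorem continuous_sOf : Continuous (sOf : ZSpace W m n → Sym n) :=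
  (WithLp.continuous_snd ..).comp (WithLp.continuous_snd ..)
theorem continuous_zOf : Continuous (zOf : ESpace W m n → ZSpace W m n) :=
  WithLp.continuous_fst ..
theorem continuous_xOf : Continuous (xOf : ESpace W m n → Sym n) :=
  WithLp.continuous_snd ..

end Components

theorem eq_gradient_of_isSubgradient {E : Type*} [NormedAddCommGroup E] [InnerProductSpace ℝ E]
    [CompleteSpace E] {f : E → ℝ} {s : Set E} {u v g : E} (hs : s ∈ 𝓝 u)
    (hg : HasGradientAt f g u) (h : ∀ u' ∈ s, f u + ⟪v, u' - u⟫ ≤ f u') : v = g := by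
  have h1 : HasFDerivAt (fun u' => f u' - ⟪v, u'⟫)
      (InnerProductSpace.toDual ℝ E g - innerSL ℝ v) u :=
    hg.hasFDerivAt.sub (innerSL ℝ v).hasFDerivAt
  have h2 : IsLocalMin (fun u' => f u' - ⟪v, u'⟫) u := by
    filter_upwards [hs] with u' hu'
    have := h u' hu'
    rw [inner_sub_right] at this
    linarith
  have h3 := h2.hasFDerivAt_eq_zero h1
  have h4 := congrArg (fun l : E →L[ℝ] ℝ => l (v - g)) h3
  simp only [_root_.sub_apply, InnerProductSpace.toDual_apply_apply,
    innerSL_apply_apply, _root_.zero_apply] at h4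
  rw [← inner_sub_left, ← neg_sub, inner_neg_left, neg_eq_zero, inner_self_eq_zero] at h4
  exact sub_eq_zero.1 h4

/-! ### The Lagrangian and the perturbed KKT system -/

namespace ConvexSDP

variable {W : Type*} [NormedAddCommGroup W] [InnerProductSpace ℝ W] [FiniteDimensional ℝ W]
  {m n : ℕ} (P : ConvexSDP W m n)

theorem hConj_ne_bot (u : W) : P.hConj u ≠ ⊥ := by
  obtain ⟨x, hx⟩ := P.dom_nonempty
  have hx1 : P.h x ≠ ⊤ := ne_of_lt hx
  intro h
  have h2 : ((⟪x, u⟫ : ℝ) : EReal) - P.h x ≤ P.hConj u :=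
    le_iSup (fun x : W => ((⟪x, u⟫ : ℝ) : EReal) - P.h x) x
  rw [h, le_bot_iff, ← EReal.coe_toReal hx1 (P.h_ne_bot x), ← EReal.coe_sub] at h2
  exact EReal.coe_ne_bot _ h2

/-- The finite part of the conjugate. -/
noncomputable def hc (u : W) : ℝ := (P.hConj u).toReal

theorem hConj_eq_coe {u : W} (hu : u ∈ effDom P.hConj) : P.hConj u = (P.hc u : EReal) :=
  (EReal.coe_toReal (ne_of_lt hu) (P.hConj_ne_bot u)).symm

theorem hasGradientAt_hc (hs : P.ConjSmooth) {u : W} (hu : u ∈ effDom P.hConj) :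
    haveI := FiniteDimensional.complete ℝ W
    HasGradientAt P.hc (P.gradConj u) u := by
  have := FiniteDimensional.complete ℝ W
  have hd : DifferentiableAt ℝ P.hc u :=
    (hs.2.1.contDiffAt (hs.1.mem_nhds hu)).differentiableAt (by simp)
  exact hd.hasGradientAt

/-- Feasibility of the dual point with respect to all constraints except the equation. -/
def Dom (z : ZSpace W m n) : Prop :=
  yOf z ∈ P.Q ∧ -wOf z ∈ effDom P.hConj ∧ sOf z ∈ psdCone n

theorem dualObj_of_dom {z : ZSpace W m n} (hz : P.Dom z) :
    P.dualObj z = ((-⟪P.b, yOf z⟫ + P.hc (-wOf z) : ℝ) : EReal) := by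
  rw [dualObj, indicatorFun, if_pos hz.1, indicatorFun, if_pos hz.2.2, hConj_eq_coe P hz.2.1]
  simp [EReal.coe_add]

theorem dualObj_of_not_dom {z : ZSpace W m n} (hz : ¬P.Dom z) : P.dualObj z = ⊤ := by
  rw [dualObj]
  have hi : ∀ {E : Type _} (D : Set E) [NormedAddCommGroup E] [InnerProductSpace ℝ E] (x : E),
      indicatorFun D x ≠ ⊥ := by
    intro E D _ _ x
    unfold indicatorFun
    split_ifs <;> simp
  have hb := P.hConj_ne_bot (-wOf z)
  by_cases h1 : yOf z ∈ P.Q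
  · by_cases h2 : -wOf z ∈ effDom P.hConj
    · have h3 : sOf z ∉ psdCone n := fun h3 => hz ⟨h1, h2, h3⟩
      rw [indicatorFun, if_pos h1, indicatorFun, if_neg h3, hConj_eq_coe P h2, zero_add,
        ← EReal.coe_add]
      exact EReal.coe_add_top _
    · have h2' : P.hConj (-wOf z) = ⊤ := not_lt_top_iff.1 h2
      rw [indicatorFun, if_pos h1, h2', zero_add, EReal.coe_add_top]
      exact EReal.top_add_of_ne_bot (hi _ _)
  · rw [indicatorFun, if_neg h1, EReal.top_add_coe, EReal.top_add_of_ne_bot hb]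
    exact EReal.top_add_of_ne_bot (hi _ _)

theorem inner_dualMap (X : Sym n) (z : ZSpace W m n) :
    ⟪X, P.dualMap z⟫ = ⟪P.A X, yOf z⟫ + ⟪P.F X, wOf z⟫ + ⟪X, sOf z⟫ := by
  rw [dualMap, inner_add_right, inner_add_right, LinearMap.adjoint_inner_right,
    LinearMap.adjoint_inner_right]

theorem dualMap_add (a b : ZSpace W m n) : P.dualMap (a + b) = P.dualMap a + P.dualMap b := by
  simp only [dualMap, yOf_add, wOf_add, sOf_add, map_add]; abel

theorem dualMap_sub (a b : ZSpace W m n) : P.dualMap (a - b) = P.dualMap a - P.dualMap b := by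
  simp only [dualMap, yOf_sub, wOf_sub, sOf_sub, map_sub]; abel

theorem dualMap_smul (t : ℝ) (a : ZSpace W m n) : P.dualMap (t • a) = t • P.dualMap a := by
  simp only [dualMap, yOf_smul, wOf_smul, sOf_smul, map_smul, smul_add]

theorem continuous_dualMap : Continuous P.dualMap :=
  (((LinearMap.adjoint P.A).continuous_of_finiteDimensional.comp continuous_yOf).add
    ((LinearMap.adjoint P.F).continuous_of_finiteDimensional.comp continuous_wOf)).add
    continuous_sOf

theorem lagrangian_of_dom {z : ZSpace W m n} (hz : P.Dom z) (X : Sym n) :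
    P.lagrangian z X =
      ((-⟪P.b, yOf z⟫ + P.hc (-wOf z) + ⟪X, P.dualMap z - P.C⟫ : ℝ) : EReal) := by
  rw [lagrangian, dualObj_of_dom P hz, ← EReal.coe_add]

theorem lagrangian_of_not_dom {z : ZSpace W m n} (hz : ¬P.Dom z) (X : Sym n) :
    P.lagrangian z X = ⊤ := by
  rw [lagrangian, dualObj_of_not_dom P hz, EReal.top_add_coe]

/-- The perturbed KKT system described by `Tl`. -/
structure PerturbedKKT (p ξ : ESpace W m n) : Prop where
  dom : P.Dom (zOf ξ)
  normal_y : ∀ y' ∈ P.Q, ⟪yOf (zOf p) + P.b - P.A (xOf ξ), y' - yOf (zOf ξ)⟫ ≤ 0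
  grad : P.F (xOf ξ) - wOf (zOf p) = P.gradConj (-wOf (zOf ξ))
  normal_S : ∀ S' ∈ psdCone n, ⟪sOf (zOf p) - xOf ξ, S' - sOf (zOf ξ)⟫ ≤ 0
  eqn : P.dualMap (zOf ξ) - P.C = -xOf p

/-- Outside the domain the Lagrangian is `⊤`, which the subgradient inequality at `z0` excludes.
Inside it, varying one component of `z` at a time separates the conditions, and since the Lagrangian
is affine in the matrix variable, the supergradient inequality is an equation. -/
theorem perturbedKKT_of_mem_Tl (hs : P.ConjSmooth) {z0 : ZSpace W m n} (h0 : P.Dom z0)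
    {p ξ : ESpace W m n} (h : p ∈ P.Tl ξ) : P.PerturbedKKT p ξ := by
  obtain ⟨h1, h2⟩ := h
  simp only at h1 h2
  have hd : P.Dom (zOf ξ) := by
    by_contra hn
    have := h1 z0
    rw [lagrangian_of_not_dom P hn, lagrangian_of_dom P h0, EReal.top_add_coe, top_le_iff] at this
    exact EReal.coe_ne_top _ this
  have h1' : ∀ z', P.Dom z' → -⟪P.b, yOf (zOf ξ)⟫ + P.hc (-wOf (zOf ξ)) +
      ⟪xOf ξ, P.dualMap (zOf ξ) - P.C⟫ + ⟪zOf p, z' - zOf ξ⟫ ≤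
      -⟪P.b, yOf z'⟫ + P.hc (-wOf z') + ⟪xOf ξ, P.dualMap z' - P.C⟫ := by
    intro z' hz'
    have := h1 z'
    rw [lagrangian_of_dom P hd, lagrangian_of_dom P hz', ← EReal.coe_add] at this
    exact EReal.coe_le_coe_iff.1 this
  refine ⟨hd, ?_, ?_, ?_, ?_⟩
  · intro y' hy'
    have := h1' (mkZ y' (wOf (zOf ξ)) (sOf (zOf ξ))) ⟨hy', hd.2⟩
    rw [inner_Z] at this
    simp only [inner_sub_right, inner_dualMap, yOf_sub, wOf_sub, sOf_sub, yOf_mkZ, wOf_mkZ,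
      sOf_mkZ] at this
    simp only [inner_sub_right, inner_sub_left, inner_add_left]
    linarith
  · have hcomp := FiniteDimensional.complete ℝ W
    refine eq_gradient_of_isSubgradient (hs.1.mem_nhds hd.2.1) (P.hasGradientAt_hc hs hd.2.1) ?_
    intro u' hu'
    have := h1' (mkZ (yOf (zOf ξ)) (-u') (sOf (zOf ξ))) ⟨hd.1, by
      rw [wOf_mkZ, neg_neg]; exact hu', hd.2.2⟩
    rw [inner_Z] at this
    simp only [inner_sub_right, inner_dualMap, yOf_sub, wOf_sub, sOf_sub, yOf_mkZ, wOf_mkZ, sOf_mkZ,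
      neg_neg,
      inner_neg_right] at this
    simp only [inner_sub_right, inner_sub_left, inner_neg_right]
    linarith
  · intro S' hS'
    have := h1' (mkZ (yOf (zOf ξ)) (wOf (zOf ξ)) S') ⟨hd.1, hd.2.1, hS'⟩
    rw [inner_Z] at this
    simp only [inner_sub_right, inner_dualMap, yOf_sub, wOf_sub, sOf_sub, yOf_mkZ, wOf_mkZ,
      sOf_mkZ] at this
    simp only [inner_sub_right, inner_sub_left]
    linarith
  · have h2' : ∀ D : Sym n, ⟪D, P.dualMap (zOf ξ) - P.C⟫ ≤ ⟪-xOf p, D⟫ := by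
      intro D
      have := h2 (xOf ξ + D)
      rw [lagrangian_of_dom P hd, lagrangian_of_dom P hd, ← EReal.coe_add,
        EReal.coe_le_coe_iff, inner_add_left, add_sub_cancel_left] at this
      linarith
    -- Testing with the difference of the two sides makes its squared norm nonpositive.
    have := h2' (P.dualMap (zOf ξ) - P.C - -xOf p)
    rw [real_inner_comm _ (-xOf p), ← sub_nonpos, ← inner_sub_right] at this
    exact sub_eq_zero.1 (inner_self_eq_zero.1 (le_antisymm this real_inner_self_nonneg))

theorem zero_mem_Tl {z : ZSpace W m n} {X : Sym n} (hz : P.Dom z) (hX : X ∈ P.multipliers z) :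
    (0 : ESpace W m n) ∈ P.Tl (mkE z X) := by
  obtain ⟨⟨-, hy⟩, ⟨-, hw⟩, ⟨-, hS⟩, he⟩ := hX
  refine ⟨fun z' => ?_, fun X' => ?_⟩
  · change P.lagrangian z X + ((⟪(0 : ZSpace W m n), z' - z⟫ : ℝ) : EReal) ≤ P.lagrangian z' X
    by_cases hz' : P.Dom z'
    · rw [lagrangian_of_dom P hz, lagrangian_of_dom P hz', ← EReal.coe_add,
        EReal.coe_le_coe_iff]
      have e1 := hy _ hz'.1
      have e2 := hw (-wOf z')
      rw [hConj_eq_coe P hz.2.1, hConj_eq_coe P hz'.2.1, ← EReal.coe_add,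
        EReal.coe_le_coe_iff] at e2
      have e3 := hS _ hz'.2.2
      have e0 : ⟪(0 : ZSpace W m n), z' - z⟫ = 0 := by rw [inner_Z]; simp
      rw [e0]
      simp only [inner_sub_right, inner_sub_left, inner_neg_left, inner_neg_right,
        inner_dualMap] at e1 e2 e3 ⊢
      linarith
    · rw [lagrangian_of_not_dom P hz']; exact le_top
  · change P.lagrangian z X' ≤ P.lagrangian z X + ((⟪-(0 : Sym n), X' - X⟫ : ℝ) : EReal)
    rw [lagrangian_of_dom P hz, lagrangian_of_dom P hz, ← EReal.coe_add, EReal.coe_le_coe_iff, he]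
    simp

theorem isPointedCone_Q : IsPointedCone P.Q := by
  obtain ⟨k, N, hN⟩ := P.polyhedral
  rw [hN]
  refine ⟨fun i => by simp, fun {x y} hx hy i => ?_, fun {t x} ht hx i => ?_⟩
  · have := hx i; have := hy i
    simp only [WithLp.ofLp_add, mulVec_add, Pi.add_apply]; linarith
  · have := hx i
    simp only [WithLp.ofLp_smul, mulVec_smul, Pi.smul_apply, smul_eq_mul]
    exact mul_nonpos_of_nonneg_of_nonpos ht this

end ConvexSDP

/-- The test points `0` and `2x` give orthogonality, and `x + y` gives polarity. -/
theorem IsPointedCone.inner_eq_zero_of_normal {E : Type*} [NormedAddCommGroup E]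
    [InnerProductSpace ℝ E] {K : Set E} (hK : IsPointedCone K) {x v : E} (hx : x ∈ K)
    (hv : ∀ y ∈ K, ⟪v, y - x⟫ ≤ 0) : ⟪v, x⟫ = 0 ∧ ∀ y ∈ K, ⟪v, y⟫ ≤ 0 := by
  refine ⟨?_, fun y hy => by simpa using hv _ (hK.add_mem hx hy)⟩
  have h1 := hv 0 hK.zero_mem
  have h2 := hv _ (hK.add_mem hx hx)
  rw [add_sub_cancel_right] at h2
  rw [zero_sub, inner_neg_right] at h1
  linarith

theorem mem_psdCone_of_forall_inner {n : ℕ} {X : Sym n} (h : ∀ Y ∈ psdCone n, 0 ≤ ⟪X, Y⟫) :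
    X ∈ psdCone n := by
  have hU : (1 : Matrix (Fin n) (Fin n) ℝ)ᵀ * 1 = 1 := by simp
  -- The frame of the zero pair serves only to supply an orthonormal basis and its rank one
  -- matrices.
  obtain ⟨f⟩ := exists_frame (isPointedCone_psdCone n).zero_mem
    (isPointedCone_psdCone n).zero_mem (inner_zero_left (0 : Sym n))
  rw [Sym.mem_psdCone_iff_forall f.orth]
  intro v
  have := h _ (f.rankOne_mem v)
  rwa [f.inner_rankOne] at this

/-! ### Variational inequalities over cones under a positivity condition -/

section ConeVariational

variable {E : Type*} [NormedAddCommGroup E] [InnerProductSpace ℝ E] [FiniteDimensional ℝ E]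

/-- A variational inequality over a closed convex cone is solvable when it is solvable over the
intersections with balls and the operator is positive and homogeneous. -/
theorem exists_variational_inequality_cone {D : Set E} (hD : IsPointedCone D) (hcl : IsClosed D)
    {G : E → E →L[ℝ] ℝ} (hGc : Continuous G)
    (hGh : ∀ d, ∀ r : ℝ, 0 < r → G (r • d) = r • G d)
    (hpos : ∀ d ∈ D, d ≠ 0 → 0 < G d d) (l : E)
    (hex : ∀ ρ : ℝ, 0 < ρ → ∃ d ∈ D ∩ Metric.closedBall 0 ρ,
      ∀ d' ∈ D ∩ Metric.closedBall 0 ρ, 0 ≤ G d (d' - d) - ⟪l, d' - d⟫) :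
    ∃ d ∈ D, ∀ d' ∈ D, 0 ≤ G d (d' - d) - ⟪l, d' - d⟫ := by
  -- Positivity on the compact unit section of the cone becomes quadratic growth by homogeneity.
  have hcoer : ∃ c : ℝ, 0 < c ∧ ∀ d ∈ D, c * ‖d‖ ^ 2 ≤ G d d := by
    have hcomp : IsCompact (D ∩ Metric.sphere (0 : E) 1) := by
      have : ProperSpace E := FiniteDimensional.proper ℝ E
      exact (isCompact_sphere _ _).inter_left hcl
    have hunit : ∀ d ∈ D, d ≠ 0 → ‖d‖⁻¹ • d ∈ D ∩ Metric.sphere (0 : E) 1 := fun d hd h0 =>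
      ⟨hD.smul_mem (by positivity) hd, by simp [norm_smul, h0]⟩
    have hscale : ∀ d, d ≠ 0 → G d d = ‖d‖ ^ 2 * G (‖d‖⁻¹ • d) (‖d‖⁻¹ • d) := by
      intro d h0
      have : 0 < ‖d‖ := norm_pos_iff.2 h0
      rw [hGh _ _ (by positivity), map_smul, _root_.smul_apply, smul_eq_mul, smul_eq_mul]
      field_simp
    rcases (D ∩ Metric.sphere (0 : E) 1).eq_empty_or_nonempty with he | hne
    · refine ⟨1, one_pos, fun d hd => ?_⟩
      by_cases h0 : d = 0
      · simp [h0]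
      · have := hunit d hd h0
        rw [he] at this; exact this.elim
    · have hcont : Continuous fun d => G d d := by fun_prop
      obtain ⟨d0, hd0, hmin⟩ := hcomp.exists_isMinOn hne hcont.continuousOn
      refine ⟨G d0 d0, hpos d0 hd0.1 ?_, fun d hd => ?_⟩
      · intro h; have := hd0.2; simp [h] at this
      · by_cases h0 : d = 0
        · simp [h0]
        · rw [hscale d h0, mul_comm]
          exact mul_le_mul_of_nonneg_left (hmin (hunit d hd h0)) (by positivity)
  obtain ⟨c, hc, hcoer⟩ := hcoer
  -- Testing with `0` bounds every solution by `‖l‖ / c`. The radius is one larger, so the ball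
  -- constraint is inactive and a short step toward any `d'` of the cone stays admissible.
  obtain ⟨d, ⟨hdD, -⟩, hd⟩ := hex (‖l‖ / c + 1) (by positivity)
  have hnorm : ‖d‖ < ‖l‖ / c + 1 := by
    have h1 := hd 0 ⟨hD.zero_mem, by simp; positivity⟩
    rw [zero_sub, map_neg, inner_neg_right] at h1
    have h2 := hcoer d hdD
    have h3 := real_inner_le_norm l d
    by_cases h0 : d = 0
    · rw [h0, norm_zero]; positivity
    have h4 : 0 < ‖d‖ := norm_pos_iff.2 h0
    have h5 : c * ‖d‖ ≤ ‖l‖ := by nlinarith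
    have h6 : ‖d‖ ≤ ‖l‖ / c := by rw [le_div_iff₀ hc]; linarith
    linarith
  refine ⟨d, hdD, fun d' hd' => ?_⟩
  have hev : ∀ᶠ ε : ℝ in 𝓝[>] 0, ‖d + ε • (d' - d)‖ ≤ ‖l‖ / c + 1 ∧ ε ≤ 1 := by
    have h1 : Tendsto (fun ε : ℝ => ‖d + ε • (d' - d)‖) (𝓝 0) (𝓝 ‖d + (0 : ℝ) • (d' - d)‖) := by
      apply Continuous.tendsto; fun_prop
    rw [zero_smul, add_zero] at h1
    have h2 : ∀ᶠ ε : ℝ in 𝓝 0, ε < 1 := gt_mem_nhds one_pos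
    filter_upwards [nhdsWithin_le_nhds (h1.eventually (gt_mem_nhds hnorm)), nhdsWithin_le_nhds h2]
      with ε h3 h4 using ⟨h3.le, h4.le⟩
  obtain ⟨ε, ⟨hε1, hε2⟩, hε0⟩ := (hev.and self_mem_nhdsWithin).exists
  have hε0' : (0 : ℝ) < ε := hε0
  have hmem : d + ε • (d' - d) ∈ D := by
    have : d + ε • (d' - d) = (1 - ε) • d + ε • d' := by
      rw [smul_sub, sub_smul, one_smul]; abel
    rw [this]
    exact hD.convex hdD hd' (by linarith) hε0'.le (by ring)
  have h1 := hd _ ⟨hmem, by rwa [mem_closedBall_zero_iff]⟩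
  rw [add_sub_cancel_left, map_smul, real_inner_smul_right, smul_eq_mul, ← mul_sub] at h1
  exact nonneg_of_mul_nonneg_right h1 hε0'

/-- Solvability of the linearized optimality conditions over a closed convex cone, for the sum of
a smooth function and a quadratic form satisfying a second order sufficient condition. -/
theorem exists_linearized_solution {W : Type*} [NormedAddCommGroup W] [InnerProductSpace ℝ W]
    [CompleteSpace W] {φ : W → ℝ} {g : W → W} {O : Set W} (hO : IsOpen O) {x : W} (hx : x ∈ O)
    (hφ : ∀ u ∈ O, HasGradientAt φ (g u) u) (hg : DirDifferentiableAt g x)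
    (L : E →L[ℝ] W) (H : E →L[ℝ] E) (hH : ∀ a b, ⟪H a, b⟫ = ⟪H b, a⟫)
    {D : Set E} (hD : IsPointedCone D) (hcl : IsClosed D)
    (hpos : ∀ d ∈ D, d ≠ 0 → 0 < ⟪dirDeriv g x (L d), L d⟫ + ⟪H d, d⟫) (l : E) :
    ∃ d ∈ D, ∀ d' ∈ D, 0 ≤ ⟪dirDeriv g x (L d), L (d' - d)⟫ + ⟪H d, d' - d⟫ - ⟪l, d' - d⟫ := by
  have hproper : ProperSpace E := FiniteDimensional.proper ℝ E
  set G : E → E →L[ℝ] ℝ := fun d => (innerSL ℝ (dirDeriv g x (L d))).comp L + innerSL ℝ (H d)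
    with hG
  have hgc : Continuous (dirDeriv g x) := continuous_of_tendsto_prod hg.tendsto_dirDeriv
  have hGc : Continuous G := by
    have h1 : Continuous fun d => innerSL ℝ (dirDeriv g x (L d)) :=
      (innerSL ℝ).continuous.comp (hgc.comp L.continuous)
    exact (h1.clm_comp continuous_const).add ((innerSL ℝ).continuous.comp H.continuous)
  refine exists_variational_inequality_cone hD hcl hGc ?_ hpos l ?_
  · intro d r hr
    ext e
    simp only [hG, map_smul, hg.dirDeriv_smul _ hr, _root_.add_apply,
      ContinuousLinearMap.comp_apply, innerSL_apply_apply,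
      _root_.smul_apply, smul_eq_mul, mul_add]
  intro ρ hρ
  have hCc : IsCompact (D ∩ Metric.closedBall (0 : E) ρ) :=
    (isCompact_closedBall _ _).inter_left hcl
  suffices h : ∃ d ∈ D ∩ Metric.closedBall 0 ρ, ∀ d' ∈ D ∩ Metric.closedBall 0 ρ,
      0 ≤ (G d - innerSL ℝ l) (d' - d) from h
  refine exists_variational_inequality hCc
    (hD.convex.inter (convex_closedBall _ _)) ⟨0, hD.zero_mem, by simp [hρ.le]⟩
    -- Apart from terms constant in `d`, the first summand is a second-order difference quotient of
    -- `φ`. Its gradient is the first-order quotient of `g`, whose limit is the Hadamard derivative,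
    -- so no potential for the limit is needed.
    (ψ := fun t d => (t⁻¹ * t⁻¹) * (φ (x + t • L d) - t * ⟪g x, L d⟫) + 2⁻¹ * ⟪H d, d⟫ - ⟪l, d⟫)
    (g := fun t d => (innerSL ℝ (t⁻¹ • (g (x + t • L d) - g x))).comp L + innerSL ℝ (H d)
      - innerSL ℝ l)
    (G := fun d => G d - innerSL ℝ l) ?_ ?_
  · obtain ⟨δ, hδ, hball⟩ := Metric.isOpen_iff.1 hO x hx
    have hev : ∀ᶠ t : ℝ in 𝓝[>] 0, t * (‖L‖ * ρ + 1) < δ := by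
      have : Tendsto (fun t : ℝ => t * (‖L‖ * ρ + 1)) (𝓝 0) (𝓝 (0 * (‖L‖ * ρ + 1))) :=
        tendsto_id.mul_const _
      rw [zero_mul] at this
      exact nhdsWithin_le_nhds (this.eventually (gt_mem_nhds hδ))
    filter_upwards [hev, self_mem_nhdsWithin] with t ht ht0 d hd
    have ht0' : (0 : ℝ) < t := ht0
    have hmem : x + t • L d ∈ O := by
      apply hball
      rw [mem_ball_iff_norm, add_sub_cancel_left, norm_smul, Real.norm_of_nonneg ht0'.le]
      have h1 : ‖L d‖ ≤ ‖L‖ * ρ :=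
        (L.le_opNorm d).trans (by gcongr; exact mem_closedBall_zero_iff.1 hd.2)
      nlinarith
    have h1 : HasFDerivAt (fun d => φ (x + t • L d))
        ((InnerProductSpace.toDual ℝ W (g (x + t • L d))).comp (t • L)) d :=
      (hφ _ hmem).hasFDerivAt.comp d ((L.hasFDerivAt.const_smul t).const_add x)
    have h2 : HasFDerivAt (fun d => t * ⟪g x, L d⟫) (t • (innerSL ℝ (g x)).comp L) d :=
      ((innerSL ℝ (g x)).comp L).hasFDerivAt.const_mul t
    have h3 : HasFDerivAt (fun d => ⟪H d, d⟫) ((2 : ℝ) • innerSL ℝ (H d)) d := by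
      refine (H.hasFDerivAt.inner ℝ (hasFDerivAt_id d)).congr_fderiv ?_
      ext e
      simp [hH e d, real_inner_comm, two_mul]
    have h4 : HasFDerivAt (fun d => ⟪l, d⟫) (innerSL ℝ l) d := (innerSL ℝ l).hasFDerivAt
    refine ((((h1.sub h2).const_mul (t⁻¹ * t⁻¹)).add (h3.const_mul 2⁻¹)).sub h4).congr_fderiv ?_
    ext e
    simp only [_root_.add_apply, _root_.sub_apply, _root_.smul_apply,
      ContinuousLinearMap.comp_apply, InnerProductSpace.toDual_apply_apply, innerSL_apply_apply,
      smul_eq_mul, real_inner_smul_right, real_inner_smul_left, inner_sub_left]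
    field_simp
  · intro d
    have h1 : Tendsto (fun p : ℝ × E => (p.1, L p.2)) (𝓝[>] (0 : ℝ) ×ˢ 𝓝 d)
        (𝓝[>] (0 : ℝ) ×ˢ 𝓝 (L d)) := tendsto_id.prodMap (L.continuous.tendsto d)
    have h2 := (hg.tendsto_dirDeriv (L d)).comp h1
    have h3 : Tendsto (fun p : ℝ × E => innerSL ℝ (p.1⁻¹ • (g (x + p.1 • L p.2) - g x)))
        (𝓝[>] (0 : ℝ) ×ˢ 𝓝 d) (𝓝 (innerSL ℝ (dirDeriv g x (L d)))) :=
      ((innerSL ℝ).continuous.tendsto _).comp h2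
    have h4 : Tendsto (fun p : ℝ × E => innerSL ℝ (H p.2)) (𝓝[>] (0 : ℝ) ×ˢ 𝓝 d)
        (𝓝 (innerSL ℝ (H d))) :=
      (((innerSL ℝ).continuous.comp H.continuous).tendsto d).comp tendsto_snd
    have h5 : Tendsto (fun p : ℝ × E =>
        (innerSL ℝ (p.1⁻¹ • (g (x + p.1 • L p.2) - g x))).comp L) (𝓝[>] (0 : ℝ) ×ˢ 𝓝 d)
        (𝓝 ((innerSL ℝ (dirDeriv g x (L d))).comp L)) :=
      ((continuous_id.clm_comp continuous_const).tendsto _).comp h3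
    exact (h5.add h4).sub tendsto_const_nhds

end ConeVariational

/-! ### Critical cones of polar cones -/

section PolarCones

variable {E : Type*} [NormedAddCommGroup E] [InnerProductSpace ℝ E]

theorem IsPointedCone.mem_of_forall_dual [FiniteDimensional ℝ E] {C : Set E} (hC : IsPointedCone C)
    (hcl : IsClosed C) {x : E} (h : ∀ v, (∀ y ∈ C, 0 ≤ ⟪v, y⟫) → 0 ≤ ⟪v, x⟫) : x ∈ C := by
  by_contra hx
  rw [← hcl.closure_eq] at hx
  obtain ⟨v, h1, h2⟩ := hC.exists_separating hx
  exact absurd (h v h1) (not_le.2 h2)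

theorem IsPointedCone.mem_posTangentConeAt {C : Set E} (hC : IsPointedCone C) {x y : E}
    (hx : x ∈ C) (hy : y ∈ C) : y ∈ posTangentConeAt C x := by
  have := smul_sub_mem_posTangentConeAt hC.convex hx (hC.add_mem hx hy) zero_le_one
  rwa [add_sub_cancel_left, one_smul] at this

theorem isPointedCone_polarCone (C : Set E) : IsPointedCone (polarCone C) := by
  refine ⟨fun d _ => by simp, fun ha hb d hd => ?_, fun ht ha d hd => ?_⟩
  · rw [inner_add_left]; exact add_nonpos (ha d hd) (hb d hd)
  · rw [real_inner_smul_left]; exact mul_nonpos_of_nonneg_of_nonpos ht (ha d hd)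

/-- The polar of a critical cone is contained in the critical cone of the polar. -/
theorem mem_criticalCone_polarCone [FiniteDimensional ℝ E] {C : Set E} (hC : IsPointedCone C)
    (hcl : IsClosed C) {y q r : E} (hy : y ∈ C) (hq : q ∈ polarCone C) (hqy : ⟪q, y⟫ = 0)
    (hr : ∀ y' ∈ criticalCone C y q, ⟪r, y'⟫ ≤ 0) : r ∈ criticalCone (polarCone C) q y := by
  have hP := isPointedCone_polarCone C
  refine ⟨mem_posTangentConeAt_of_forall hP.convex hq fun v hv => ?_, ?_⟩
  · have hvq : ⟪v, q⟫ = 0 := by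
      have h1 := hv 0 hP.zero_mem
      have h2 := hv _ (hP.add_mem hq hq)
      rw [add_sub_cancel_right] at h2
      rw [zero_sub, inner_neg_right] at h1
      linarith
    have hvC : -v ∈ C := by
      refine hC.mem_of_forall_dual hcl fun u hu => ?_
      have := hv _ (hP.add_mem hq (y := -u) fun d hd => by
        rw [inner_neg_left]; linarith [hu d hd])
      rw [add_sub_cancel_left, inner_neg_right] at this
      rw [inner_neg_right, real_inner_comm]; exact this
    have := hr (-v) ⟨hC.mem_posTangentConeAt hy hvC, by
      rw [inner_neg_right, real_inner_comm, hvq, neg_zero]⟩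
    rw [inner_neg_right, real_inner_comm] at this
    linarith
  -- Both `y` and `-y` are critical at `y`, which forces orthogonality of `r` and `y`.
  · have h1 := hr y ⟨hC.mem_posTangentConeAt hy hy, hqy⟩
    have h2 := hr (-y) ⟨by
      have := smul_sub_mem_posTangentConeAt hC.convex hy hC.zero_mem zero_le_one
      rwa [zero_sub, one_smul] at this, by rw [inner_neg_right, hqy, neg_zero]⟩
    rw [inner_neg_right] at h2
    rw [real_inner_comm]; linarith

end PolarCones

/-! ### The biactive projector as a relative interior point of K -/

namespace Frame

variable {n : ℕ} {S X : Sym n} (f : Frame S X)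

/-- The orthogonal projection onto the common kernel of the two matrices. -/
noncomputable def biactive : Sym n := by
  classical
  exact Sym.ofCoord f.U (diagonal fun i => if f.s i = 0 ∧ f.x i = 0 then 1 else 0) (by simp)

theorem c_biactive : f.c f.biactive = by
    classical exact diagonal fun i => if f.s i = 0 ∧ f.x i = 0 then 1 else 0 := by
  classical
  rw [c, biactive, Sym.coord_ofCoord f.orth]

theorem quad_biactive {v : Fin n → ℝ} (h1 : ∀ i, f.s i ≠ 0 → v i = 0)
    (h2 : ∀ i, f.x i ≠ 0 → v i = 0) : v ⬝ᵥ f.c f.biactive *ᵥ v = ∑ i, v i * v i := by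
  classical
  rw [c_biactive]
  simp only [mulVec_diagonal, dotProduct]
  refine Finset.sum_congr rfl fun i _ => ?_
  by_cases hs : f.s i = 0
  · by_cases hx : f.x i = 0
    · simp [hs, hx]
    · simp [h2 i hx]
  · simp [h1 i hs]

theorem inner_biactive (D : Sym n) : ⟪f.biactive, D⟫ = by
    classical exact ∑ i, if f.s i = 0 ∧ f.x i = 0 then f.c D i i else 0 := by
  classical
  rw [f.inner_eq, c_biactive]
  refine Finset.sum_congr rfl fun i _ => ?_
  simp [diagonal_apply]

/-- The subspace spanned by the cone `K`. -/
noncomputable def spanK : Submodule ℝ (Sym n) where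
  carrier := {G | ∀ i j, f.s i ≠ 0 → f.c G i j = 0}
  zero_mem' := by intro i j _; simp
  add_mem' := by
    intro a b ha hb i j hi
    rw [c, Sym.coord_add, Matrix.add_apply]
    exact (congrArg₂ (· + ·) (ha i j hi) (hb i j hi)).trans (add_zero 0)
  smul_mem' := by
    intro t a ha i j hi
    rw [c, Sym.coord_smul, Matrix.smul_apply]
    exact (congrArg (t • ·) (ha i j hi)).trans (smul_zero t)

theorem mem_spanK {G : Sym n} : G ∈ f.spanK ↔ ∀ i j, f.s i ≠ 0 → f.c G i j = 0 := Iff.rfl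

theorem coneK_subset_spanK : coneK S X ⊆ f.spanK := fun _ hG _ j hi => f.coneK_zero hG hi j

theorem abs_quad_le (D : Sym n) (v : Fin n → ℝ) :
    |v ⬝ᵥ f.c D *ᵥ v| ≤ n * ‖D‖ * ∑ i, v i * v i := by
  rw [dotProduct_mulVec_eq_sum]
  have h1 : ∀ i j, |f.c D i j * (v i * v j)| ≤ ‖D‖ * ((v i * v i + v j * v j) / 2) := by
    intro i j
    rw [abs_mul]
    gcongr
    · exact Sym.abs_coord_le f.orth D i j
    · rw [abs_le]
      constructor <;> nlinarith [sq_nonneg (v i - v j), sq_nonneg (v i + v j)]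
  calc |∑ i, ∑ j, f.c D i j * (v i * v j)|
      ≤ ∑ i, ∑ j, |f.c D i j * (v i * v j)| :=
        (Finset.abs_sum_le_sum_abs _ _).trans
          (Finset.sum_le_sum fun i _ => Finset.abs_sum_le_sum_abs _ _)
    _ ≤ ∑ i, ∑ j, ‖D‖ * ((v i * v i + v j * v j) / 2) :=
        Finset.sum_le_sum fun i _ => Finset.sum_le_sum fun j _ => h1 i j
    _ = n * ‖D‖ * ∑ i, v i * v i := by
        have e : ∀ i, ∑ j, ‖D‖ * ((v i * v i + v j * v j) / 2)
            = ‖D‖ / 2 * n * (v i * v i) + ‖D‖ / 2 * ∑ j, v j * v j := by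
          intro i
          rw [← Finset.mul_sum, ← Finset.sum_div, Finset.sum_add_distrib, Finset.sum_const,
            Finset.card_univ, Fintype.card_fin, nsmul_eq_mul]
          ring
        rw [Finset.sum_congr rfl fun i _ => e i, Finset.sum_add_distrib, ← Finset.mul_sum,
          Finset.sum_const, Finset.card_univ, Fintype.card_fin, nsmul_eq_mul]
        ring

/-- `biactive` is the identity form on the common kernel, and a perturbation of norm below 1/(n+1)
changes the form by at most |v|². Thus it is interior to `K` relative to `spanK`, as
`add_mem_sum_of_mem_closure` requires. -/
theorem biactive_add_mem {G : Sym n} (hG : G ∈ f.spanK) (hn : ‖G‖ < 1 / (n + 1)) :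
    f.biactive + G ∈ coneK S X := by
  classical
  apply f.mem_coneK
  · intro i j hi
    rw [c, Sym.coord_add, Matrix.add_apply]
    change f.c f.biactive i j + f.c G i j = 0
    rw [hG i j hi, c_biactive, add_zero, diagonal_apply]
    simp [hi]
  · intro v h1 h2
    rw [c, Sym.coord_add, add_mulVec, dotProduct_add]
    change 0 ≤ v ⬝ᵥ f.c f.biactive *ᵥ v + v ⬝ᵥ f.c G *ᵥ v
    rw [f.quad_biactive h1 h2]
    have h3 := (abs_le.1 (f.abs_quad_le G v)).1
    have h4 : 0 ≤ ∑ i, v i * v i := Finset.sum_nonneg fun i _ => mul_self_nonneg _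
    have h5 : n * ‖G‖ ≤ 1 := by
      rw [lt_div_iff₀ (by positivity)] at hn
      nlinarith [norm_nonneg G]
    nlinarith

/-- The projection onto `K` of an element that differs from an element of `K` by a matrix
orthogonal to `K`. -/
theorem metricProj_coneK {D p : Sym n} (hp : p ∈ coneK S X)
    (h : ∀ i j, f.s i = 0 → f.s j = 0 → f.c p i j = f.c D i j) :
    metricProj (coneK S X) D = p := by
  have h0 : ∀ k ∈ coneK S X, ⟪D - p, k⟫ = 0 := by
    intro k hk
    rw [f.inner_eq]
    refine Finset.sum_eq_zero fun i _ => Finset.sum_eq_zero fun j _ => ?_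
    by_cases hi : f.s i = 0
    · by_cases hj : f.s j = 0
      · rw [c, Sym.coord_sub, Matrix.sub_apply]
        change (f.c D i j - f.c p i j) * _ = 0
        rw [h i j hi hj, sub_self, zero_mul]
      · rw [show f.c k i j = f.c k j i from Sym.coord_symm k i j, f.coneK_zero hk hj, mul_zero]
    · rw [f.coneK_zero hk hi, mul_zero]
  exact metricProj_eq (isPointedCone_dualCone _) (isClosed_dualCone _) hp
    (fun k hk => (h0 k hk).le) (h0 p hp)

end Frame

/-! ### Complementarity, critical cone and asymptotic multipliers -/

namespace ConvexSDP

variable {W : Type*} [NormedAddCommGroup W] [InnerProductSpace ℝ W] [FiniteDimensional ℝ W]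
  {m n : ℕ} (P : ConvexSDP W m n)

theorem isClosed_Q : IsClosed P.Q := by
  obtain ⟨k, N, hN⟩ := P.polyhedral
  have : P.Q = ⋂ i, {y : Vec m | (N *ᵥ y.ofLp) i ≤ 0} := by rw [hN]; ext y; simp
  rw [this]
  refine isClosed_iInter fun i => isClosed_le ?_ continuous_const
  exact (continuous_apply i).comp
    ((Continuous.matrix_mulVec continuous_const continuous_id).comp (PiLp.continuous_ofLp 2 _))

theorem dom_of_isDualOptimal {z : ZSpace W m n} (h : P.IsDualOptimal z) : P.Dom z := by
  by_contra hn
  have := h.2.1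
  rw [P.dualObj_of_not_dom hn] at this
  exact lt_irrefl _ this

/-- The multiplier equations in the form of complementarity conditions. -/
structure Complementary (z : ZSpace W m n) (X : Sym n) : Prop where
  dom : P.Dom z
  q_polar : P.b - P.A X ∈ polarCone P.Q
  q_orth : ⟪P.b - P.A X, yOf z⟫ = 0
  grad : P.F X = P.gradConj (-wOf z)
  X_mem : X ∈ psdCone n
  orth : ⟪sOf z, X⟫ = 0
  eqn : P.dualMap z = P.C

theorem complementary_of_mem (hs : P.ConjSmooth) {z : ZSpace W m n} (hz : P.Dom z) {X : Sym n}
    (hX : X ∈ P.multipliers z) : P.Complementary z X := by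
  have hcomp := FiniteDimensional.complete ℝ W
  obtain ⟨⟨hy, hy'⟩, ⟨-, hw⟩, ⟨hS, hS'⟩, he⟩ := hX
  obtain ⟨h1, h2⟩ := P.isPointedCone_Q.inner_eq_zero_of_normal hy hy'
  obtain ⟨h3, h4⟩ := (isPointedCone_psdCone n).inner_eq_zero_of_normal hS hS'
  refine ⟨hz, h2, h1, ?_, mem_psdCone_of_forall_inner fun Y hY => ?_, ?_, he⟩
  · refine eq_gradient_of_isSubgradient (hs.1.mem_nhds hz.2.1) (P.hasGradientAt_hc hs hz.2.1) ?_
    intro u' hu'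
    have := hw u'
    rwa [hConj_eq_coe P hz.2.1, hConj_eq_coe P hu', ← EReal.coe_add,
        EReal.coe_le_coe_iff] at this
  · have := h4 Y hY
    rw [inner_neg_left] at this
    linarith
  · rw [inner_neg_left] at h3
    rw [real_inner_comm]; linarith

/-- The critical cone of the dual problem, described by the multiplier. -/
def critCone (z : ZSpace W m n) (X : Sym n) : Set (ZSpace W m n) :=
  {d | P.dualMap d = 0 ∧ yOf d ∈ criticalCone P.Q (yOf z) (P.b - P.A X) ∧
    sOf d ∈ criticalCone (psdCone n) (sOf z) X}

variable {P}

theorem Complementary.isPointedCone_critCone {z : ZSpace W m n} {X : Sym n}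
    (h : P.Complementary z X) : IsPointedCone (P.critCone z X) := by
  have hy := isPointedCone_criticalCone (v := P.b - P.A X) P.isPointedCone_Q.convex h.dom.1
  have hS := isPointedCone_criticalCone (v := X) (isPointedCone_psdCone n).convex h.dom.2.2
  refine ⟨⟨?_, hy.zero_mem, hS.zero_mem⟩, fun ha hb => ⟨?_, hy.add_mem ha.2.1 hb.2.1,
    hS.add_mem ha.2.2 hb.2.2⟩, fun ht ha => ⟨?_, hy.smul_mem ht ha.2.1, hS.smul_mem ht ha.2.2⟩⟩
  · have := P.dualMap_smul 0 (0 : ZSpace W m n)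
    rwa [zero_smul, zero_smul] at this
  · rw [dualMap_add, ha.1, hb.1, add_zero]
  · rw [dualMap_smul, ha.1, smul_zero]

theorem isClosed_critCone {z : ZSpace W m n} {X : Sym n} : IsClosed (P.critCone z X) :=
  (isClosed_eq P.continuous_dualMap continuous_const).inter
    ((isClosed_criticalCone.preimage continuous_yOf).inter
      (isClosed_criticalCone.preimage continuous_sOf))

/-- Pairing `X` with the linearized equation, and using `F X = ∇h*(-w)` and the orthogonality
relations, gives the vanishing of the directional derivative of the objective. -/
theorem Complementary.critCone_subset {z : ZSpace W m n} {X : Sym n}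
    (h : P.Complementary z X) : P.critCone z X ⊆ P.dualCriticalCone z := by
  rintro d ⟨h1, h2, h3⟩
  refine ⟨h1, h2.1, h3.1, ?_⟩
  have e1 := P.inner_dualMap X d
  have e2 := h2.2
  rw [h1, inner_zero_right, h3.2] at e1
  rw [inner_sub_left] at e2
  rw [← h.grad]
  linarith

theorem Complementary.nonempty_frame {z : ZSpace W m n} {X : Sym n} (h : P.Complementary z X) :
    Nonempty (Frame (sOf z) X) := exists_frame h.dom.2.2 h.X_mem h.orth

/-- Elements assembled from the coefficients of the linearized equations. -/
noncomputable def adjL (P : ConvexSDP W m n) : Sym n →ₗ[ℝ] ZSpace W m n where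
  toFun X := mkZ (P.A X) (P.F X) X
  map_add' X Y := by rw [map_add, map_add]; rfl
  map_smul' t X := by rw [map_smul, map_smul]; rfl

open Classical in
/-- Nonnegative combinations of the rows in `a`. -/
noncomputable def rowsL {r : ℕ} (B : Matrix (Fin r) (Fin m) ℝ) (a : Set (Fin r)) :
    (Fin r → ℝ) →ₗ[ℝ] Vec m where
  toFun l := WithLp.toLp 2 (Bᵀ *ᵥ fun i => if i ∈ a then l i else 0)
  map_add' l l' := by
    rw [← WithLp.toLp_add, ← mulVec_add]
    congr 2
    funext i
    by_cases hi : i ∈ a <;> simp [hi]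
  map_smul' t l := by
    rw [RingHom.id_apply, ← WithLp.toLp_smul, ← mulVec_smul]
    congr 2
    funext i
    by_cases hi : i ∈ a <;> simp [hi]

theorem inner_rowsL {r : ℕ} (B : Matrix (Fin r) (Fin m) ℝ) (a : Set (Fin r)) (l : Fin r → ℝ)
    (y : Vec m) : ⟪rowsL B a l, y⟫ = by
      classical exact ∑ i, if i ∈ a then l i * (B *ᵥ y.ofLp) i else 0 := by
  classical
  have : ⟪rowsL B a l, y⟫ = y.ofLp ⬝ᵥ Bᵀ *ᵥ fun i => if i ∈ a then l i else 0 := by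
    rw [PiLp.inner_apply, dotProduct]
    exact Finset.sum_congr rfl fun i _ => by simp [rowsL]
  rw [this, dotProduct_mulVec, vecMul_transpose, dotProduct]
  refine Finset.sum_congr rfl fun i _ => ?_
  by_cases hi : i ∈ a <;> simp [hi, mul_comm]

/-- The insertion of the `y` and `S` components. -/
def insY : Vec m →ₗ[ℝ] ZSpace W m n := ⟨⟨fun y => mkZ y 0 0, fun y y' => by
  rw [← mkZ_add]; simp⟩, fun t y => by rw [RingHom.id_apply, ← mkZ_smul]; simp⟩
def insS : Sym n →ₗ[ℝ] ZSpace W m n := ⟨⟨fun S => mkZ 0 0 S, fun y y' => by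
  rw [← mkZ_add]; simp⟩, fun t y => by rw [RingHom.id_apply, ← mkZ_smul]; simp⟩

/-- Multipliers for the linearized optimality conditions: the relation between a solution of a
variational inequality over the critical cone and the linear and conic multipliers. -/
theorem Complementary.mem_closure_multipliers {z : ZSpace W m n} {X : Sym n}
    (h : P.Complementary z X) {r : ℕ} {B : Matrix (Fin r) (Fin m) ℝ}
    (hB : criticalCone P.Q (yOf z) (P.b - P.A X) = {y | ∀ i, (B *ᵥ y.ofLp) i ≤ 0})
    {d v : ZSpace W m n} (hd : d ∈ P.critCone z X) (hv : ∀ d' ∈ P.critCone z X, 0 ≤ ⟪v, d' - d⟫) :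
    v ∈ closure {u : ZSpace W m n | ∃ (e : Sym n) (l : Fin r → ℝ), (∀ i, 0 ≤ l i) ∧
      ∃ k ∈ insS '' coneK (sOf z) X,
        u = P.adjL e + (-(insY ∘ₗ rowsL B {i | (B *ᵥ (yOf d).ofLp) i = 0})) l + k} := by
  classical
  set a : Set (Fin r) := {i | (B *ᵥ (yOf d).ofLp) i = 0} with ha
  set R : Set (ZSpace W m n) := {u | ∃ (e : Sym n) (l : Fin r → ℝ), (∀ i, 0 ≤ l i) ∧
      ∃ k ∈ insS '' coneK (sOf z) X, u = P.adjL e + (-(insY ∘ₗ rowsL B a)) l + k} with hR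
  have hK := isPointedCone_dualCone (criticalCone (psdCone n) (sOf z) X)
  have hRc : IsPointedCone R := by
    refine ⟨⟨0, 0, fun i => le_rfl, 0, ⟨0, hK.zero_mem, map_zero _⟩, by simp⟩, ?_, ?_⟩
    · rintro _ _ ⟨e, l, hl, _, ⟨k, hk, rfl⟩, rfl⟩ ⟨e', l', hl', _, ⟨k', hk', rfl⟩, rfl⟩
      refine ⟨e + e', l + l', fun i => add_nonneg (hl i) (hl' i), _,
        ⟨k + k', hK.add_mem hk hk', rfl⟩, ?_⟩
      simp only [map_add]; abel
    · rintro t _ ht ⟨e, l, hl, _, ⟨k, hk, rfl⟩, rfl⟩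
      refine ⟨t • e, t • l, fun i => mul_nonneg ht (hl i), _, ⟨t • k, hK.smul_mem ht hk, rfl⟩, ?_⟩
      simp only [map_smul, smul_add]
  -- A separating `η` satisfies the linear equation, the rows active at `d` and the conic condition.
  -- So `d + ε η` is critical for small `ε`, contradicting the variational inequality because ⟪η, v⟫
  -- < 0.
  by_contra hn
  obtain ⟨η, h1, h2⟩ := hRc.exists_separating hn
  have hE : P.dualMap η = 0 := by
    have h3 : ∀ e : Sym n, 0 ≤ ⟪e, P.dualMap η⟫ := by
      intro e
      have := h1 (P.adjL e) ⟨e, 0, fun i => le_rfl, 0, ⟨0, hK.zero_mem, map_zero _⟩, by simp⟩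
      rw [inner_Z] at this
      simp only [adjL, LinearMap.coe_mk, AddHom.coe_mk, yOf_mkZ, wOf_mkZ, sOf_mkZ] at this
      rw [inner_dualMap, real_inner_comm, real_inner_comm (wOf η), real_inner_comm (sOf η)]
      linarith
    have := h3 (-P.dualMap η)
    rw [inner_neg_left] at this
    exact inner_self_eq_zero.1 (le_antisymm (by linarith) real_inner_self_nonneg)
  have hY : ∀ i ∈ a, (B *ᵥ (yOf η).ofLp) i ≤ 0 := by
    intro i hi
    have := h1 ((-(insY ∘ₗ rowsL B a)) (Pi.single i 1)) ⟨0, Pi.single i 1, fun j => by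
      by_cases hj : j = i
      · rw [hj]; simp
      · simp [hj], 0, ⟨0, hK.zero_mem, map_zero _⟩, by simp⟩
    rw [LinearMap.neg_apply, LinearMap.comp_apply, inner_Z_neg_right, inner_Z] at this
    simp only [insY, LinearMap.coe_mk, AddHom.coe_mk, yOf_mkZ, wOf_mkZ, sOf_mkZ,
      inner_zero_right, add_zero] at this
    rw [real_inner_comm, inner_rowsL, Finset.sum_eq_single i] at this
    · simp only [hi, if_true, Pi.single_eq_same, one_mul] at this
      linarith
    · intro j _ hj; simp [hj]
    · simp
  have hS : sOf η ∈ criticalCone (psdCone n) (sOf z) X := by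
    refine (isPointedCone_criticalCone (isPointedCone_psdCone n).convex
      h.dom.2.2).mem_of_forall_dual isClosed_criticalCone fun u hu => ?_
    have := h1 (insS u) ⟨0, 0, fun i => le_rfl, _, ⟨u, mem_dualCone.2 hu, rfl⟩, by simp⟩
    rw [inner_Z] at this
    simp only [insS, LinearMap.coe_mk, AddHom.coe_mk, yOf_mkZ, wOf_mkZ, sOf_mkZ,
      inner_zero_right, zero_add] at this
    rwa [real_inner_comm]
  have hdY : ∀ i, (B *ᵥ (yOf d).ofLp) i ≤ 0 := by
    have := hd.2.1; rw [hB] at this; exact this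
  -- Only rows active at `d` constrain `η`; the inactive ones have slack for small `ε`.
  have hev : ∀ᶠ ε : ℝ in 𝓝[>] 0, ∀ i, (B *ᵥ (yOf d).ofLp) i + ε * (B *ᵥ (yOf η).ofLp) i ≤ 0 := by
    rw [Filter.eventually_all]
    intro i
    by_cases hi : (B *ᵥ (yOf d).ofLp) i = 0
    · filter_upwards [self_mem_nhdsWithin] with ε hε
      rw [hi, zero_add]
      exact mul_nonpos_of_nonneg_of_nonpos (le_of_lt hε) (hY i hi)
    · have hlt : (B *ᵥ (yOf d).ofLp) i < 0 := lt_of_le_of_ne (hdY i) hi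
      have ht : Tendsto (fun ε : ℝ => (B *ᵥ (yOf d).ofLp) i + ε * (B *ᵥ (yOf η).ofLp) i) (𝓝 0)
          (𝓝 ((B *ᵥ (yOf d).ofLp) i + 0 * (B *ᵥ (yOf η).ofLp) i)) :=
        tendsto_const_nhds.add (tendsto_id.mul_const _)
      rw [zero_mul, add_zero] at ht
      exact nhdsWithin_le_nhds ((ht.eventually (gt_mem_nhds hlt)).mono fun _ h => h.le)
  obtain ⟨ε, hε, hε0⟩ := (hev.and self_mem_nhdsWithin).exists
  have hε0' : (0 : ℝ) < ε := hε0
  have hmem : d + ε • η ∈ P.critCone z X := by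
    refine ⟨?_, ?_, ?_⟩
    · rw [dualMap_add, dualMap_smul, hd.1, hE, smul_zero, add_zero]
    · rw [hB]
      intro i
      rw [yOf_add, yOf_smul, WithLp.ofLp_add, WithLp.ofLp_smul, mulVec_add, mulVec_smul]
      exact hε i
    · have hC := isPointedCone_criticalCone (v := X) (isPointedCone_psdCone n).convex h.dom.2.2
      exact hC.add_mem hd.2.2 (hC.smul_mem hε0'.le hS)
  have h3 := hv _ hmem
  rw [add_sub_cancel_left, inner_Z_smul_right, inner_Z_comm] at h3
  have := mul_neg_of_pos_of_neg hε0' h2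
  linarith

end ConvexSDP

/-! ### Linearized complementarity and projections onto K -/

namespace Frame

variable {n : ℕ} {S X : Sym n} (f : Frame S X)

theorem c_add (D E : Sym n) : f.c (D + E) = f.c D + f.c E := Sym.coord_add D E

theorem c_sub (D E : Sym n) : f.c (D - E) = f.c D - f.c E := by
  have := f.c_add (D - E) E
  rw [sub_add_cancel] at this
  rw [this, add_sub_cancel_right]

theorem c_symm (D : Sym n) (i j : Fin n) : f.c D i j = f.c D j i := Sym.coord_symm D i j

theorem mat_eq (D : Sym n) : D.mat = f.U * f.c D * f.Uᵀ := Sym.mat_eq_coord f.orth D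

/-- The difference of an element of `coneK S X` and a Hessian value is a critical direction
of the multiplier. -/
theorem sub_hess_mem_criticalCone {G : Sym n} (hG : G ∈ coneK S X) (D : Sym n) :
    G - f.hess D ∈ criticalCone (psdCone n) X S := by
  refine (f.swap.mem_criticalCone_iff _).2 ⟨fun i j hi hj => ?_, fun v hv => ?_⟩
  · change f.x i = 0 at hi
    change f.s j ≠ 0 at hj
    change f.c (G - f.hess D) i j = 0
    rw [c_sub, Matrix.sub_apply, c_symm, f.coneK_zero hG hj, c_hess, hi, f.x_eq_zero_of_s hj]
    ring
  · change ∀ i, f.x i ≠ 0 → v i = 0 at hv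
    change 0 ≤ v ⬝ᵥ f.c (G - f.hess D) *ᵥ v
    have h : v ⬝ᵥ f.c (G - f.hess D) *ᵥ v = v ⬝ᵥ f.c G *ᵥ v := by
      rw [dotProduct_mulVec_eq_sum, dotProduct_mulVec_eq_sum]
      refine Finset.sum_congr rfl fun i _ => Finset.sum_congr rfl fun j _ => ?_
      rw [c_sub, Matrix.sub_apply, c_hess]
      by_cases hi : f.x i = 0
      · by_cases hj : f.x j = 0
        · rw [hi, hj]; ring
        · rw [hv j hj]; ring
      · rw [hv i hi]; ring
    rw [h]
    exact f.coneK_quad hG hv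

/-- Only entries with `x i > 0` and `s j > 0` matter. There `G` vanishes and the Hessian weight is
`x i / s j`, so both terms have size √(x i / s j) · D i j and cancel. -/
theorem sqrt_equation {G : Sym n} (hG : G ∈ coneK S X) (D : Sym n) :
    psdSqrt X.mat * D.mat * pinv (psdSqrt S.mat)
      + pinv (psdSqrt X.mat) * (G - f.hess D).mat * psdSqrt S.mat = 0 := by
  have hO : f.Uᵀ * f.U = 1 := f.orth
  have key : ∀ (a b : Fin n → ℝ) (M : Matrix (Fin n) (Fin n) ℝ),
      (f.U * diagonal a * f.Uᵀ) * (f.U * M * f.Uᵀ) * (f.U * diagonal b * f.Uᵀ)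
        = f.U * (diagonal a * M * diagonal b) * f.Uᵀ := by
    intro a b M
    calc (f.U * diagonal a * f.Uᵀ) * (f.U * M * f.Uᵀ) * (f.U * diagonal b * f.Uᵀ)
        = f.U * diagonal a * (f.Uᵀ * f.U) * M * (f.Uᵀ * f.U) * diagonal b * f.Uᵀ := by
          simp only [Matrix.mul_assoc]
      _ = _ := by rw [hO, Matrix.mul_one, Matrix.mul_one]; simp only [Matrix.mul_assoc]
  rw [f.mat_X, f.mat_S, psdSqrt_conj_diagonal hO f.x_nonneg, psdSqrt_conj_diagonal hO f.s_nonneg,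
    pinv_conj_diagonal hO, pinv_conj_diagonal hO, f.mat_eq D, f.mat_eq (G - f.hess D), key, key,
    ← Matrix.add_mul, ← Matrix.mul_add]
  convert Matrix.zero_mul _
  convert Matrix.mul_zero _
  ext i j
  rw [Matrix.add_apply, mul_diagonal, diagonal_mul, mul_diagonal, diagonal_mul, c_sub,
    Matrix.sub_apply, c_hess, Matrix.zero_apply]
  rcases eq_or_lt_of_le (f.x_nonneg i) with hi | hi
  · rw [← hi]; simp
  rcases eq_or_lt_of_le (f.s_nonneg j) with hj | hj
  · rw [← hj]; simp
  rw [f.s_eq_zero_of_x hi.ne', c_symm f G, f.coneK_zero hG hj.ne', f.x_eq_zero_of_s hj.ne']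
  have h1 : √(f.x i) ≠ 0 := (Real.sqrt_pos.2 hi).ne'
  have h2 : √(f.s j) ≠ 0 := (Real.sqrt_pos.2 hj).ne'
  have h3 : f.x i = √(f.x i) * √(f.x i) := (Real.mul_self_sqrt hi.le).symm
  have h4 : f.s j = √(f.s j) * √(f.s j) := (Real.mul_self_sqrt hj.le).symm
  set a := √(f.x i)
  set b := √(f.s j)
  rw [h3, h4]
  field_simp
  ring

/-- With `0⁻¹ = 0` the Hessian vanishes on the kernel block of `S`, so it is orthogonal to the span
of `K`. -/
theorem metricProj_coneK_sub_hess {G : Sym n} (hG : G ∈ coneK S X) (D : Sym n) :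
    metricProj (coneK S X) (G - f.hess D) = G := by
  refine f.metricProj_coneK hG fun i j hi hj => ?_
  rw [c_sub, Matrix.sub_apply, c_hess, hi, hj]
  simp

/-- The projection of a critical direction is its kernel block, and `G` pairs only with that block.
-/
theorem inner_metricProj_coneK (f : Frame S X) {G : Sym n} (hG : G ∈ coneK S X) {D : Sym n}
    (hD : D ∈ criticalCone (psdCone n) S X) : ⟪G, metricProj (coneK S X) D⟫ = ⟪G, D⟫ := by
  classical
  have hm : metricProj (coneK S X) D = f.mask D fun i => f.s i = 0 := by
    refine f.metricProj_coneK (f.mem_coneK (fun i j hi => ?_) fun v _ _ => ?_) fun i j hi hj => ?_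
    · rw [c_mask, if_neg fun h => hi h.1]
    · rw [mask_quad]
      exact ((f.mem_criticalCone_iff D).1 hD).2 _ fun i hi => if_neg hi
    · rw [c_mask, if_pos ⟨hi, hj⟩]
  rw [hm, f.inner_eq, f.inner_eq]
  refine Finset.sum_congr rfl fun i _ => Finset.sum_congr rfl fun j _ => ?_
  by_cases hi : f.s i = 0
  · by_cases hj : f.s j = 0
    · rw [c_mask, if_pos ⟨hi, hj⟩]
    · rw [c_symm f G, f.coneK_zero hG hj]; ring
  · rw [f.coneK_zero hG hi]; ring

/-- A critical direction with nonpositive trace on the biactive block vanishes on the kernel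
block. -/
theorem c_eq_zero_of_inner_biactive_nonpos {D : Sym n} (hD : D ∈ criticalCone (psdCone n) S X)
    (h : ⟪f.biactive, D⟫ ≤ 0) {i j : Fin n} (hi : f.s i = 0) (hj : f.s j = 0) :
    f.c D i j = 0 := by
  classical
  obtain ⟨h0, hq⟩ := (f.mem_criticalCone_iff D).1 hD
  by_cases hxj : f.x j = 0
  swap
  · exact h0 i j hi hxj
  have hdiag : ∀ k, f.s k = 0 → 0 ≤ f.c D k k := by
    intro k hk
    have := hq (Pi.single k 1) fun l hl => by
      rw [Pi.single_apply, if_neg]; rintro rfl; exact hl hk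
    simpa [mulVec_single_one] using this
  rw [inner_biactive] at h
  have hz : f.c D j j = 0 := by
    have h2 := Finset.single_le_sum (f := fun i => if f.s i = 0 ∧ f.x i = 0 then f.c D i i else 0)
      (s := Finset.univ) (fun k _ => by
        by_cases hk : f.s k = 0 ∧ f.x k = 0
        · simp only [if_pos hk]; exact hdiag k hk.1
        · simp only [if_neg hk]; exact le_rfl) (Finset.mem_univ j)
    simp only [if_pos (And.intro hj hxj)] at h2
    exact le_antisymm (h2.trans h) (hdiag j hj)
  refine entry_eq_zero_of_diag_eq_zero ?_ (fun v hv => hq v fun k hk => hv k ?_ ?_) hz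
  · ext k l; exact f.c_symm D l k
  · rintro rfl; exact hk hi
  · rintro rfl; exact hk hj

end Frame

section Components

variable {W : Type*} [NormedAddCommGroup W] [InnerProductSpace ℝ W] {m n : ℕ}

theorem yOf_neg (a : ZSpace W m n) : yOf (-a) = -yOf a := rfl
theorem wOf_neg (a : ZSpace W m n) : wOf (-a) = -wOf a := rfl
theorem sOf_neg (a : ZSpace W m n) : sOf (-a) = -sOf a := rfl

end Components

/-! ### Critical directions vanish on the kernel block -/

namespace ConvexSDP

variable {W : Type*} [NormedAddCommGroup W] [InnerProductSpace ℝ W] [FiniteDimensional ℝ W]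
  {m n : ℕ} {P : ConvexSDP W m n}

set_option synthInstance.maxHeartbeats 200000 in
/-- Solvability of the linearized variational inequality with a biactive source term. -/
theorem Complementary.exists_critical_solution {z : ZSpace W m n} {X : Sym n}
    (h : P.Complementary z X) (hs : P.ConjSmooth) (hso : P.DualSOSC z X) (f : Frame (sOf z) X) :
    ∃ d ∈ P.critCone z X, ∀ d' ∈ P.critCone z X,
      0 ≤ ⟪mkZ 0 (-dirDeriv P.gradConj (-wOf z) (-wOf d)) (f.hess (sOf d) - f.biactive),
        d' - d⟫ := by
  have hcomp := FiniteDimensional.complete ℝ W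
  let L : ZSpace W m n →L[ℝ] W := LinearMap.toContinuousLinearMap (-wL)
  let H : ZSpace W m n →L[ℝ] ZSpace W m n :=
    LinearMap.toContinuousLinearMap (insS ∘ₗ f.hessL ∘ₗ sL)
  have hL : ∀ d, L d = -wOf d := fun d => rfl
  have hH : ∀ d, H d = mkZ 0 0 (f.hess (sOf d)) := fun d => rfl
  have hHi : ∀ a b, ⟪H a, b⟫ = ⟪f.hess (sOf a), sOf b⟫ := by
    intro a b
    rw [hH, inner_Z, yOf_mkZ, wOf_mkZ, sOf_mkZ, inner_zero_left, inner_zero_left]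
    ring
  suffices hh : ∃ d ∈ P.critCone z X, ∀ d' ∈ P.critCone z X,
      0 ≤ ⟪dirDeriv P.gradConj (-wOf z) (L d), L (d' - d)⟫ + ⟪H d, d' - d⟫
        - ⟪(mkZ 0 0 f.biactive : ZSpace W m n), d' - d⟫ by
    obtain ⟨d, hd, hv⟩ := hh
    refine ⟨d, hd, fun d' hd' => ?_⟩
    have := hv d' hd'
    rw [hHi, hL, hL, inner_Z] at this
    rw [inner_Z]
    simp only [yOf_mkZ, wOf_mkZ, sOf_mkZ, inner_zero_left, inner_neg_left, inner_neg_right,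
      inner_sub_left] at this ⊢
    linarith
  refine exists_linearized_solution hs.1 h.dom.2.1 (fun u hu => P.hasGradientAt_hc hs hu)
    (hs.2.2 _ h.dom.2.1) L H (fun a b => ?_) h.isPointedCone_critCone isClosed_critCone
    (fun d hd hd0 => ?_) _
  · rw [hHi, hHi, f.inner_hess_comm]
  · rw [hHi, hL, ← f.Upsilon_eq, real_inner_comm]
    exact hso d (h.critCone_subset hd) hd0

theorem dirDeriv_zero {E F : Type*} [NormedAddCommGroup E]
    [InnerProductSpace ℝ E] [NormedAddCommGroup F] [InnerProductSpace ℝ F] {G : E → F} {x : E}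
    (h : DirDifferentiableAt G x) : dirDeriv G x 0 = 0 := by
  have := h.dirDeriv_smul 0 (r := 2) two_pos
  rw [smul_zero, two_smul] at this
  exact left_eq_add.1 this

/-- Critical directions vanish on the kernel block of `S`. -/
theorem Complementary.c_eq_zero {z : ZSpace W m n} {X : Sym n}
    (h : P.Complementary z X) (hs : P.ConjSmooth) (hso : P.DualSOSC z X) {r : ℕ}
    {B : Matrix (Fin r) (Fin m) ℝ}
    (hB : criticalCone P.Q (yOf z) (P.b - P.A X) = {y | ∀ i, (B *ᵥ y.ofLp) i ≤ 0})
    (hii : ∀ d ∈ P.jointCriticalCone z X ∩ P.linearizedSet z,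
      ⟪metricProj (coneK (sOf z) X) (xOf d), metricProj (coneK (sOf z) X) (sOf (zOf d))⟫ = 0)
    (f : Frame (sOf z) X) {d : ZSpace W m n} (hd : d ∈ P.critCone z X) {i j : Fin n}
    (hi : f.s i = 0) (hj : f.s j = 0) : f.c (sOf d) i j = 0 := by
  classical
  refine f.c_eq_zero_of_inner_biactive_nonpos hd.2.2 ?_ hi hj
  obtain ⟨e, he, hv⟩ := h.exists_critical_solution hs hso f
  set g' : W := dirDeriv P.gradConj (-wOf z) (-wOf e) with hg'
  -- These are exact multipliers of the linearized problem without source: the shift by `biactive`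
  -- needed to leave the closure removes the source term.
  have hdec : ∃ (X1 : Sym n) (l : Fin r → ℝ), (∀ i, 0 ≤ l i) ∧ ∃ G ∈ coneK (sOf z) X,
      P.A X1 = rowsL B {i | (B *ᵥ (yOf e).ofLp) i = 0} l ∧ P.F X1 = -g' ∧
        f.hess (sOf e) = X1 + G := by
    have hK : IsPointedCone (insS (W := W) (m := m) '' coneK (sOf z) X) := by
      have hK := isPointedCone_dualCone (criticalCone (psdCone n) (sOf z) X)
      refine ⟨⟨0, hK.zero_mem, map_zero _⟩, ?_, ?_⟩
      · rintro _ _ ⟨a, ha, rfl⟩ ⟨b, hb, rfl⟩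
        exact ⟨a + b, hK.add_mem ha hb, map_add _ _ _⟩
      · rintro t _ ht ⟨a, ha, rfl⟩
        exact ⟨t • a, hK.smul_mem ht ha, map_smul _ _ _⟩
    have hn : (0 : ℝ) < 1 / (n + 1) := by positivity
    have := add_mem_sum_of_mem_closure P.adjL
      (-(insY ∘ₗ rowsL B {i | (B *ᵥ (yOf e).ofLp) i = 0})) hK (f.spanK.map insS)
      (g := insS f.biactive) (ε := 1 / (n + 1))
      (image_mono f.coneK_subset_spanK) hn (fun s hs1 hs2 => by
        obtain ⟨s, hs, rfl⟩ := hs1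
        have : ‖s‖ ≤ ‖(insS s : ZSpace W m n)‖ := norm_sOf_le (insS s : ZSpace W m n)
        exact ⟨f.biactive + s, f.biactive_add_mem hs (this.trans_lt hs2), map_add _ _ _⟩)
      (h.mem_closure_multipliers hB he hv)
    obtain ⟨X1, l, hl, _, ⟨G, hG, rfl⟩, heq⟩ := this
    refine ⟨X1, l, hl, G, hG, ?_, ?_, ?_⟩
    · have := congrArg yOf heq
      simp only [yOf_add, yOf_mkZ, adjL, insS, insY, LinearMap.coe_mk, AddHom.coe_mk,
        LinearMap.neg_apply, LinearMap.comp_apply, yOf_neg, add_zero] at this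
      rwa [eq_comm, ← sub_eq_add_neg, sub_eq_zero] at this
    · have := congrArg wOf heq
      simp only [wOf_add, wOf_mkZ, adjL, insS, insY, LinearMap.coe_mk, AddHom.coe_mk,
        LinearMap.neg_apply, LinearMap.comp_apply, wOf_neg, add_zero, neg_zero] at this
      exact this.symm
    · have := congrArg sOf heq
      simp only [sOf_add, sOf_mkZ, adjL, insS, insY, LinearMap.coe_mk, AddHom.coe_mk,
        LinearMap.neg_apply, LinearMap.comp_apply, sOf_neg, add_zero, neg_zero,
        sub_add_cancel] at this
      exact this
  obtain ⟨X1, l, hl, G, hG, hA, hF, hX1⟩ := hdec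
  -- With `d_X = -X1` the pair `(e, d_X)` has the form `G - hess`, which satisfies all conic and
  -- square-root conditions of the joint critical cone.
  have hX1' : -X1 = G - f.hess (sOf e) := by rw [hX1]; abel
  have hAe : ⟪P.A X1, yOf e⟫ = 0 := by
    rw [hA, inner_rowsL]
    refine Finset.sum_eq_zero fun i _ => ?_
    by_cases hi : (B *ᵥ (yOf e).ofLp) i = 0
    · rw [if_pos (show i ∈ {i | (B *ᵥ (yOf e).ofLp) i = 0} from hi), hi, mul_zero]
    · rw [if_neg (show i ∉ {i | (B *ᵥ (yOf e).ofLp) i = 0} from hi)]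
  have hmem : mkE e (-X1) ∈ P.jointCriticalCone z X ∩ P.linearizedSet z := by
    refine ⟨⟨he.2.1, he.2.2, ?_, ?_, ?_, ?_⟩, he.1, ?_⟩
    · change -X1 ∈ _
      rw [hX1']
      exact f.sub_hess_mem_criticalCone hG _
    · change -P.A (-X1) ∈ _
      rw [map_neg, neg_neg]
      refine mem_criticalCone_polarCone P.isPointedCone_Q P.isClosed_Q h.dom.1 h.q_polar h.q_orth
        fun y' hy' => ?_
      rw [hB] at hy'
      rw [hA, inner_rowsL]
      refine Finset.sum_nonpos fun i _ => ?_
      split_ifs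
      · exact mul_nonpos_of_nonneg_of_nonpos (hl i) (hy' i)
      · exact le_rfl
    · change ⟪yOf e, P.A (-X1)⟫ = 0
      rw [map_neg, inner_neg_right, real_inner_comm, hAe, neg_zero]
    · change psdSqrt X.mat * (sOf e).mat * pinv (psdSqrt (sOf z).mat)
        + pinv (psdSqrt X.mat) * (-X1).mat * psdSqrt (sOf z).mat = 0
      rw [hX1']
      exact f.sqrt_equation hG _
    · change P.F (-X1) - g' = 0
      rw [map_neg, hF, neg_neg, sub_self]
  -- Hypothesis (ii), with the two projections evaluated.
  have hGe : ⟪G, sOf e⟫ = 0 := by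
    have := hii _ hmem
    change ⟪metricProj (coneK (sOf z) X) (-X1), metricProj (coneK (sOf z) X) (sOf e)⟫ = 0 at this
    rwa [hX1', f.metricProj_coneK_sub_hess hG, f.inner_metricProj_coneK hG he.2.2] at this
  -- Pairing `X1` with the linearized equation at `e` expresses the second-order form as a multiple
  -- of ⟪G, sOf e⟫ = 0, so it cannot be positive.
  have he0 : e = 0 := by
    by_contra hne
    have h1 := hso e (h.critCone_subset he) hne
    have h2 := P.inner_dualMap X1 e
    have h3 : X1 = f.hess (sOf e) - G := by rw [hX1]; abel
    rw [he.1, inner_zero_right, hAe, hF] at h2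
    rw [f.Upsilon_eq, ← hg', inner_neg_left, real_inner_comm] at h1
    have h4 : ⟪X1, sOf e⟫ = ⟪f.hess (sOf e), sOf e⟫ := by
      rw [h3, inner_sub_left, hGe, sub_zero]
    rw [h4, inner_neg_left] at h2
    linarith
  -- At `e = 0` only the source term survives: `0 ≤ -⟪f.biactive, sOf d⟫`.
  have h1 := hv d hd
  have h2 : wOf e = 0 := by rw [he0]; rfl
  have h3 : f.hess (sOf e) = 0 := by
    have : sOf e = 0 := by rw [he0]; rfl
    rw [this]; exact map_zero f.hessL
  have h5 : sOf e = 0 := by rw [he0]; rfl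
  have h4 : g' = 0 := by rw [hg', h2, neg_zero]; exact dirDeriv_zero (hs.2.2 _ h.dom.2.1)
  rw [h4, inner_Z, h3, yOf_mkZ, wOf_mkZ, sOf_mkZ, neg_zero, zero_sub, inner_zero_left,
    inner_zero_left, sOf_sub, h5, sub_zero, inner_neg_left] at h1
  linarith

end ConvexSDP

/-! ### First-order expansion of complementarity -/

namespace Frame

variable {n : ℕ} {S X : Sym n} (f : Frame S X)

theorem c_smul (t : ℝ) (D : Sym n) : f.c (t • D) = t • f.c D := by
  rw [c, Sym.coord_smul]

theorem c_mul_eq_zero {D E : Sym n} (h : D.mat * E.mat = 0) : f.c D * f.c E = 0 := by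
  rw [c, c, Sym.coord_mul f.orth, h, Matrix.mul_zero, Matrix.zero_mul]

theorem c_X : f.c X = diagonal f.x := f.coord_X

theorem tendsto_c {ι : Type*} {l : Filter ι} {D : ι → Sym n} {E : Sym n}
    (h : Tendsto D l (𝓝 E)) (i j : Fin n) :
    Tendsto (fun k => f.c (D k) i j) l (𝓝 (f.c E i j)) :=
  ((Sym.continuous_coord_apply i j).tendsto E).comp h

/-- First-order expansion of complementary pairs of matrices. -/
theorem tendsto_s_mul_c {ι : Type*} {l : Filter ι} {t : ι → ℝ} {S' X' : ι → Sym n} {D : Sym n}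
    (hD : Tendsto (fun k => (t k)⁻¹ • (S' k - S)) l (𝓝 D))
    (hX : Tendsto X' l (𝓝 X)) (h0 : ∀ k, (S' k).mat * (X' k).mat = 0) (i j : Fin n) :
    Tendsto (fun k => (t k)⁻¹ * (f.s i * f.c (X' k) i j)) l (𝓝 (-(f.c D i j * f.x j))) := by
  -- Split `0 = S' X'` as `S X' + (S' - S) X'` and divide by `t`.
  have h1 : ∀ k, (t k)⁻¹ * (f.s i * f.c (X' k) i j)
      = -∑ r, f.c ((t k)⁻¹ • (S' k - S)) i r * f.c (X' k) r j := by
    intro k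
    have h2 := congrFun (congrFun (f.c_mul_eq_zero (h0 k)) i) j
    rw [Matrix.mul_apply, Matrix.zero_apply] at h2
    have h3 : ∑ r, f.c S i r * f.c (X' k) r j = f.s i * f.c (X' k) i j := by
      rw [f.c_S, ← Matrix.mul_apply, diagonal_mul]
    rw [← h3]
    have h4 : ∀ r, f.c ((t k)⁻¹ • (S' k - S)) i r * f.c (X' k) r j
        = (t k)⁻¹ * (f.c (S' k) i r * f.c (X' k) r j)
          - (t k)⁻¹ * (f.c S i r * f.c (X' k) r j) := by
      intro r
      rw [c_smul, c_sub, Matrix.smul_apply, Matrix.sub_apply, smul_eq_mul]; ring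
    rw [Finset.sum_congr rfl fun r _ => h4 r, Finset.sum_sub_distrib, ← Finset.mul_sum,
      ← Finset.mul_sum, h2, mul_zero, zero_sub, neg_neg]
  have h5 : f.c D i j * f.x j = ∑ r, f.c D i r * f.c X r j := by
    rw [f.c_X, ← Matrix.mul_apply, mul_diagonal]
  rw [h5]
  refine Tendsto.congr (fun k => (h1 k).symm) ?_
  exact (tendsto_finsetSum _ fun r _ => (f.tendsto_c hD i r).mul (f.tendsto_c hX r j)).neg

theorem c_mul_x_eq_zero {ι : Type*} {l : Filter ι} [l.NeBot] {t : ι → ℝ} {S' X' : ι → Sym n}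
    {D : Sym n} (hD : Tendsto (fun k => (t k)⁻¹ • (S' k - S)) l (𝓝 D))
    (hX : Tendsto X' l (𝓝 X)) (h0 : ∀ k, (S' k).mat * (X' k).mat = 0) {i : Fin n}
    (hi : f.s i = 0) (j : Fin n) : f.c D i j * f.x j = 0 := by
  have h := f.tendsto_s_mul_c hD hX h0 i j
  simp only [hi, zero_mul, mul_zero] at h
  exact neg_eq_zero.1 (tendsto_nhds_unique h tendsto_const_nhds)

/-- The expansion determines the limiting quotient of `X'` in rows with `s i ≠ 0`, where it is
`-hess D`. On the kernel block the quotient may diverge, but it is multiplied by the zero block of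
`D`. -/
theorem tendsto_inner_multiplier {ι : Type*} {l : Filter ι} {t : ι → ℝ} {S' X' : ι → Sym n}
    {D : Sym n} (hD : Tendsto (fun k => (t k)⁻¹ • (S' k - S)) l (𝓝 D))
    (hX : Tendsto X' l (𝓝 X)) (h0 : ∀ k, (S' k).mat * (X' k).mat = 0)
    (hz : ∀ i j, f.s i = 0 → f.s j = 0 → f.c D i j = 0) :
    Tendsto (fun k => ⟪(t k)⁻¹ • (X' k - X), D⟫) l (𝓝 (-⟪f.hess D, D⟫)) := by
  have hrow : ∀ i j, f.s i ≠ 0 →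
      Tendsto (fun k => f.c ((t k)⁻¹ • (X' k - X)) i j) l (𝓝 (-(f.c (f.hess D) i j))) := by
    intro i j hi
    have h := (f.tendsto_s_mul_c hD hX h0 i j).const_mul (f.s i)⁻¹
    have e1 : f.c X i j = 0 := by
      rw [f.c_X, diagonal_apply, f.x_eq_zero_of_s hi]; simp
    have e2 : (f.s i)⁻¹ * -(f.c D i j * f.x j) = -f.c (f.hess D) i j := by
      rw [c_hess, f.x_eq_zero_of_s hi]; ring
    rw [e2] at h
    refine h.congr fun k => ?_
    rw [c_smul, c_sub, Matrix.smul_apply, Matrix.sub_apply, e1, smul_eq_mul]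
    field_simp
    ring
  have hterm : ∀ i j, Tendsto (fun k => f.c ((t k)⁻¹ • (X' k - X)) i j * f.c D i j) l
      (𝓝 (-(f.c (f.hess D) i j * f.c D i j))) := by
    intro i j
    by_cases hi : f.s i = 0
    · by_cases hj : f.s j = 0
      · simpa only [hz i j hi hj, mul_zero, neg_zero] using tendsto_const_nhds
      · have := (hrow j i hj).mul_const (f.c D i j)
        rw [neg_mul, f.c_symm (f.hess D)] at this
        exact this.congr fun k => by rw [f.c_symm ((t k)⁻¹ • (X' k - X)) j i]
    · have := (hrow i j hi).mul_const (f.c D i j)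
      rwa [neg_mul] at this
  have := tendsto_finsetSum Finset.univ fun i _ =>
    tendsto_finsetSum (Finset.univ : Finset (Fin n)) fun j _ => hterm i j
  simp only [Finset.sum_neg_distrib] at this
  rw [← f.inner_eq] at this
  exact this.congr fun k => (f.inner_eq _ _).symm

end Frame

/-! ### The error bound for the dual variables -/

namespace ConvexSDP

variable {W : Type*} [NormedAddCommGroup W] [InnerProductSpace ℝ W] [FiniteDimensional ℝ W]
  {m n : ℕ} {P : ConvexSDP W m n}

theorem exists_rows (P : ConvexSDP W m n) :
    ∃ (k : ℕ) (N : Fin k → Vec m), P.Q = {y | ∀ i, ⟪N i, y⟫ ≤ 0} := by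
  obtain ⟨k, N, hN⟩ := P.polyhedral
  refine ⟨k, fun i => WithLp.toLp 2 (N i), ?_⟩
  rw [hN]
  ext y
  have h : ∀ i, ⟪(WithLp.toLp 2 (N i) : Vec m), y⟫ = (N *ᵥ y.ofLp) i := by
    intro i
    rw [PiLp.inner_apply, mulVec, dotProduct]
    exact Finset.sum_congr rfl fun j _ => by simp [mul_comm]
  simp only [mem_ofPred_eq, h]

/-- Normals along a sequence in a polyhedral cone make an acute angle with its direction. -/
theorem eventually_inner_normal_nonneg {E ι : Type*} [NormedAddCommGroup E]
    [InnerProductSpace ℝ E] {l : Filter ι} {k : ℕ} {N : Fin k → E} {t : ι → ℝ} {y : ι → E}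
    {y₀ d : E} (hmem : ∀ i j, ⟪N j, y i⟫ ≤ 0) (hy : Tendsto y l (𝓝 y₀))
    (hd : Tendsto (fun i => (t i)⁻¹ • (y i - y₀)) l (𝓝 d)) :
    ∀ᶠ i in l, ∀ v : E, (∀ y', (∀ j, ⟪N j, y'⟫ ≤ 0) → ⟪v, y' - y i⟫ ≤ 0) → 0 ≤ ⟪v, d⟫ := by
  -- A row active frequently along the sequence is active at `y₀`, and its quotients then vanish
  -- frequently, so it is orthogonal to `d`.
  have h1 : ∀ j, ∀ᶠ i in l, ⟪N j, y i⟫ < 0 ∨ ⟪N j, d⟫ = 0 := by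
    intro j
    by_cases hj : ⟪N j, d⟫ = 0
    · exact Eventually.of_forall fun _ => Or.inr hj
    refine Eventually.mono ?_ fun i => Or.inl
    by_contra hf
    rw [not_eventually] at hf
    have hf' : ∃ᶠ i in l, ⟪N j, y i⟫ = 0 :=
      hf.mono fun i hi => le_antisymm (hmem i j) (not_lt.1 hi)
    have hy0 : ⟪N j, y₀⟫ = 0 := by
      by_contra hne
      have := (tendsto_const_nhds.inner hy : Tendsto (fun i => ⟪N j, y i⟫) l (𝓝 ⟪N j, y₀⟫))
      exact hf' ((this.eventually_ne hne).mono fun i hi => hi)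
    refine hj ?_
    by_contra hne
    have := (tendsto_const_nhds.inner hd :
      Tendsto (fun i => ⟪N j, (t i)⁻¹ • (y i - y₀)⟫) l (𝓝 ⟪N j, d⟫))
    refine hf' ((this.eventually_ne hne).mono fun i hi hi' => hi ?_)
    rw [real_inner_smul_right, inner_sub_right, hi', hy0, sub_zero, mul_zero]
  filter_upwards [Filter.eventually_all.2 h1] with i hi v hv
  -- A step backward along `d` stays in the cone; testing the normal there gives the sign.
  have hev : ∀ᶠ ε : ℝ in 𝓝[>] 0, ∀ j, ⟪N j, y i - ε • d⟫ ≤ 0 := by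
    rw [Filter.eventually_all]
    intro j
    rcases hi j with h | h
    · have hc : Tendsto (fun ε : ℝ => ⟪N j, y i - ε • d⟫) (𝓝 0) (𝓝 ⟪N j, y i - (0 : ℝ) • d⟫) :=
        Continuous.tendsto (by fun_prop) 0
      rw [zero_smul, sub_zero] at hc
      exact nhdsWithin_le_nhds ((hc.eventually (gt_mem_nhds h)).mono fun _ h => h.le)
    · refine Eventually.of_forall fun ε => ?_
      rw [inner_sub_right, real_inner_smul_right, h, mul_zero, sub_zero]
      exact hmem i j
  obtain ⟨ε, hε, hε0⟩ := (hev.and self_mem_nhdsWithin).exists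
  have := hv _ hε
  have e : y i - ε • d - y i = -(ε • d) := by abel
  rw [e, inner_neg_right, real_inner_smul_right] at this
  have hε0' : (0 : ℝ) < ε := hε0
  by_contra hneg
  have := mul_neg_of_pos_of_neg hε0' (not_le.1 hneg)
  linarith

/-- Subtracting the perturbation moves the matrix into the semidefinite cone with exact
complementarity, so the expansion for complementary pairs applies. -/
theorem PerturbedKKT.shifted {p ξ : ESpace W m n} (h : P.PerturbedKKT p ξ) :
    xOf ξ - sOf (zOf p) ∈ psdCone n ∧ (sOf (zOf ξ)).mat * (xOf ξ - sOf (zOf p)).mat = 0 := by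
  obtain ⟨h1, h2⟩ := (isPointedCone_psdCone n).inner_eq_zero_of_normal h.dom.2.2 h.normal_S
  have hm : xOf ξ - sOf (zOf p) ∈ psdCone n := by
    refine mem_psdCone_of_forall_inner fun Y hY => ?_
    have := h2 Y hY
    rw [← neg_sub, inner_neg_left] at this
    linarith
  refine ⟨hm, Sym.mul_eq_zero_of_inner_eq_zero h.dom.2.2 hm ?_⟩
  rw [← neg_sub, inner_neg_left] at h1
  rw [real_inner_comm]
  linarith

/-- Limits of normalized differences of solutions of perturbed systems vanish. -/
theorem Complementary.limit_direction_eq_zero {z : ZSpace W m n} {X : Sym n}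
    (h : P.Complementary z X) (hs : P.ConjSmooth) (hso : P.DualSOSC z X) (f : Frame (sOf z) X)
    (hblock : ∀ d ∈ P.critCone z X, ∀ i j, f.s i = 0 → f.s j = 0 → f.c (sOf d) i j = 0)
    {ι : Type*} {l : Filter ι} [l.NeBot] {t : ι → ℝ} {p ξ : ι → ESpace W m n} {d : ZSpace W m n}
    (hp : ∀ k, P.PerturbedKKT (p k) (ξ k)) (ht : ∀ k, 0 < t k) (ht0 : Tendsto t l (𝓝 0))
    (hz : Tendsto (fun k => zOf (ξ k)) l (𝓝 z)) (hX : Tendsto (fun k => xOf (ξ k)) l (𝓝 X))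
    (hd : Tendsto (fun k => (t k)⁻¹ • (zOf (ξ k) - z)) l (𝓝 d))
    (hp0 : Tendsto (fun k => (t k)⁻¹ • p k) l (𝓝 0)) : d = 0 := by
  have hpz : Tendsto (fun k => (t k)⁻¹ • zOf (p k)) l (𝓝 0) :=
    (continuous_zOf.tendsto (0 : ESpace W m n)).comp hp0
  have hpx : Tendsto (fun k => (t k)⁻¹ • xOf (p k)) l (𝓝 0) :=
    (continuous_xOf.tendsto (0 : ESpace W m n)).comp hp0
  have huS : Tendsto (fun k => (t k)⁻¹ • sOf (zOf (p k))) l (𝓝 0) :=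
    (continuous_sOf.tendsto (0 : ZSpace W m n)).comp hpz
  have huy : Tendsto (fun k => (t k)⁻¹ • yOf (zOf (p k))) l (𝓝 0) :=
    (continuous_yOf.tendsto (0 : ZSpace W m n)).comp hpz
  have huw : Tendsto (fun k => (t k)⁻¹ • wOf (zOf (p k))) l (𝓝 0) :=
    (continuous_wOf.tendsto (0 : ZSpace W m n)).comp hpz
  have hdS : Tendsto (fun k => (t k)⁻¹ • (sOf (zOf (ξ k)) - sOf z)) l (𝓝 (sOf d)) :=
    (continuous_sOf.tendsto d).comp hd
  have hdy : Tendsto (fun k => (t k)⁻¹ • (yOf (zOf (ξ k)) - yOf z)) l (𝓝 (yOf d)) :=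
    (continuous_yOf.tendsto d).comp hd
  have hdw : Tendsto (fun k => (t k)⁻¹ • (wOf (zOf (ξ k)) - wOf z)) l (𝓝 (wOf d)) :=
    (continuous_wOf.tendsto d).comp hd
  have hA : Continuous P.A := P.A.continuous_of_finiteDimensional
  have hF : Continuous P.F := P.F.continuous_of_finiteDimensional
  have hS0 : Tendsto (fun k => sOf (zOf (p k))) l (𝓝 0) := by
    have := ht0.smul huS
    rw [smul_zero] at this
    exact this.congr fun k => smul_inv_smul₀ (ht k).ne' _
  have hy0 : Tendsto (fun k => yOf (zOf (p k))) l (𝓝 0) := by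
    have := ht0.smul huy
    rw [smul_zero] at this
    exact this.congr fun k => smul_inv_smul₀ (ht k).ne' _
  set X' : ι → Sym n := fun k => xOf (ξ k) - sOf (zOf (p k)) with hX'
  have hX't : Tendsto X' l (𝓝 X) := by simpa using hX.sub hS0
  have hprod : ∀ k, (sOf (zOf (ξ k))).mat * (X' k).mat = 0 := fun k => (hp k).shifted.2
  have hdual : P.dualMap d = 0 := by
    have h1 := (P.continuous_dualMap.tendsto d).comp hd
    have h2 : Tendsto (fun k => -((t k)⁻¹ • xOf (p k))) l (𝓝 0) := by
      simpa using hpx.neg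
    refine tendsto_nhds_unique h1 (h2.congr fun k => ?_)
    rw [Function.comp_apply, dualMap_smul, dualMap_sub, h.eqn, (hp k).eqn, smul_neg]
  have hyt : Tendsto (fun k => yOf (zOf (ξ k))) l (𝓝 (yOf z)) :=
    (continuous_yOf.tendsto z).comp hz
  obtain ⟨K, N, hN⟩ := P.exists_rows
  have hev : ∀ᶠ k in l, 0 ≤ ⟪yOf (zOf (p k)) + P.b - P.A (xOf (ξ k)), yOf d⟫ := by
    have := eventually_inner_normal_nonneg (N := N) (fun k => by
      have := (hp k).dom.1; rw [hN] at this; exact this) hyt hdy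
    filter_upwards [this] with k hk
    refine hk _ fun y' hy' => (hp k).normal_y y' ?_
    rw [hN]; exact hy'
  -- One sign comes from polarity of the reference normal, the other from the limit of the perturbed
  -- normals.
  have hqd : ⟪P.b - P.A X, yOf d⟫ = 0 := by
    refine le_antisymm ?_ ?_
    · have h1 : Tendsto (fun k => ⟪P.b - P.A X, (t k)⁻¹ • (yOf (zOf (ξ k)) - yOf z)⟫) l
          (𝓝 ⟪P.b - P.A X, yOf d⟫) := tendsto_const_nhds.inner hdy
      refine le_of_tendsto h1 (Eventually.of_forall fun k => ?_)
      rw [real_inner_smul_right, inner_sub_right, h.q_orth, sub_zero]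
      exact mul_nonpos_of_nonneg_of_nonpos (inv_nonneg.2 (ht k).le) (h.q_polar _ (hp k).dom.1)
    · have h1 : Tendsto (fun k => yOf (zOf (p k)) + P.b - P.A (xOf (ξ k))) l
          (𝓝 (0 + P.b - P.A X)) :=
        (hy0.add_const _).sub ((hA.tendsto X).comp hX)
      rw [zero_add] at h1
      exact ge_of_tendsto (h1.inner tendsto_const_nhds) hev
  have hcrit : d ∈ P.critCone z X := by
    refine ⟨hdual, ⟨?_, hqd⟩, ?_, ?_⟩
    · exact (isClosed_posTangentConeAt _ _).mem_of_tendsto hdy (Eventually.of_forall fun k =>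
        smul_sub_mem_posTangentConeAt P.isPointedCone_Q.convex h.dom.1 (hp k).dom.1
          (inv_nonneg.2 (ht k).le))
    · exact (isClosed_posTangentConeAt _ _).mem_of_tendsto hdS (Eventually.of_forall fun k =>
        smul_sub_mem_posTangentConeAt (isPointedCone_psdCone n).convex h.dom.2.2 (hp k).dom.2.2
          (inv_nonneg.2 (ht k).le))
    · rw [f.inner_X]
      refine Finset.sum_eq_zero fun i _ => ?_
      by_cases hi : f.x i = 0
      · rw [hi, zero_mul]
      · rw [mul_comm]
        exact f.c_mul_x_eq_zero hdS hX't hprod (f.s_eq_zero_of_x hi) i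
  -- This is where the vanishing kernel block is used.
  have hinner := f.tendsto_inner_multiplier hdS hX't hprod (hblock d hcrit)
  set g' : W := dirDeriv P.gradConj (-wOf z) (-wOf d) with hg'
  have hgrad : Tendsto (fun k => (t k)⁻¹ • (P.gradConj (-wOf (zOf (ξ k))) - P.gradConj (-wOf z)))
      l (𝓝 g') := by
    have h1 : Tendsto (fun k => (t k, -((t k)⁻¹ • (wOf (zOf (ξ k)) - wOf z)))) l
        (𝓝[>] (0 : ℝ) ×ˢ 𝓝 (-wOf d)) :=
      (tendsto_nhdsWithin_iff.2 ⟨ht0, Eventually.of_forall ht⟩).prodMk hdw.neg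
    refine (((hs.2.2 _ h.dom.2.1).tendsto_dirDeriv (-wOf d)).comp h1).congr fun k => ?_
    simp only [Function.comp_apply]
    rw [smul_neg, smul_inv_smul₀ (ht k).ne']
    congr 3
    abel
  have hFX : Tendsto (fun k => P.F ((t k)⁻¹ • (X' k - X))) l (𝓝 g') := by
    have h1 : Tendsto (fun k => (t k)⁻¹ • wOf (zOf (p k)) + (t k)⁻¹ •
        (P.gradConj (-wOf (zOf (ξ k))) - P.gradConj (-wOf z))
        - P.F ((t k)⁻¹ • sOf (zOf (p k)))) l (𝓝 (0 + g' - P.F 0)) :=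
      (huw.add hgrad).sub ((hF.tendsto 0).comp huS)
    rw [map_zero, zero_add, sub_zero] at h1
    refine h1.congr fun k => ?_
    rw [map_smul, map_smul, ← smul_add, ← smul_sub, hX', map_sub, map_sub, ← (hp k).grad, ← h.grad]
    congr 1
    abel
  -- The linearized equation annihilates the pairing of the multiplier quotient with `d`. Its `y`
  -- part contains the normal quotient with a known sign and, besides that, only perturbation terms.
  have hle : ∀ᶠ k in l, -⟪P.F ((t k)⁻¹ • (X' k - X)), wOf d⟫ - ⟪(t k)⁻¹ • (X' k - X), sOf d⟫
      ≤ ⟪(t k)⁻¹ • yOf (zOf (p k)) - P.A ((t k)⁻¹ • sOf (zOf (p k))), yOf d⟫ := by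
    filter_upwards [hev] with k hk
    have h1 := P.inner_dualMap ((t k)⁻¹ • (X' k - X)) d
    rw [hdual, inner_zero_right] at h1
    have h2 : P.A ((t k)⁻¹ • (X' k - X)) = (t k)⁻¹ • yOf (zOf (p k))
        - P.A ((t k)⁻¹ • sOf (zOf (p k)))
        - (t k)⁻¹ • ((yOf (zOf (p k)) + P.b - P.A (xOf (ξ k))) - (P.b - P.A X)) := by
      rw [map_smul, map_smul, ← smul_sub, ← smul_sub, hX', map_sub, map_sub]
      congr 1
      abel
    rw [h2, inner_sub_left, real_inner_smul_left _ _ (t k)⁻¹,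
      inner_sub_left (yOf (zOf (p k)) + P.b - P.A (xOf (ξ k))), hqd, sub_zero] at h1
    have h3 := mul_nonneg (inv_nonneg.2 (ht k).le) hk
    linarith
  have hfin : -⟪g', wOf d⟫ - -⟪f.hess (sOf d), sOf d⟫ ≤ 0 := by
    have hr : Tendsto (fun k => ⟪(t k)⁻¹ • yOf (zOf (p k)) - P.A ((t k)⁻¹ • sOf (zOf (p k))),
        yOf d⟫) l (𝓝 ⟪(0 : Vec m) - P.A 0, yOf d⟫) :=
      (huy.sub ((hA.tendsto 0).comp huS)).inner tendsto_const_nhds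
    rw [map_zero, sub_zero, inner_zero_left] at hr
    exact le_of_tendsto_of_tendsto
      (((hFX.inner tendsto_const_nhds).neg).sub hinner) hr hle
  by_contra hne
  have := hso d (h.critCone_subset hcrit) hne
  rw [f.Upsilon_eq, ← hg', inner_neg_left, real_inner_comm] at this
  linarith

/-- Local upper Lipschitz property of the primal part of the solutions. -/
theorem Complementary.exists_norm_sub_le {z : ZSpace W m n} {X : Sym n}
    (h : P.Complementary z X) (hs : P.ConjSmooth) (hso : P.DualSOSC z X) (f : Frame (sOf z) X)
    (hblock : ∀ d ∈ P.critCone z X, ∀ i j, f.s i = 0 → f.s j = 0 → f.c (sOf d) i j = 0) :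
    ∃ κ : ℝ, 0 < κ ∧ ∃ U ∈ 𝓝 (mkE z X), ∀ p ξ : ESpace W m n, p ∈ P.Tl ξ → ξ ∈ U →
      ‖zOf ξ - z‖ ≤ κ * ‖p‖ := by
  by_contra hcon
  -- Failure for the constant `k + 1` on the ball of radius `1 / (k + 1)` makes the points converge
  -- and the perturbations negligible against `‖zOf (ξ k) - z‖`.
  have hk : ∀ k : ℕ, ∃ p ξ : ESpace W m n, p ∈ P.Tl ξ ∧
      ξ ∈ Metric.ball (mkE z X) (1 / ((k : ℝ) + 1)) ∧ ((k : ℝ) + 1) * ‖p‖ < ‖zOf ξ - z‖ := by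
    intro k
    by_contra hc
    refine hcon ⟨(k : ℝ) + 1, by positivity, Metric.ball (mkE z X) (1 / ((k : ℝ) + 1)),
      Metric.ball_mem_nhds _ (by positivity),
      fun p ξ hp hξ => ?_⟩
    by_contra hlt
    exact hc ⟨p, ξ, hp, hξ, not_le.1 hlt⟩
  choose p ξ hp hξ hlt using hk
  have hξt : Tendsto ξ atTop (𝓝 (mkE z X)) := by
    rw [tendsto_iff_dist_tendsto_zero]
    exact squeeze_zero (fun _ => dist_nonneg) (fun k => (Metric.mem_ball.1 (hξ k)).le)
      tendsto_one_div_add_atTop_nhds_zero_nat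
  set t : ℕ → ℝ := fun k => ‖zOf (ξ k) - z‖ with ht
  have htpos : ∀ k, 0 < t k := fun k =>
    lt_of_le_of_lt (mul_nonneg (by positivity : (0 : ℝ) ≤ (k : ℝ) + 1) (norm_nonneg (p k))) (hlt k)
  have hzt : Tendsto (fun k => zOf (ξ k)) atTop (𝓝 z) :=
    (continuous_zOf.tendsto (mkE z X)).comp hξt
  have hXt : Tendsto (fun k => xOf (ξ k)) atTop (𝓝 X) :=
    (continuous_xOf.tendsto (mkE z X)).comp hξt
  have ht0 : Tendsto t atTop (𝓝 0) := tendsto_iff_norm_sub_tendsto_zero.1 hzt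
  have hp0 : Tendsto (fun k => (t k)⁻¹ • p k) atTop (𝓝 0) := by
    rw [tendsto_zero_iff_norm_tendsto_zero]
    refine squeeze_zero (fun _ => norm_nonneg _) (fun k => ?_)
      tendsto_one_div_add_atTop_nhds_zero_nat
    rw [norm_smul, norm_inv, Real.norm_of_nonneg (htpos k).le, inv_mul_le_iff₀ (htpos k),
      mul_one_div, le_div_iff₀ (by positivity), mul_comm]
    exact (hlt k).le
  have hnorm : ∀ k, ‖(t k)⁻¹ • (zOf (ξ k) - z)‖ = 1 := by
    intro k
    rw [norm_smul, norm_inv, Real.norm_of_nonneg (htpos k).le]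
    exact inv_mul_cancel₀ (htpos k).ne'
  have hcomp : IsCompact (Metric.sphere (0 : ZSpace W m n) 1) := isCompact_sphere _ _
  obtain ⟨d, hd, φ, hφ, hφd⟩ := hcomp.tendsto_subseq (x := fun k => (t k)⁻¹ • (zOf (ξ k) - z))
    fun k => by rw [mem_sphere_zero_iff_norm]; exact hnorm k
  have hφt := hφ.tendsto_atTop
  have hd0 : d = 0 := h.limit_direction_eq_zero hs hso f hblock (l := atTop)
    (t := t ∘ φ) (p := p ∘ φ) (ξ := ξ ∘ φ) (fun k => perturbedKKT_of_mem_Tl P hs h.dom (hp (φ k)))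
    (fun k => htpos _) (ht0.comp hφt) (hzt.comp hφt) (hXt.comp hφt) hφd (hp0.comp hφt)
  rw [hd0] at hd
  simp at hd

end ConvexSDP

/-! ### The kernel block under strict complementarity -/

namespace Frame

variable {n : ℕ} {S X : Sym n} (f : Frame S X)

theorem norm_le {D : Sym n} {C : ℝ} (hC : 0 ≤ C) (h : ∀ i j, |f.c D i j| ≤ C) : ‖D‖ ≤ n * C := by
  refine abs_le_of_sq_le_sq' ?_ (by positivity) |>.2
  rw [← real_inner_self_eq_norm_sq, f.inner_eq]
  calc ∑ i, ∑ j, f.c D i j * f.c D i j ≤ ∑ _i : Fin n, ∑ _j : Fin n, C * C :=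
        Finset.sum_le_sum fun i _ => Finset.sum_le_sum fun j _ => by
          rw [← abs_mul_abs_self (f.c D i j)]
          exact mul_self_le_mul_self (abs_nonneg _) (h i j)
    _ = (n * C) ^ 2 := by simp; ring

open Classical in
/-- The orthogonal projection to the matrices supported on the kernel of `S`. -/
noncomputable def kerPart (D : Sym n) : Sym n := f.mask D fun i => f.s i = 0

theorem kerPart_mem_spanK (D : Sym n) : f.kerPart D ∈ f.spanK := fun i j hi => by
  change f.c (f.kerPart D) i j = 0
  rw [kerPart, c_mask, if_neg fun h => hi h.1]

theorem kerPart_mem_psdCone {D : Sym n} (h : D ∈ psdCone n) : f.kerPart D ∈ psdCone n :=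
  f.mask_mem _ _ fun v _ => (Sym.mem_psdCone_iff_forall f.orth).1 h v

/-- Distance to the kernel block of a matrix complementary to a matrix near `S`. -/
theorem norm_kerPart_sub_le {S' X' : Sym n} (h0 : S'.mat * X'.mat = 0) :
    ‖f.kerPart X' - X'‖ ≤ n * ((∑ i, (f.s i)⁻¹) * (n * (‖S' - S‖ * ‖X'‖))) := by
  have hinv : ∀ i, 0 ≤ (f.s i)⁻¹ := fun i => inv_nonneg.2 (f.s_nonneg i)
  have hrow : ∀ i j, f.s i ≠ 0 →
      |f.c X' i j| ≤ (∑ i, (f.s i)⁻¹) * (n * (‖S' - S‖ * ‖X'‖)) := by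
    intro i j hi
    have h2 := congrFun (congrFun (f.c_mul_eq_zero h0) i) j
    rw [Matrix.mul_apply, Matrix.zero_apply] at h2
    have h3 : ∑ r, f.c S i r * f.c X' r j = f.s i * f.c X' i j := by
      rw [f.c_S, ← Matrix.mul_apply, diagonal_mul]
    -- As `S' X' = 0`, the rows of `X'` with `s i ≠ 0` are controlled by `S' - S`.
    have h4 : f.s i * f.c X' i j = -∑ r, f.c (S' - S) i r * f.c X' r j := by
      rw [← h3, ← sub_zero (∑ r, f.c S i r * f.c X' r j), ← h2, ← Finset.sum_sub_distrib,
        ← Finset.sum_neg_distrib]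
      refine Finset.sum_congr rfl fun r _ => ?_
      rw [c_sub, Matrix.sub_apply]; ring
    have h5 : |∑ r, f.c (S' - S) i r * f.c X' r j| ≤ n * (‖S' - S‖ * ‖X'‖) := by
      refine (Finset.abs_sum_le_sum_abs _ _).trans ?_
      calc ∑ r, |f.c (S' - S) i r * f.c X' r j| ≤ ∑ _r : Fin n, ‖S' - S‖ * ‖X'‖ :=
            Finset.sum_le_sum fun r _ => by
              rw [abs_mul]
              exact mul_le_mul (Sym.abs_coord_le f.orth _ _ _) (Sym.abs_coord_le f.orth _ _ _)
                (abs_nonneg _) (norm_nonneg _)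
        _ = n * (‖S' - S‖ * ‖X'‖) := by simp
    have h6 : f.c X' i j = (f.s i)⁻¹ * -∑ r, f.c (S' - S) i r * f.c X' r j := by
      rw [← h4, inv_mul_cancel_left₀ hi]
    rw [h6, abs_mul, abs_neg, abs_of_nonneg (hinv i)]
    exact mul_le_mul (Finset.single_le_sum (f := fun i => (f.s i)⁻¹) (fun i _ => hinv i)
      (Finset.mem_univ i)) h5 (abs_nonneg _) (Finset.sum_nonneg fun i _ => hinv i)
  have hC : 0 ≤ (∑ i, (f.s i)⁻¹) * (n * (‖S' - S‖ * ‖X'‖)) :=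
    mul_nonneg (Finset.sum_nonneg fun i _ => hinv i) (by positivity)
  refine f.norm_le hC fun i j => ?_
  rw [c_sub, Matrix.sub_apply, kerPart, c_mask]
  by_cases hi : f.s i = 0
  · by_cases hj : f.s j = 0
    · rw [if_pos ⟨hi, hj⟩, sub_self, abs_zero]; exact hC
    · rw [if_neg fun h => hj h.2, zero_sub, abs_neg, f.c_symm]
      exact hrow j i hj
  · rw [if_neg fun h => hi h.1, zero_sub, abs_neg]
    exact hrow i j hi

theorem mem_spanK_of_mul_eq_zero {Y : Sym n} (h : S.mat * Y.mat = 0) : Y ∈ f.spanK := by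
  intro i j hi
  have h2 := congrFun (congrFun (f.c_mul_eq_zero h) i) j
  rw [f.c_S, diagonal_mul, Matrix.zero_apply] at h2
  exact (mul_eq_zero.1 h2).resolve_left hi

/-- Strict complementarity makes the quadratic form definite on the kernel of `S`. -/
theorem eq_zero_of_rank_add_rank {Y : Sym n} (hY : Y ∈ psdCone n) (h : S.mat * Y.mat = 0)
    (hr : Y.mat.rank + S.mat.rank = n) {v : Fin n → ℝ} (hv : ∀ i, f.s i ≠ 0 → v i = 0)
    (h0 : v ⬝ᵥ f.c Y *ᵥ v = 0) : v = 0 := by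
  have hc : f.c Y *ᵥ v = 0 := by
    have := (Sym.mem_psdCone_iff_coord f.orth).1 hY
    exact (this.dotProduct_mulVec_zero_iff v).1 (by simpa using h0)
  have hUU : f.U * f.Uᵀ = 1 := mul_eq_one_comm.1 f.orth
  have hker : Y.mat *ᵥ (f.U *ᵥ v) = 0 := by
    rw [f.mat_eq Y, mulVec_mulVec, Matrix.mul_assoc, f.orth, Matrix.mul_one, ← mulVec_mulVec, hc,
      mulVec_zero]
  have hYS : Y.mat * S.mat = 0 := by
    have h1 : f.c Y * f.c S = 0 := by
      ext i j
      have h2 := congrFun (congrFun (f.c_mul_eq_zero h) j) i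
      rw [f.c_S, diagonal_mul, Matrix.zero_apply] at h2
      rw [f.c_S, mul_diagonal, Matrix.zero_apply, mul_comm, f.c_symm, h2]
    rw [f.mat_eq Y, f.mat_eq S]
    calc f.U * f.c Y * f.Uᵀ * (f.U * f.c S * f.Uᵀ)
        = f.U * (f.c Y * (f.Uᵀ * f.U) * f.c S) * f.Uᵀ := by simp only [Matrix.mul_assoc]
      _ = 0 := by rw [f.orth, Matrix.mul_one, h1, Matrix.mul_zero, Matrix.zero_mul]
  have hle : LinearMap.range S.mat.mulVecLin ≤ LinearMap.ker Y.mat.mulVecLin := by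
    rintro _ ⟨u, rfl⟩
    rw [LinearMap.mem_ker, mulVecLin_apply, mulVecLin_apply, mulVec_mulVec, hYS, zero_mulVec]
  -- The rank condition turns the inclusion of the range of `S` in the kernel of `Y` into equality.
  -- A null vector supported on the kernel coordinates then lies in the range of `S`, hence is zero.
  have hfin : Module.finrank ℝ (LinearMap.range S.mat.mulVecLin)
      = Module.finrank ℝ (LinearMap.ker Y.mat.mulVecLin) := by
    have h1 := LinearMap.finrank_range_add_finrank_ker Y.mat.mulVecLin
    rw [Module.finrank_fin_fun] at h1
    change Y.mat.rank + _ = n at h1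
    change S.mat.rank = _
    omega
  have heq := Submodule.eq_of_le_of_finrank_eq hle hfin
  have hmem : f.U *ᵥ v ∈ LinearMap.range S.mat.mulVecLin := by
    rw [heq]; exact hker
  obtain ⟨u, hu⟩ := hmem
  rw [mulVecLin_apply] at hu
  have hv' : v = diagonal f.s *ᵥ (f.Uᵀ *ᵥ u) := by
    calc v = (f.Uᵀ * f.U) *ᵥ v := by rw [f.orth, one_mulVec]
      _ = f.Uᵀ *ᵥ (S.mat *ᵥ u) := by rw [hu, mulVec_mulVec]
      _ = (f.Uᵀ * f.U * diagonal f.s) *ᵥ (f.Uᵀ *ᵥ u) := by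
          rw [f.mat_S]
          simp only [mulVec_mulVec, Matrix.mul_assoc]
      _ = _ := by rw [f.orth, Matrix.one_mul]
  funext i
  by_cases hi : f.s i = 0
  · rw [hv', mulVec_diagonal, hi, zero_mul]; rfl
  · exact hv i hi

/-- Definiteness on the kernel becomes uniform by compactness. The sphere is taken in the sup norm,
whence the factor `n + 1` in passing to the sum of squares. -/
theorem exists_quad_lower_bound {Y : Sym n} (hY : Y ∈ psdCone n) (h : S.mat * Y.mat = 0)
    (hr : Y.mat.rank + S.mat.rank = n) : ∃ μ : ℝ, 0 < μ ∧ ∀ v : Fin n → ℝ,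
      (∀ i, f.s i ≠ 0 → v i = 0) → μ * ∑ i, v i * v i ≤ v ⬝ᵥ f.c Y *ᵥ v := by
  set K : Set (Fin n → ℝ) := Metric.sphere 0 1 ∩ {v | ∀ i, f.s i ≠ 0 → v i = 0} with hK
  have hKc : IsCompact K := by
    refine (isCompact_sphere _ _).inter_right ?_
    simp only [ofPred_forall]
    exact isClosed_iInter fun i => isClosed_iInter fun _ =>
      isClosed_eq (continuous_apply i) continuous_const
  have hcont : Continuous fun v : Fin n → ℝ => v ⬝ᵥ f.c Y *ᵥ v := by
    simp only [dotProduct_mulVec_eq_sum]; fun_prop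
  obtain ⟨m, hm, hmK⟩ : ∃ m : ℝ, 0 < m ∧ ∀ v ∈ K, m ≤ v ⬝ᵥ f.c Y *ᵥ v := by
    rcases K.eq_empty_or_nonempty with he | hne
    · exact ⟨1, one_pos, fun v hv => by rw [he] at hv; exact hv.elim⟩
    obtain ⟨v, hv, hmin⟩ := hKc.exists_isMinOn hne hcont.continuousOn
    refine ⟨_, lt_of_le_of_ne ((Sym.mem_psdCone_iff_forall f.orth).1 hY v) fun h0 => ?_,
      fun w hw => hmin hw⟩
    have := f.eq_zero_of_rank_add_rank hY h hr hv.2 h0.symm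
    have h1 := hv.1
    rw [this] at h1
    simp at h1
  refine ⟨m / (n + 1), by positivity, fun v hv => ?_⟩
  rcases eq_or_ne v 0 with rfl | hv0
  · simp
  have hpos : 0 < ‖v‖ := norm_pos_iff.2 hv0
  have h1 := hmK (‖v‖⁻¹ • v) ⟨by
    rw [mem_sphere_zero_iff_norm, norm_smul, norm_inv, norm_norm, inv_mul_cancel₀ hpos.ne'],
    fun i hi => by rw [Pi.smul_apply, hv i hi, smul_zero]⟩
  rw [mulVec_smul, dotProduct_smul, smul_dotProduct, smul_eq_mul, smul_eq_mul, ← mul_assoc,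
    ← mul_inv, inv_mul_eq_div, le_div_iff₀ (by positivity)] at h1
  have h2 : ∑ i, v i * v i ≤ (n + 1) * (‖v‖ * ‖v‖) := by
    calc ∑ i, v i * v i ≤ ∑ _i : Fin n, ‖v‖ * ‖v‖ := Finset.sum_le_sum fun i _ => by
          rw [← abs_mul_abs_self (v i)]
          exact mul_self_le_mul_self (abs_nonneg _) (norm_le_pi_norm v i)
      _ = n * (‖v‖ * ‖v‖) := by simp
      _ ≤ _ := by nlinarith [mul_self_nonneg ‖v‖]
  calc m / (n + 1) * ∑ i, v i * v i ≤ m / (n + 1) * ((n + 1) * (‖v‖ * ‖v‖)) :=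
        mul_le_mul_of_nonneg_left h2 (by positivity)
    _ = m * (‖v‖ * ‖v‖) := by field_simp
    _ ≤ _ := h1

theorem mem_psdCone_of_mem_spanK {D : Sym n} (hD : D ∈ f.spanK)
    (h : ∀ v : Fin n → ℝ, (∀ i, f.s i ≠ 0 → v i = 0) → 0 ≤ v ⬝ᵥ f.c D *ᵥ v) :
    D ∈ psdCone n := by
  have : D = f.kerPart D := by
    refine Sym.coord_injective f.orth ?_
    ext i j
    change f.c D i j = f.c (f.kerPart D) i j
    rw [kerPart, c_mask]
    by_cases hi : f.s i = 0
    · by_cases hj : f.s j = 0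
      · rw [if_pos ⟨hi, hj⟩]
      · rw [if_neg fun h => hj h.2, f.c_symm, hD j i hj]
    · rw [if_neg fun h => hi h.1, hD i j hi]
  rw [this]
  exact f.mask_mem _ _ h

/-- Moving towards a matrix that is definite on the kernel of `S` restores semidefiniteness. -/
theorem exists_psd_combination {Y Z D : Sym n} {μ : ℝ} (hμ : 0 < μ) (hY : Y ∈ f.spanK)
    (hYq : ∀ v : Fin n → ℝ, (∀ i, f.s i ≠ 0 → v i = 0) →
      μ * ∑ i, v i * v i ≤ v ⬝ᵥ f.c Y *ᵥ v)
    (hZ : Z ∈ f.spanK) (hZp : Z ∈ psdCone n) (hD : D ∈ f.spanK) :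
    ∃ θ : ℝ, 0 ≤ θ ∧ θ ≤ n * ‖D‖ / μ ∧ θ ≤ 1 ∧ (1 - θ) • (Z + D) + θ • Y ∈ psdCone n := by
  set a : ℝ := n * ‖D‖ with ha
  have ha0 : 0 ≤ a := by positivity
  have hpos : 0 < a + μ := by linarith
  -- Up to the factor `1 / (a + μ)` the form is μ(Z + D) + aY. The loss from `D` is at most μ a
  -- |v|², and `Y` supplies at least that.
  refine ⟨a / (a + μ), by positivity, div_le_div_of_nonneg_left ha0 hμ (by linarith),
    (div_le_one hpos).2 (by linarith), ?_⟩
  refine f.mem_psdCone_of_mem_spanK (f.spanK.add_mem (f.spanK.smul_mem _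
    (f.spanK.add_mem hZ hD)) (f.spanK.smul_mem _ hY)) fun v hv => ?_
  have e1 : v ⬝ᵥ f.c ((1 - a / (a + μ)) • (Z + D) + (a / (a + μ)) • Y) *ᵥ v
      = (1 - a / (a + μ)) * (v ⬝ᵥ f.c Z *ᵥ v + v ⬝ᵥ f.c D *ᵥ v)
        + a / (a + μ) * (v ⬝ᵥ f.c Y *ᵥ v) := by
    rw [c_add, c_smul, c_smul, c_add, add_mulVec, smul_mulVec, smul_mulVec, add_mulVec,
      dotProduct_add, dotProduct_smul, dotProduct_smul, dotProduct_add]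
    rfl
  have e2 : 1 - a / (a + μ) = μ / (a + μ) := by field_simp; ring
  rw [e1, e2]
  have h1 := (Sym.mem_psdCone_iff_forall f.orth).1 hZp v
  have h2 := (abs_le.1 (f.abs_quad_le D v)).1
  have h3 := hYq v hv
  have e3 : μ / (a + μ) * (v ⬝ᵥ f.c Z *ᵥ v + v ⬝ᵥ f.c D *ᵥ v)
        + a / (a + μ) * (v ⬝ᵥ f.c Y *ᵥ v)
      = (a + μ)⁻¹ * (μ * (v ⬝ᵥ f.c Z *ᵥ v + v ⬝ᵥ f.c D *ᵥ v) + a * (v ⬝ᵥ f.c Y *ᵥ v)) := by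
    ring
  rw [e3]
  refine mul_nonneg (inv_nonneg.2 hpos.le) ?_
  have h4 := mul_le_mul_of_nonneg_left h3 ha0
  have h5 := mul_le_mul_of_nonneg_left h2 hμ.le
  have h6 := mul_nonneg hμ.le h1
  nlinarith

end Frame

/-- Farkas' lemma. -/
theorem exists_nonneg_combination {E : Type*} [NormedAddCommGroup E] [InnerProductSpace ℝ E]
    [FiniteDimensional ℝ E] {k : ℕ} {N : Fin k → E} {v : E}
    (h : ∀ y, (∀ j, ⟪N j, y⟫ ≤ 0) → ⟪v, y⟫ ≤ 0) :
    ∃ l : Fin k → ℝ, (∀ j, 0 ≤ l j) ∧ v = ∑ j, l j • N j := by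
  set T' : (Fin k → ℝ) →ₗ[ℝ] E := Fintype.linearCombination ℝ N with hT'
  -- Finitely generated cones are closed: the orthant image without effective free variables.
  have hcl := isClosed_image_orthant (0 : E →ₗ[ℝ] E) T'
  set R := {y | ∃ (e : E) (l : Fin k → ℝ), (∀ i, 0 ≤ l i) ∧ y = (0 : E →ₗ[ℝ] E) e + T' l} with hR
  have hRc : IsPointedCone R := by
    refine ⟨⟨0, 0, fun i => le_rfl, by simp⟩, ?_, ?_⟩
    · rintro _ _ ⟨e, l, hl, rfl⟩ ⟨e', l', hl', rfl⟩
      exact ⟨0, l + l', fun i => add_nonneg (hl i) (hl' i), by simp⟩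
    · rintro t _ ht ⟨e, l, hl, rfl⟩
      exact ⟨0, t • l, fun i => mul_nonneg ht (hl i), by simp⟩
  suffices hv : v ∈ R by
    obtain ⟨e, l, hl, rfl⟩ := hv
    exact ⟨l, hl, by simp [hT', Fintype.linearCombination_apply]⟩
  by_contra hn
  rw [← hcl.closure_eq] at hn
  obtain ⟨η, h1, h2⟩ := hRc.exists_separating hn
  have h3 := h (-η) fun j => by
    have := h1 (N j) ⟨0, Pi.single j 1, fun i => by
      by_cases hi : i = j
      · rw [hi]; simp
      · simp [hi], by simp [hT', Fintype.linearCombination_apply_single]⟩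
    rw [inner_neg_right, real_inner_comm]; linarith
  rw [inner_neg_right, real_inner_comm] at h3
  linarith

/-- Conformal correction within a subspace. -/
theorem exists_conformal_submodule {E ι Y : Type*} [NormedAddCommGroup E] [NormedSpace ℝ E]
    [FiniteDimensional ℝ E] [Fintype ι] [NormedAddCommGroup Y]
    [NormedSpace ℝ Y] (K : Submodule ℝ E) (T : E →ₗ[ℝ] Y) (T' : (ι → ℝ) →ₗ[ℝ] Y) :
    ∃ c : ℝ, 0 ≤ c ∧ ∀ e ∈ K, ∀ δ : ι → ℝ, ∃ e' ∈ K, ∃ v : ι → ℝ, Conformal v δ ∧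
      T e' + T' v = T e + T' δ ∧ ‖e'‖ ≤ c * ‖T e + T' δ‖ := by
  obtain ⟨c, hc, H⟩ := exists_conformal_prod (T ∘ₗ K.subtype) T'
  refine ⟨c, hc, fun e he δ => ?_⟩
  obtain ⟨e', v, hv, h1, h2, -⟩ := H ⟨e, he⟩ δ
  exact ⟨e'.1, e'.2, v, hv, h1, h2⟩

/-! ### Nearby multipliers and metric subregularity -/

namespace ConvexSDP

variable {W : Type*} [NormedAddCommGroup W] [InnerProductSpace ℝ W] [FiniteDimensional ℝ W]
  {m n : ℕ} {P : ConvexSDP W m n}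

/-- In the Farkas representation orthogonality to `y` is a vanishing sum of nonpositive terms, so
coefficients of inactive rows are zero. -/
theorem exists_active_combination {k : ℕ} {N : Fin k → Vec m} (hN : P.Q = {y | ∀ i, ⟪N i, y⟫ ≤ 0})
    {v y : Vec m} (hy : y ∈ P.Q) (hv : v ∈ polarCone P.Q) (hvy : ⟪v, y⟫ = 0) :
    ∃ l : Fin k → ℝ, (∀ j, 0 ≤ l j) ∧ v = ∑ j, l j • N j ∧ ∀ j, ⟪N j, y⟫ ≠ 0 → l j = 0 := by
  rw [hN] at hy
  obtain ⟨l, hl, rfl⟩ := exists_nonneg_combination (N := N) (v := v) fun y' hy' =>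
    hv y' (by rw [hN]; exact hy')
  refine ⟨l, hl, rfl, fun j hj => ?_⟩
  rw [sum_inner] at hvy
  have h1 := (Finset.sum_eq_zero_iff_of_nonpos fun j _ => by
    rw [real_inner_smul_left]
    exact mul_nonpos_of_nonneg_of_nonpos (hl j) (hy j)).1 hvy j (Finset.mem_univ j)
  rw [real_inner_smul_left] at h1
  exact (mul_eq_zero.1 h1).resolve_right hj

theorem combination_mem {k : ℕ} {N : Fin k → Vec m} (hN : P.Q = {y | ∀ i, ⟪N i, y⟫ ≤ 0})
    {y : Vec m} {l : Fin k → ℝ} (hl : ∀ j, 0 ≤ l j) (h0 : ∀ j, ⟪N j, y⟫ ≠ 0 → l j = 0) :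
    ∑ j, l j • N j ∈ polarCone P.Q ∧ ⟪∑ j, l j • N j, y⟫ = 0 := by
  refine ⟨fun d hd => ?_, ?_⟩
  · rw [hN] at hd
    rw [sum_inner]
    refine Finset.sum_nonpos fun j _ => ?_
    rw [real_inner_smul_left]
    exact mul_nonpos_of_nonneg_of_nonpos (hl j) (hd j)
  · rw [sum_inner]
    refine Finset.sum_eq_zero fun j _ => ?_
    rw [real_inner_smul_left]
    by_cases hj : ⟪N j, y⟫ = 0
    · rw [hj, mul_zero]
    · rw [h0 j hj, zero_mul]

/-- Error bound for the linear equations in the multiplier, preserving signs of coefficients. -/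
theorem exists_linear_correction (P : ConvexSDP W m n) {S X : Sym n} (f : Frame S X) {k : ℕ}
    (N : Fin k → Vec m) :
    ∃ c : ℝ, 0 ≤ c ∧ ∀ Y ∈ f.spanK, ∀ Z ∈ f.spanK, ∀ l l' : Fin k → ℝ,
      (∀ j, 0 ≤ l j) → (∀ j, 0 ≤ l' j) → ∃ D ∈ f.spanK, ∃ r : Fin k → ℝ, (∀ j, 0 ≤ r j) ∧
        (∀ j, l j = 0 → l' j = 0 → r j = 0) ∧ P.F (Z + D) = P.F Y ∧
        P.A (Z + D) + ∑ j, r j • N j = P.A Y + ∑ j, l' j • N j ∧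
        ‖D‖ ≤ c * (‖P.F (Y - Z)‖ + ‖P.A (Y - Z) + (∑ j, l' j • N j - ∑ j, l j • N j)‖) := by
  let T : Sym n →ₗ[ℝ] W × Vec m := P.F.prod P.A
  let T' : (Fin k → ℝ) →ₗ[ℝ] W × Vec m :=
    LinearMap.inr ℝ W (Vec m) ∘ₗ Fintype.linearCombination ℝ N
  obtain ⟨c, hc, H⟩ := exists_conformal_submodule f.spanK T T'
  refine ⟨c, hc, fun Y hY Z hZ l l' hl hl' => ?_⟩
  -- The known solution `(Y, l')` shows the residual of `(Z, l)` to be correctable. Conformality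
  -- toward `l' - l` keeps the corrected coefficients nonnegative and supported where `l` or `l'` is
  -- nonzero.
  obtain ⟨e, heK, v, hv, heq, he⟩ := H (Y - Z) (f.spanK.sub_mem hY hZ) (l' - l)
  have hT : ∀ e, T e = (P.F e, P.A e) := fun _ => rfl
  have hT' : ∀ v, T' v = (0, ∑ j, v j • N j) := fun v => rfl
  have hsub : ∑ j, (l' - l) j • N j = ∑ j, l' j • N j - ∑ j, l j • N j := by
    rw [← Finset.sum_sub_distrib]
    exact Finset.sum_congr rfl fun j _ => sub_smul _ _ _
  rw [hT, hT, hT', hT', hsub, Prod.mk_add_mk, Prod.mk_add_mk, Prod.mk.injEq, add_zero,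
    add_zero] at heq
  rw [hT, hT', hsub, Prod.mk_add_mk, add_zero] at he
  obtain ⟨h1, h2⟩ := heq
  refine ⟨e, heK, l + v, fun j => hv.add_nonneg (hl j) (hl' j), fun j hj hj' => ?_, ?_, ?_,
    he.trans (mul_le_mul_of_nonneg_left ?_ hc)⟩
  · have := hv j
    rw [Pi.sub_apply, hj, hj', sub_zero, uIcc_self] at this
    rw [Pi.add_apply, hj, this, add_zero]
  · rw [map_add, h1, map_sub]; abel
  · have h3 : ∑ j, (l + v) j • N j = ∑ j, l j • N j + ∑ j, v j • N j := by
      rw [← Finset.sum_add_distrib]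
      exact Finset.sum_congr rfl fun j _ => add_smul _ _ _
    calc P.A (Z + e) + ∑ j, (l + v) j • N j
        = P.A Z + ∑ j, l j • N j + (P.A e + ∑ j, v j • N j) := by rw [map_add, h3]; abel
      _ = _ := by rw [h2, map_sub]; abel
  · rw [Prod.norm_def]
    exact max_le (le_add_of_nonneg_right (norm_nonneg _)) (le_add_of_nonneg_left (norm_nonneg _))

theorem mem_multipliers {z : ZSpace W m n} (hz : P.Dom z) {Y Y' : Sym n} (hY : Y ∈ P.multipliers z)
    (hF : P.F Y' = P.F Y) (hY' : Y' ∈ psdCone n) (hS : ⟪sOf z, Y'⟫ = 0)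
    (hq : P.b - P.A Y' ∈ polarCone P.Q) (hqy : ⟪P.b - P.A Y', yOf z⟫ = 0) :
    Y' ∈ P.multipliers z := by
  obtain ⟨-, h2, -, h4⟩ := hY
  refine ⟨⟨hz.1, fun d hd => ?_⟩, hF ▸ h2, ⟨hz.2.2, fun D hD => ?_⟩, h4⟩
  · rw [inner_sub_right, hqy, sub_zero]; exact hq d hd
  · rw [inner_neg_left, inner_sub_right, real_inner_comm, real_inner_comm (sOf z), hS, sub_zero,
      real_inner_comm]
    exact neg_nonpos.2 (Sym.inner_nonneg hY' hD)

theorem exists_norm_apply_le {E F : Type*} [NormedAddCommGroup E] [NormedSpace ℝ E]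
    [FiniteDimensional ℝ E] [NormedAddCommGroup F] [NormedSpace ℝ F] (T : E →ₗ[ℝ] F) :
    ∃ c : ℝ, 0 ≤ c ∧ ∀ x, ‖T x‖ ≤ c * ‖x‖ :=
  ⟨‖LinearMap.toContinuousLinearMap T‖, norm_nonneg _,
    (LinearMap.toContinuousLinearMap T).le_opNorm⟩

/-- Under strict complementarity, multipliers of perturbed problems are close to multipliers. -/
theorem Complementary.exists_multiplier_near {z : ZSpace W m n} {X : Sym n}
    (h : P.Complementary z X) (hs : P.ConjSmooth) (f : Frame (sOf z) X) {κ : ℝ} (hκ : 0 ≤ κ)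
    {L : ℝ≥0} {t : Set W} (ht : t ∈ 𝓝 (-wOf z)) (hL : LipschitzOnWith L P.gradConj t)
    {Y : Sym n} (hY : Y ∈ P.multipliers z) (hr : Y.mat.rank + (sOf z).mat.rank = n) :
    ∃ C : ℝ, 0 ≤ C ∧ ∀ᶠ ξ in 𝓝 (mkE z X), ∀ p, P.PerturbedKKT p ξ → ‖zOf ξ - z‖ ≤ κ * ‖p‖ →
      ‖p‖ ≤ 1 → ∃ X2 ∈ P.multipliers z, ‖xOf ξ - X2‖ ≤ C * ‖p‖ := by
  have hYc := P.complementary_of_mem hs h.dom hY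
  obtain ⟨k, N, hN⟩ := P.exists_rows
  have hSY : (sOf z).mat * Y.mat = 0 :=
    Sym.mul_eq_zero_of_inner_eq_zero h.dom.2.2 hYc.X_mem hYc.orth
  have hYK := f.mem_spanK_of_mul_eq_zero hSY
  obtain ⟨μ, hμ, hYq⟩ := f.exists_quad_lower_bound hYc.X_mem hSY hr
  obtain ⟨l', hl', hlY, hl0⟩ := exists_active_combination hN h.dom.1 hYc.q_polar hYc.q_orth
  obtain ⟨c, hc, hcorr⟩ := P.exists_linear_correction f N
  obtain ⟨cF, hcF, hF⟩ := exists_norm_apply_le P.F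
  obtain ⟨cA, hcA, hA⟩ := exists_norm_apply_le P.A
  set σ : ℝ := ∑ i, (f.s i)⁻¹ with hσ
  have hσ0 : 0 ≤ σ := Finset.sum_nonneg fun i _ => inv_nonneg.2 (f.s_nonneg i)
  -- Up to the factor ‖p‖, `c2` bounds the cut to the kernel block and `c3` the linear correction
  -- `D`; `M` bounds the distance from `Z + D` to `Y` when ‖p‖ ≤ 1.
  set c2 : ℝ := n * (σ * (n * (κ * (‖X‖ + 2)))) + 1 with hc2
  have hc20 : 0 ≤ c2 := by positivity
  set c3 : ℝ := c * ((L * κ + 1 + cF * c2) + (1 + cA * c2)) with hc3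
  have hc30 : 0 ≤ c3 := by positivity
  set M : ℝ := ‖Y‖ + (‖X‖ + 1 + c2) + c3 with hM
  have hM0 : 0 ≤ M := by positivity
  refine ⟨c2 + c3 + n * c3 / μ * M, by positivity, ?_⟩
  have hzt : Tendsto (fun ξ : ESpace W m n => zOf ξ) (𝓝 (mkE z X)) (𝓝 z) :=
    continuous_zOf.tendsto (mkE z X)
  have ev1 : ∀ᶠ ξ in 𝓝 (mkE z X), ‖xOf ξ - X‖ < 1 := by
    have h1 : Tendsto (fun ξ : ESpace W m n => xOf ξ) (𝓝 (mkE z X)) (𝓝 X) :=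
      continuous_xOf.tendsto (mkE z X)
    exact (tendsto_iff_norm_sub_tendsto_zero.1 h1).eventually (gt_mem_nhds one_pos)
  have ev2 : ∀ᶠ ξ in 𝓝 (mkE z X), -wOf (zOf ξ) ∈ t :=
    ((continuous_wOf.tendsto z).comp hzt).neg ht
  have hyt : Tendsto (fun ξ : ESpace W m n => yOf (zOf ξ)) (𝓝 (mkE z X)) (𝓝 (yOf z)) :=
    (continuous_yOf.tendsto z).comp hzt
  have hyQ : ∀ j, ⟪N j, yOf z⟫ ≤ 0 := by
    have := h.dom.1; rw [hN] at this; exact this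
  -- The factor 1/2 ensures that half of the reference `y` can be subtracted from a nearby `y`
  -- within `Q`.
  have ev3 : ∀ᶠ ξ in 𝓝 (mkE z X), ∀ j, ⟪N j, yOf z⟫ = 0 ∨
      ⟪N j, yOf (zOf ξ)⟫ ≤ (1 / 2) * ⟪N j, yOf z⟫ := by
    rw [Filter.eventually_all]
    intro j
    by_cases hj : ⟪N j, yOf z⟫ = 0
    · exact Eventually.of_forall fun _ => Or.inl hj
    · have hlt : ⟪N j, yOf z⟫ < (1 / 2) * ⟪N j, yOf z⟫ := by
        have := lt_of_le_of_ne (hyQ j) hj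
        linarith
      have h1 : Tendsto (fun ξ : ESpace W m n => ⟪N j, yOf (zOf ξ)⟫) (𝓝 (mkE z X))
          (𝓝 ⟪N j, yOf z⟫) := tendsto_const_nhds.inner hyt
      exact (h1.eventually (gt_mem_nhds hlt)).mono fun _ h => Or.inr h.le
  filter_upwards [ev1, ev2, ev3] with ξ hξ1 hξ2 hξ3 p hp hpz hp1
  have hε := norm_nonneg p
  have huy : ‖yOf (zOf p)‖ ≤ ‖p‖ := (norm_yOf_le _).trans (norm_zOf_le _)
  have huw : ‖wOf (zOf p)‖ ≤ ‖p‖ := (norm_wOf_le _).trans (norm_zOf_le _)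
  have huS : ‖sOf (zOf p)‖ ≤ ‖p‖ := (norm_sOf_le _).trans (norm_zOf_le _)
  have hXn : ‖xOf ξ‖ ≤ ‖X‖ + 1 := by
    have := norm_sub_norm_le (xOf ξ) X
    linarith
  obtain ⟨hX'p, hX'0⟩ := hp.shifted
  set X' : Sym n := xOf ξ - sOf (zOf p) with hX'
  have hX'n : ‖X'‖ ≤ ‖X‖ + 2 := by
    have := norm_sub_le (xOf ξ) (sOf (zOf p))
    linarith
  set Z : Sym n := f.kerPart X' with hZ
  have hZK : Z ∈ f.spanK := f.kerPart_mem_spanK X'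
  have hZX : ‖Z - xOf ξ‖ ≤ c2 * ‖p‖ := by
    have h1 : ‖Z - X'‖ ≤ n * (σ * (n * (κ * ‖p‖ * (‖X‖ + 2)))) := by
      refine (f.norm_kerPart_sub_le hX'0).trans ?_
      have h2 : ‖sOf (zOf ξ) - sOf z‖ ≤ κ * ‖p‖ := (norm_sOf_le (zOf ξ - z)).trans hpz
      have h3 := mul_le_mul h2 hX'n (norm_nonneg _) (by positivity)
      gcongr
    have h2 : Z - xOf ξ = (Z - X') - sOf (zOf p) := by rw [hX']; abel
    rw [h2]
    refine (norm_sub_le _ _).trans ((add_le_add h1 huS).trans (le_of_eq ?_))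
    rw [hc2]; ring
  obtain ⟨hn1, hn2⟩ := P.isPointedCone_Q.inner_eq_zero_of_normal hp.dom.1 hp.normal_y
  set q : Vec m := yOf (zOf p) + P.b - P.A (xOf ξ) with hq
  -- By polyhedrality normals at nearby points are normals at the reference point, so `q` uses only
  -- rows active there.
  have hqy : ⟪q, yOf z⟫ = 0 := by
    refine le_antisymm (hn2 _ h.dom.1) ?_
    have h1 : yOf (zOf ξ) - (1 / 2 : ℝ) • yOf z ∈ P.Q := by
      rw [hN]
      intro j
      rw [inner_sub_right, real_inner_smul_right]
      have h2 : ⟪N j, yOf (zOf ξ)⟫ ≤ 0 := by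
        have := hp.dom.1; rw [hN] at this; exact this j
      rcases hξ3 j with h3 | h3
      · rw [h3]; linarith
      · linarith
    have h2 := hn2 _ h1
    rw [inner_sub_right, real_inner_smul_right, hn1] at h2
    linarith
  obtain ⟨l, hl, hlq, hlq0⟩ := exists_active_combination hN h.dom.1 hn2 hqy
  obtain ⟨D, hDK, r, hr0, hrz, hDF, hDA, hDn⟩ := hcorr Y hYK Z hZK l l' hl hl'
  rw [← hlY, ← hlq] at hDn
  have hb1 : ‖P.F (Y - Z)‖ ≤ (L * κ + 1 + cF * c2) * ‖p‖ := by
    have h1 : P.F (Y - Z) = (P.gradConj (-wOf z) - P.gradConj (-wOf (zOf ξ)))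
        - wOf (zOf p) - P.F (Z - xOf ξ) := by
      rw [← hp.grad, map_sub, map_sub, hYc.grad]; abel
    have h2 : ‖P.gradConj (-wOf z) - P.gradConj (-wOf (zOf ξ))‖ ≤ L * (κ * ‖p‖) := by
      refine (hL.norm_sub_le (mem_of_mem_nhds ht) hξ2).trans
        (mul_le_mul_of_nonneg_left ?_ L.coe_nonneg)
      have h3 : -wOf z - -wOf (zOf ξ) = wOf (zOf ξ - z) := by
        rw [wOf_sub]; abel
      rw [h3]
      exact (norm_wOf_le _).trans hpz
    have h3 := (hF (Z - xOf ξ)).trans (mul_le_mul_of_nonneg_left hZX hcF)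
    rw [h1]
    refine (norm_sub_le _ _).trans ((add_le_add ((norm_sub_le _ _).trans
      (add_le_add h2 huw)) h3).trans (le_of_eq (by ring)))
  have hb2 : ‖P.A (Y - Z) + ((P.b - P.A Y) - q)‖ ≤ (1 + cA * c2) * ‖p‖ := by
    have h1 : P.A (Y - Z) + ((P.b - P.A Y) - q) = -yOf (zOf p) - P.A (Z - xOf ξ) := by
      rw [hq, map_sub, map_sub]; abel
    have h3 := (hA (Z - xOf ξ)).trans (mul_le_mul_of_nonneg_left hZX hcA)
    rw [h1]
    refine (norm_sub_le _ _).trans ?_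
    rw [norm_neg]
    exact (add_le_add huy h3).trans (le_of_eq (by ring))
  have hDn' : ‖D‖ ≤ c3 * ‖p‖ := by
    refine hDn.trans ((mul_le_mul_of_nonneg_left (add_le_add hb1 hb2) hc).trans (le_of_eq ?_))
    rw [hc3]; ring
  obtain ⟨θ, hθ0, hθ, hθ1, hpsd⟩ := f.exists_psd_combination hμ hYK hYq hZK
    (f.kerPart_mem_psdCone hX'p) hDK
  have hspan : (1 - θ) • (Z + D) + θ • Y ∈ f.spanK :=
    f.spanK.add_mem (f.spanK.smul_mem _ (f.spanK.add_mem hZK hDK)) (f.spanK.smul_mem _ hYK)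
  obtain ⟨hpol, horth⟩ := combination_mem (P := P) (y := yOf z) hN hr0
    fun j hj => hrz j (hlq0 j hj) (hl0 j hj)
  have hAD : ∑ j, r j • N j = P.b - P.A (Z + D) := by
    rw [← hlY] at hDA
    rw [eq_sub_iff_add_eq, add_comm, hDA]; abel
  rw [hAD] at hpol horth
  have hbA : P.b - P.A ((1 - θ) • (Z + D) + θ • Y)
      = (1 - θ) • (P.b - P.A (Z + D)) + θ • (P.b - P.A Y) := by
    rw [map_add, map_smul, map_smul, smul_sub, smul_sub, sub_smul, one_smul]
    rw [sub_smul, one_smul]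
    abel
  refine ⟨(1 - θ) • (Z + D) + θ • Y, mem_multipliers h.dom hY ?_ hpsd ?_ ?_ ?_, ?_⟩
  · rw [map_add, map_smul, map_smul, hDF, ← add_smul, sub_add_cancel, one_smul]
  · rw [f.inner_S]
    refine Finset.sum_eq_zero fun i _ => ?_
    by_cases hi : f.s i = 0
    · rw [hi, zero_mul]
    · rw [f.mem_spanK.1 hspan i i hi, mul_zero]
  · rw [hbA]
    exact (isPointedCone_polarCone P.Q).add_mem
      ((isPointedCone_polarCone P.Q).smul_mem (sub_nonneg.2 hθ1) hpol)
      ((isPointedCone_polarCone P.Q).smul_mem hθ0 hYc.q_polar)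
  · rw [hbA, inner_add_left, real_inner_smul_left, real_inner_smul_left, horth, hYc.q_orth]
    ring
  -- The distance splits into the cut, the linear correction and the mixing with `Y`; the weight `θ`
  -- of the last is itself proportional to ‖p‖.
  · have h1 : xOf ξ - ((1 - θ) • (Z + D) + θ • Y)
        = -(Z - xOf ξ) - D - θ • (Y - (Z - xOf ξ + xOf ξ) - D) := by
      rw [sub_smul, one_smul, smul_sub, smul_sub, smul_add, smul_add, smul_sub]; abel
    have h2 : ‖Y - (Z - xOf ξ + xOf ξ) - D‖ ≤ M := by
      have e1 : ‖Z - xOf ξ + xOf ξ‖ ≤ c2 + (‖X‖ + 1) := (norm_add_le _ _).trans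
        (add_le_add (hZX.trans (mul_le_of_le_one_right hc20 hp1)) hXn)
      have e2 : ‖D‖ ≤ c3 := hDn'.trans (mul_le_of_le_one_right hc30 hp1)
      have e3 := norm_sub_le (Y - (Z - xOf ξ + xOf ξ)) D
      have e4 := norm_sub_le Y (Z - xOf ξ + xOf ξ)
      rw [hM]; linarith
    have h3 : θ ≤ n * (c3 * ‖p‖) / μ := hθ.trans (by gcongr)
    have h4 : ‖θ • (Y - (Z - xOf ξ + xOf ξ) - D)‖ ≤ n * (c3 * ‖p‖) / μ * M := by
      rw [norm_smul, Real.norm_of_nonneg hθ0]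
      exact mul_le_mul h3 h2 (norm_nonneg _) (by positivity)
    rw [h1]
    have e1 := norm_sub_le (-(Z - xOf ξ) - D) (θ • (Y - (Z - xOf ξ + xOf ξ) - D))
    have e2 := norm_sub_le (-(Z - xOf ξ)) D
    rw [norm_neg] at e2
    have e3 : n * (c3 * ‖p‖) / μ * M = n * c3 / μ * M * ‖p‖ := by ring
    linarith

/-- An error bound for the solutions of perturbed systems is metric subregularity. -/
theorem metricallySubregularAt_of_eventually {E E' : Type*} [NormedAddCommGroup E]
    [InnerProductSpace ℝ E] [NormedAddCommGroup E'] [InnerProductSpace ℝ E'] {T : E → Set E'}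
    {x : E} (h0 : (0 : E') ∈ T x) {κ : ℝ} (hκ : 0 < κ)
    (h : ∀ᶠ x' in 𝓝 x, ∀ p ∈ T x', ∃ x'', (0 : E') ∈ T x'' ∧ ‖x' - x''‖ ≤ κ * ‖p‖) :
    MetricallySubregularAt T x 0 := by
  refine ⟨h0, κ.toNNReal, Real.toNNReal_pos.2 hκ, _, h, fun x' hx' => ?_⟩
  change _ ≤ ENNReal.ofReal κ * _
  have hk0 : ENNReal.ofReal κ ≠ 0 := (ENNReal.ofReal_pos.2 hκ).ne'
  rw [mul_comm, ← ENNReal.div_le_iff hk0 ENNReal.ofReal_ne_top, Metric.le_infEDist]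
  intro p hp
  rw [ENNReal.div_le_iff hk0 ENNReal.ofReal_ne_top]
  obtain ⟨x'', hx'', hle⟩ := hx' p hp
  refine (Metric.infEDist_le_edist_of_mem (s := {x'' | (0 : E') ∈ T x''}) hx'').trans ?_
  rw [edist_dist, edist_dist, dist_zero_left, dist_eq_norm, mul_comm, ← ENNReal.ofReal_mul hκ.le]
  exact ENNReal.ofReal_le_ofReal hle

end ConvexSDP

end SDP

/-! ### Assembly of the theorem -/

theorem mainTheorem2 {W : Type*} [NormedAddCommGroup W] [InnerProductSpace ℝ W]
    [FiniteDimensional ℝ W] {m n r : ℕ} (P : SDP.ConvexSDP W m n)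
    (hsmooth : P.ConjSmooth)
    (ybar : SDP.Vec m) (wbar : W) (Sbar Xbar : SDP.Sym n)
    (hopt : P.IsDualOptimal (SDP.mkZ ybar wbar Sbar))
    (hX : Xbar ∈ P.multipliers (SDP.mkZ ybar wbar Sbar))
    (B : Matrix (Fin r) (Fin m) ℝ)
    (hB : SDP.criticalCone P.Q ybar (P.b - P.A Xbar) = {y | ∀ i, (B *ᵥ y.ofLp) i ≤ 0})
    (hi₁ : IsClosed (P.F '' SDP.coneK Sbar Xbar))
    (hi₂ : ∀ a ∈ SDP.activeSets B,
      IsClosed {v : SDP.Vec m | ∃ G ∈ SDP.coneK Sbar Xbar,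
        ∃ q ∈ SDP.criticalCone (SDP.polarCone P.Q) (P.b - P.A Xbar) ybar ∩
            ((SDP.activeSubspace B a)ᗮ : Submodule ℝ (SDP.Vec m)),
          v = P.A G - q})
    (hii : ∀ d ∈ P.jointCriticalCone (SDP.mkZ ybar wbar Sbar) Xbar ∩
        P.linearizedSet (SDP.mkZ ybar wbar Sbar),
      ⟪SDP.metricProj (SDP.coneK Sbar Xbar) (SDP.xOf d),
        SDP.metricProj (SDP.coneK Sbar Xbar) (SDP.sOf (SDP.zOf d))⟫ = 0)
    (hiii : P.DualSOSC (SDP.mkZ ybar wbar Sbar) Xbar) :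
    (∃ κ : ℝ, 0 < κ ∧ ∃ U ∈ 𝓝 (SDP.mkE (SDP.mkZ ybar wbar Sbar) Xbar),
      ∀ p ξ : SDP.ESpace W m n, p ∈ P.Tl ξ → ξ ∈ U →
        ‖SDP.zOf ξ - SDP.mkZ ybar wbar Sbar‖ ≤ κ * ‖p‖) ∧
    ((∃ L : ℝ≥0, ∃ t ∈ 𝓝 (-wbar), LipschitzOnWith L P.gradConj t) →
      (∃ Xhat ∈ P.multipliers (SDP.mkZ ybar wbar Sbar),
        Xhat.mat.rank + Sbar.mat.rank = n) →
      SDP.MetricallySubregularAt P.Tl (SDP.mkE (SDP.mkZ ybar wbar Sbar) Xbar) 0) := by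
  have hdom := P.dom_of_isDualOptimal hopt
  have hc := P.complementary_of_mem hsmooth hdom hX
  obtain ⟨f⟩ := hc.nonempty_frame
  have hblock : ∀ d ∈ P.critCone (SDP.mkZ ybar wbar Sbar) Xbar, ∀ i j, f.s i = 0 → f.s j = 0 →
      f.c (SDP.sOf d) i j = 0 := fun d hd i j hi hj =>
    hc.c_eq_zero hsmooth hiii hB hii f hd hi hj
  obtain ⟨κ, hκ, U, hU, hmain⟩ := hc.exists_norm_sub_le hsmooth hiii f hblock
  refine ⟨⟨κ, hκ, U, hU, hmain⟩, ?_⟩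
  rintro ⟨L, t, ht, hL⟩ ⟨Y, hY, hr⟩
  obtain ⟨C, hC, hev⟩ := hc.exists_multiplier_near hsmooth f hκ.le ht hL hY hr
  have h0 : (0 : SDP.ESpace W m n) ∈ P.Tl (SDP.mkE (SDP.mkZ ybar wbar Sbar) Xbar) :=
    P.zero_mem_Tl hdom hX
  refine SDP.ConvexSDP.metricallySubregularAt_of_eventually h0
    (κ := κ + C + 1) (by linarith) ?_
  filter_upwards [hev, hU, Metric.ball_mem_nhds _ one_pos] with ξ hξ hξU hξ1 p hp
  have hpn := norm_nonneg p
  -- The multiplier estimate covers perturbations with ‖p‖ ≤ 1. For larger ones the reference point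
  -- itself is close enough, since `ξ` lies in its unit ball; this accounts for the summand `1` in
  -- the constant.
  rcases le_or_gt ‖p‖ 1 with hp1 | hp1
  · have hz := hmain p ξ hp hξU
    obtain ⟨X2, hX2, hle⟩ := hξ p (P.perturbedKKT_of_mem_Tl hsmooth hdom hp) hz hp1
    refine ⟨SDP.mkE (SDP.mkZ ybar wbar Sbar) X2, P.zero_mem_Tl hdom hX2,
      (SDP.norm_E_le _).trans ((add_le_add hz hle).trans ?_)⟩
    linarith
  · refine ⟨_, h0, ?_⟩
    rw [← dist_eq_norm]
    have h1 := (Metric.mem_ball.1 hξ1).le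
    have h2 : 0 ≤ (κ + C) * ‖p‖ := by positivity
    linarith
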